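/- **Setting.** Let $\Omega\subset\mathbb R^2$ be a bounded connected open set with Lipschitz boundary, $\partial_D\Omega\subset\partial\Omega$ closed with $\mathcal H^1(\partial_D\Omega)>0$, and $\partial_N\Omega=\partial\Omega\setminus\partial_D\Omega$. Let $0<\sigma_0<\sigma_1<\overline\sigma<\sigma_{max}$ and let $\gamma\colon[0,\sigma_{max}]\to\overline\Omega$ be the arc-length parametrization of a simple $C^3$ arc $\Gamma$ with $\gamma(0),\gamma(\sigma_{max})\in\partial_N\Omega$, not tangential to $\partial\Omega$ there, and $\gamma(\sigma)\in\Omega$ for $0<\sigma<\sigma_{max}$. Assume that $\Omega\setminus\Gamma=\Omega^+\cup\Omega^-$ with $\Omega^\pm$ disjoint, open, connected, with Lipschitz boundary, lying on the two sides of $\Gamma$ determined by a unit normal field on $\Gamma$, and that $\mathcal H^1(\partial_D\Omega\cap\partial\Omega^\pm)>0$. Put $\Gamma(\sigma)=\gamma([0,\sigma])$. For $\sigma\in[\sigma_0,\overline\sigma]$ let $\Phi_\sigma\colon\Omega\to\Omega$ be a $C^1$ diffeomorphism with inverse $\Psi_\sigma$, equal to the identity near $\partial\Omega$, leaving $\Omega^+$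 and $\Omega^-$ invariant and mapping $\Gamma(\sigma)\cap\Omega$ onto $\Gamma(\sigma_0)\cap\Omega$. Let $$A(\sigma)=(a_{ij}(\sigma))=\det D\Psi_\sigma\,(D\Psi_\sigma)^{-1}(D\Psi_\sigma)^{-T},$$ and assume that $a_{ij}(\sigma)$ extends to an element of $C(\overline\Omega)$ and that $\sigma\mapsto a_{ij}(\sigma)\in C(\overline\Omega)$ is of class $C^2$ on $[\sigma_0,\overline\sigma]$ for the uniform norm. Let $T>0$. Let $\psi\in W^{1,\infty}(0,T;H^1(\Omega))\cap L^\infty(0,T;L^\infty(\Omega))$ and $g\in W^{1,\infty}(0,T;L^2(\partial_N\Omega,\mathcal H^1))$ (continuous representatives) be such that for every $t\in[0,T]$ all points of $\Omega$ in the support of $\psi(t)$ are fixed by every $\Psi_\sigma$, $\sigma\in[\sigma_0,\overline\sigma]$, and the support of $g(t)$ does not intersect $\Gamma$. Let $V$ be the space of the functions in $H^1(\Omega\setminus\Gamma(\sigma_0))$ with zero trace $\mathcal H^1$-a.e. on $\partial_D\Omega$, with $(v,w)_V=\int_{\Omega\setminus\Gamma(\sigma_0)}(Dv|Dw)\,dx$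 and $\|v\|_V=\|Dv\|_{L^2}$. For $t\in[0,T]$, $v\in V$, $\sigma\in[\sigma_0,\overline\sigma]$ let $$\mathcal F(t,v,\sigma)=\int_{\Omega\setminus\Gamma(\sigma_0)}\sum_{i,j}a_{ij}(\sigma)D_j(v+\psi(t))\,D_i(v+\psi(t))\,dx+\sigma-\int_{\partial_N\Omega}g(t)\,(v+\psi(t))\,d\mathcal H^1 .$$ Here $\mathrm{grad}_v\mathcal F(t,v,\sigma)\in V$ represents the Fréchet differential of $\mathcal F(t,\cdot,\sigma)$ at $v$ with respect to $(\cdot,\cdot)_V$, $\partial_\sigma\mathcal F$ is the derivative in $\sigma\in[\sigma_0,\overline\sigma]$ (one-sided at the end points), and $\partial_t\mathcal F$ is the derivative in $t$ at fixed $(v,\sigma)$. Finally let $$\lambda(\sigma)=\frac{(\overline\sigma-\max(\sigma,\sigma_1))^+}{\overline\sigma-\sigma_1}.$$ **Theorem 3.4.** For every $\varepsilon>0$ and every $u_0\in V$ there exist $v_\varepsilon\in C^1([0,T];V)$ and a nondecreasing $C^1$ function $\sigma_\varepsilon\colon[0,T]\to[\sigma_0,\overline\sigma]$ such that $v_\varepsilon(0)=u_0$,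 $\sigma_\varepsilon(0)=\sigma_0$ and, for every $t\in[0,T]$, $$(\varepsilon\dot v_\varepsilon(t),w)_V=-(\mathrm{grad}_v\mathcal F(t,v_\varepsilon(t),\sigma_\varepsilon(t)),w)_V\quad\forall\,w\in V,$$ $$\varepsilon\dot\sigma_\varepsilon(t)=\big(-\partial_\sigma\mathcal F(t,v_\varepsilon(t),\sigma_\varepsilon(t))\big)^+\lambda(\sigma_\varepsilon(t)).$$ Moreover $\lambda(\sigma_\varepsilon(t))>0$ for every $t\in[0,T]$; for a.e. $\tau\in[0,T]$ the function $r\mapsto\mathcal F(r,v_\varepsilon(\tau),\sigma_\varepsilon(\tau))$ is differentiable at $\tau$; the integrands below are integrable on $[0,T]$; and for every $s,t\in[0,T]$ with $s<t$ $$\varepsilon\int_s^t\|\dot v_\varepsilon(\tau)\|_V^2\,d\tau+\varepsilon\int_s^t\frac{|\dot\sigma_\varepsilon(\tau)|^2}{\lambda(\sigma_\varepsilon(\tau))}\,d\tau+\mathcal F(t,v_\varepsilon(t),\sigma_\varepsilon(t))\le\mathcal F(s,v_\varepsilon(s),\sigma_\varepsilon(s))+\int_s^t\partial_t\mathcal F(\tau,v_\varepsilon(\tau),\sigma_\varepsilon(\tau))\,d\tau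 .$$ -/

import Mathlib

open Set Filter Topology MeasureTheory
open scoped ContDiff NNReal

noncomputable section

/-- The Euclidean plane. -/
abbrev Plane : Type := EuclideanSpace ℝ (Fin 2)

namespace Crack

/-- The `i`-th vector of the canonical basis. -/
def unitVec (i : Fin 2) : Plane := EuclideanSpace.single i 1

/-- `S` has Lipschitz boundary: near each boundary point, in suitable orthonormal coordinates
centred at that point, `S` is the part of a rectangle above the graph of a Lipschitz function. -/
def HasLipschitzBoundary (S : Set Plane) : Prop :=
  ∀ x ∈ frontier S, ∃ (L : Plane ≃ₗᵢ[ℝ] Plane) (r h : ℝ) (K : ℝ≥0) (f : ℝ → ℝ),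
    0 < r ∧ 0 < h ∧ LipschitzWith K f ∧ (∀ a : ℝ, |a| < r → |f a| < h) ∧
    ∀ y : Plane, |L (y - x) 0| < r → |L (y - x) 1| < h →
      (y ∈ S ↔ f (L (y - x) 0) < L (y - x) 1)

/-! ### Sobolev functions and traces -/

/-- Pairs consisting of a square integrable function and a square integrable vector field. -/
abbrev Pair (U : Set Plane) : Type :=
  Lp ℝ 2 (volume.restrict U) × Lp Plane 2 (volume.restrict U)

/-- `p` is the distributional gradient of `u` in `U`. -/
def IsWeakGrad (U : Set Plane) (u : Plane → ℝ) (p : Plane → Plane) : Prop :=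
  ∀ φ : Plane → ℝ, ContDiff ℝ ∞ φ → HasCompactSupport φ → tsupport φ ⊆ U → ∀ i : Fin 2,
    ∫ x in U, u x * fderiv ℝ φ x (unitVec i) = - ∫ x in U, p x i * φ x

theorem integrable_mul_of_cpt {U : Set Plane} (u : Lp ℝ 2 (volume.restrict U)) {f : Plane → ℝ}
    (hf : Continuous f) (hc : HasCompactSupport f) :
    Integrable (fun x => u x * f x) (volume.restrict U) :=
  (Lp.memLp u).integrable_mul
    (hf.memLp_of_hasCompactSupport (μ := volume.restrict U) (p := 2) hc)

theorem integrable_coord_mul_of_cpt {U : Set Plane} (p : Lp Plane 2 (volume.restrict U))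
    (i : Fin 2) {f : Plane → ℝ} (hf : Continuous f) (hc : HasCompactSupport f) :
    Integrable (fun x => p x i * f x) (volume.restrict U) := by
  have h : MemLp (fun x => p x i) 2 (volume.restrict U) :=
    (EuclideanSpace.proj (𝕜 := ℝ) i).comp_memLp' (Lp.memLp p)
  exact h.integrable_mul (hf.memLp_of_hasCompactSupport (μ := volume.restrict U) (p := 2) hc)

/-- The Sobolev space `H¹(U)`: an element is a function together with its distributional
gradient. -/
def H1 (U : Set Plane) : Submodule ℝ (Pair U) where
  carrier := {q | IsWeakGrad U q.1 q.2}
  zero_mem' := by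
    intro φ _ _ _ i
    have h1 : ∀ᵐ x ∂(volume.restrict U),
        ((0 : Pair U).1 : Plane → ℝ) x * fderiv ℝ φ x (unitVec i) = 0 := by
      filter_upwards [Lp.coeFn_zero ℝ 2 (volume.restrict U)] with x hx
      rw [Prod.fst_zero, hx, Pi.zero_apply, zero_mul]
    have h2 : ∀ᵐ x ∂(volume.restrict U), ((0 : Pair U).2 : Plane → Plane) x i * φ x = 0 := by
      filter_upwards [Lp.coeFn_zero Plane 2 (volume.restrict U)] with x hx
      rw [Prod.snd_zero, hx, Pi.zero_apply, PiLp.zero_apply, zero_mul]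
    rw [integral_congr_ae h1, integral_congr_ae h2]
    simp
  add_mem' := by
    intro a b ha hb φ hφ hc hs i
    have hd : Continuous fun x => fderiv ℝ φ x (unitVec i) :=
      (hφ.continuous_fderiv (by simp)).clm_apply continuous_const
    have hdc : HasCompactSupport fun x => fderiv ℝ φ x (unitVec i) :=
      hc.fderiv_apply (𝕜 := ℝ) (unitVec i)
    have h1 : ∀ᵐ x ∂(volume.restrict U),
        ((a + b).1 : Plane → ℝ) x * fderiv ℝ φ x (unitVec i) =
          a.1 x * fderiv ℝ φ x (unitVec i) + b.1 x * fderiv ℝ φ x (unitVec i) := by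
      filter_upwards [Lp.coeFn_add a.1 b.1] with x hx
      rw [Prod.fst_add, hx, Pi.add_apply, add_mul]
    have h2 : ∀ᵐ x ∂(volume.restrict U), ((a + b).2 : Plane → Plane) x i * φ x =
        a.2 x i * φ x + b.2 x i * φ x := by
      filter_upwards [Lp.coeFn_add a.2 b.2] with x hx
      rw [Prod.snd_add, hx, Pi.add_apply, PiLp.add_apply, add_mul]
    rw [integral_congr_ae h1, integral_congr_ae h2,
      integral_add (integrable_mul_of_cpt a.1 hd hdc) (integrable_mul_of_cpt b.1 hd hdc),
      integral_add (integrable_coord_mul_of_cpt a.2 i hφ.continuous hc)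
        (integrable_coord_mul_of_cpt b.2 i hφ.continuous hc),
      ha φ hφ hc hs i, hb φ hφ hc hs i, neg_add]
  smul_mem' := by
    intro k a ha φ hφ hc hs i
    have h1 : ∀ᵐ x ∂(volume.restrict U),
        ((k • a).1 : Plane → ℝ) x * fderiv ℝ φ x (unitVec i) =
          k * (a.1 x * fderiv ℝ φ x (unitVec i)) := by
      filter_upwards [Lp.coeFn_smul k a.1] with x hx
      rw [Prod.smul_fst, hx, Pi.smul_apply, smul_eq_mul, mul_assoc]
    have h2 : ∀ᵐ x ∂(volume.restrict U), ((k • a).2 : Plane → Plane) x i * φ x =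
        k * (a.2 x i * φ x) := by
      filter_upwards [Lp.coeFn_smul k a.2] with x hx
      rw [Prod.smul_snd, hx, Pi.smul_apply, PiLp.smul_apply, smul_eq_mul, mul_assoc]
    rw [integral_congr_ae h1, integral_congr_ae h2, integral_const_mul, integral_const_mul,
      ha φ hφ hc hs i, mul_neg]

/-- `c` is the trace of `u` (a function on the open set `U`) at the boundary point `x`: the mean
of `|u - c|` on `U ∩ B(x, r)` tends to `0` as `r → 0`. -/
def HasTraceAt (U : Set Plane) (u : Plane → ℝ) (x : Plane) (c : ℝ) : Prop :=
  Tendsto (fun r : ℝ => ⨍ y in U ∩ Metric.ball x r, |u y - c|) (𝓝[>] 0) (𝓝 0)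

open Classical in
/-- The trace of `u` at `x` (with value `0` at the points where it does not exist). -/
def trace (U : Set Plane) (u : Plane → ℝ) (x : Plane) : ℝ :=
  if h : ∃ c, HasTraceAt U u x c then h.choose else 0

theorem integrable_abs_ball {U : Set Plane} (u : Lp ℝ 2 (volume.restrict U)) (x : Plane) (r : ℝ) :
    Integrable (fun y => |u y|) (volume.restrict (U ∩ Metric.ball x r)) := by
  have h1 : MemLp u 2 (volume.restrict (U ∩ Metric.ball x r)) :=
    (Lp.memLp u).mono_measure (Measure.restrict_mono inter_subset_left le_rfl)
  have hlt : volume (U ∩ Metric.ball x r) < ⊤ :=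
    (measure_mono inter_subset_right).trans_lt measure_ball_lt_top
  have : IsFiniteMeasure (volume.restrict (U ∩ Metric.ball x r)) := ⟨by simpa using hlt⟩
  exact (h1.integrable (by norm_num)).abs

theorem HasTraceAt.add_zero {U : Set Plane} {a b : Lp ℝ 2 (volume.restrict U)} {x : Plane}
    (ha : HasTraceAt U a x 0) (hb : HasTraceAt U b x 0) : HasTraceAt U (a + b : Lp ℝ 2 _) x 0 := by
  unfold HasTraceAt at *
  simp only [sub_zero] at *
  have hsum := ha.add hb
  rw [zero_add] at hsum
  refine squeeze_zero (fun r => ?_) (fun r => ?_) hsum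
  · rw [setAverage_eq]
    exact smul_nonneg (by positivity) (integral_nonneg fun _ => abs_nonneg _)
  · simp only [setAverage_eq, ← smul_add]
    refine smul_le_smul_of_nonneg_left ?_ (by positivity)
    rw [← integral_add (integrable_abs_ball a x r) (integrable_abs_ball b x r)]
    refine integral_mono_ae (integrable_abs_ball _ x r)
      ((integrable_abs_ball a x r).add (integrable_abs_ball b x r)) ?_
    have h := ae_mono (Measure.restrict_mono (μ := (volume : Measure Plane))
      (inter_subset_left (s := U) (t := Metric.ball x r)) le_rfl) (Lp.coeFn_add a b)
    filter_upwards [h] with y hy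
    rw [hy]
    exact abs_add_le _ _

theorem HasTraceAt.smul_zero {U : Set Plane} (k : ℝ) {a : Lp ℝ 2 (volume.restrict U)} {x : Plane}
    (ha : HasTraceAt U a x 0) : HasTraceAt U (k • a : Lp ℝ 2 _) x 0 := by
  unfold HasTraceAt at *
  simp only [sub_zero] at *
  have h := ha.const_mul |k|
  rw [mul_zero] at h
  refine h.congr fun r => ?_
  simp only [setAverage_eq, smul_eq_mul]
  rw [mul_left_comm, ← integral_const_mul]
  congr 1
  have h := ae_mono (Measure.restrict_mono (μ := (volume : Measure Plane))
      (inter_subset_left (s := U) (t := Metric.ball x r)) le_rfl) (Lp.coeFn_smul k a)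
  refine integral_congr_ae ?_
  filter_upwards [h] with y hy
  rw [hy, Pi.smul_apply, smul_eq_mul, abs_mul]

/-- The functions of `H¹(U)` whose trace vanishes almost everywhere on `D` with respect to the
one-dimensional Hausdorff measure. -/
def H1zero (U D : Set Plane) : Submodule ℝ (Pair U) where
  carrier := {q | q ∈ H1 U ∧ ∀ᵐ x ∂μH[1], x ∈ D → HasTraceAt U q.1 x 0}
  zero_mem' := by
    refine ⟨(H1 U).zero_mem, Eventually.of_forall fun x _ => ?_⟩
    have h : HasTraceAt U (fun _ => (0 : ℝ)) x 0 := by simp [HasTraceAt]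
    unfold HasTraceAt at *
    refine h.congr fun r => ?_
    simp only [setAverage_eq]
    congr 1
    have h := ae_mono (Measure.restrict_mono (μ := (volume : Measure Plane))
      (inter_subset_left (s := U) (t := Metric.ball x r)) le_rfl)
      (Lp.coeFn_zero ℝ 2 (volume.restrict U))
    refine integral_congr_ae ?_
    filter_upwards [h] with y hy
    rw [Prod.fst_zero, hy, Pi.zero_apply]
  add_mem' := by
    rintro a b ⟨ha, ha'⟩ ⟨hb, hb'⟩
    refine ⟨(H1 U).add_mem ha hb, ?_⟩
    filter_upwards [ha', hb'] with x h1 h2 hx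
    exact (h1 hx).add_zero (h2 hx)
  smul_mem' := by
    rintro k a ⟨ha, ha'⟩
    refine ⟨(H1 U).smul_mem k ha, ?_⟩
    filter_upwards [ha'] with x h1 hx
    exact (h1 hx).smul_zero k

/-- `H1zero U D` as a type of its own, to be normed by the `L²` norm of the gradient. -/
def SobolevV (U D : Set Plane) : Type := H1zero U D

instance (U D : Set Plane) : AddCommGroup (SobolevV U D) :=
  inferInstanceAs (AddCommGroup (H1zero U D))

instance (U D : Set Plane) : Module ℝ (SobolevV U D) :=
  inferInstanceAs (Module ℝ (H1zero U D))

/-- The underlying function. -/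
def SobolevV.fn {U D : Set Plane} (v : SobolevV U D) : Lp ℝ 2 (volume.restrict U) := v.1.1

/-- The gradient, as a linear map into `L²`. -/
def SobolevV.grad {U D : Set Plane} : SobolevV U D →ₗ[ℝ] Lp Plane 2 (volume.restrict U) :=
  (LinearMap.snd ℝ (Lp ℝ 2 (volume.restrict U)) (Lp Plane 2 (volume.restrict U))).comp
    (H1zero U D).subtype

/-- `‖v‖` is the `L²` norm of the gradient of `v`. -/
instance (U D : Set Plane) : SeminormedAddCommGroup (SobolevV U D) :=
  SeminormedAddCommGroup.induced _ _ SobolevV.grad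

instance (U D : Set Plane) : NormedSpace ℝ (SobolevV U D) :=
  NormedSpace.induced ℝ _ _ SobolevV.grad

/-- The scalar product of `v` and `w` is the `L²` scalar product of their gradients. -/
instance (U D : Set Plane) : InnerProductSpace ℝ (SobolevV U D) where
  inner v w := inner ℝ (SobolevV.grad v) (SobolevV.grad w)
  norm_sq_eq_re_inner v := norm_sq_eq_re_inner (𝕜 := ℝ) (SobolevV.grad v)
  conj_inner_symm v w := inner_conj_symm (SobolevV.grad v) (SobolevV.grad w)
  add_left u v w := by rw [map_add, inner_add_left]
  smul_left u v r := by rw [map_smul, inner_smul_left]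

/-- `f` is the continuous representative of an element of `W^{1,∞}(0,T;X)`: it is a primitive of
an essentially bounded strongly measurable function. -/
def IsW1Infty {X : Type*} [NormedAddCommGroup X] [NormedSpace ℝ X] (T : ℝ) (f : ℝ → X) : Prop :=
  ∃ f' : ℝ → X, MemLp f' ⊤ (volume.restrict (Icc 0 T)) ∧
    ∀ t ∈ Icc 0 T, f t = f 0 + ∫ τ in (0 : ℝ)..t, f' τ

/-! ### The cracked body -/

/-- Jacobian matrix. -/
def jac (f : Plane → Plane) (y : Plane) : Matrix (Fin 2) (Fin 2) ℝ :=
  Matrix.of fun i j => fderiv ℝ f y (unitVec j) i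

/-- Coefficient matrix produced by the change of variables `f` in the Dirichlet energy:
`(a ξ | ξ) = |((Df)ᵀ)⁻¹ ξ|² det Df`. -/
def coeff (f : Plane → Plane) (y : Plane) : Matrix (Fin 2) (Fin 2) ℝ :=
  (jac f y).det • ((jac f y)⁻¹ * ((jac f y)⁻¹).transpose)

/-- Reference configuration, crack path and change of variables. -/
structure CrackedBody where
  /-- reference configuration -/
  Ω : Set Plane
  isOpen_Ω : IsOpen Ω
  isConnected_Ω : IsConnected Ω
  isBounded_Ω : Bornology.IsBounded Ω
  lipschitz_Ω : HasLipschitzBoundary Ω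
  /-- Dirichlet part of the boundary -/
  dirichlet : Set Plane
  isClosed_dirichlet : IsClosed dirichlet
  dirichlet_subset : dirichlet ⊆ frontier Ω
  dirichlet_pos : 0 < μH[1] dirichlet
  /-- initial crack length -/
  σ₀ : ℝ
  /-- crack length up to which the evolution is not modified -/
  σ₁ : ℝ
  /-- maximal length of admissible cracks -/
  σbar : ℝ
  /-- length of the extended crack path -/
  σmax : ℝ
  σ₀_pos : 0 < σ₀
  σ₀_lt : σ₀ < σ₁
  σ₁_lt : σ₁ < σbar
  σbar_lt : σbar < σmax
  /-- arc-length parametrization of the extended crack path, on `[0, σmax]` -/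
  γ : ℝ → Plane
  contDiff_γ : ContDiffOn ℝ 3 γ (Icc 0 σmax)
  unitSpeed_γ : ∀ s ∈ Icc 0 σmax, ‖derivWithin γ (Icc 0 σmax) s‖ = 1
  injOn_γ : InjOn γ (Icc 0 σmax)
  γ_mem : ∀ s ∈ Ioo 0 σmax, γ s ∈ Ω
  γ_zero_mem : γ 0 ∈ frontier Ω \ dirichlet
  γ_σmax_mem : γ σmax ∈ frontier Ω \ dirichlet
  /-- the path is not tangential to the boundary at its end points -/
  not_tangent_zero : derivWithin γ (Icc 0 σmax) 0 ∉ tangentConeAt ℝ (frontier Ω) (γ 0)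
  not_tangent_σmax : derivWithin γ (Icc 0 σmax) σmax ∉ tangentConeAt ℝ (frontier Ω) (γ σmax)
  /-- unit normal field along the path -/
  ν : ℝ → Plane
  continuousOn_ν : ContinuousOn ν (Icc 0 σmax)
  norm_ν : ∀ s ∈ Icc 0 σmax, ‖ν s‖ = 1
  ν_perp : ∀ s ∈ Icc 0 σmax, inner ℝ (ν s) (derivWithin γ (Icc 0 σmax) s) = 0
  /-- the part of `Ω` on the positive side of the path -/
  Ωp : Set Plane
  /-- the part of `Ω` on the negative side of the path -/
  Ωm : Set Plane
  isOpen_Ωp : IsOpen Ωp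
  isOpen_Ωm : IsOpen Ωm
  isConnected_Ωp : IsConnected Ωp
  isConnected_Ωm : IsConnected Ωm
  union_eq : Ωp ∪ Ωm = Ω \ γ '' Icc 0 σmax
  disjoint_pm : Disjoint Ωp Ωm
  side_p : ∀ s ∈ Ioo 0 σmax, ∀ᶠ h in 𝓝[>] (0 : ℝ), γ s + h • ν s ∈ Ωp
  side_m : ∀ s ∈ Ioo 0 σmax, ∀ᶠ h in 𝓝[>] (0 : ℝ), γ s - h • ν s ∈ Ωm
  lipschitz_Ωp : HasLipschitzBoundary Ωp
  lipschitz_Ωm : HasLipschitzBoundary Ωm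
  dirichlet_pos_p : 0 < μH[1] (dirichlet ∩ frontier Ωp)
  dirichlet_pos_m : 0 < μH[1] (dirichlet ∩ frontier Ωm)
  /-- diffeomorphisms of `Ω` carrying the crack of length `σ` to the one of length `σ₀` -/
  Φ : ℝ → Plane → Plane
  /-- the inverse diffeomorphisms -/
  Ψ : ℝ → Plane → Plane
  mapsTo_Φ : ∀ σ ∈ Icc σ₀ σbar, MapsTo (Φ σ) Ω Ω
  mapsTo_Ψ : ∀ σ ∈ Icc σ₀ σbar, MapsTo (Ψ σ) Ω Ω
  invOn_ΨΦ : ∀ σ ∈ Icc σ₀ σbar, InvOn (Ψ σ) (Φ σ) Ω Ω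
  contDiff_Φ : ∀ σ ∈ Icc σ₀ σbar, ContDiffOn ℝ 1 (Φ σ) Ω
  contDiff_Ψ : ∀ σ ∈ Icc σ₀ σbar, ContDiffOn ℝ 1 (Ψ σ) Ω
  Φ_eq_id : ∀ σ ∈ Icc σ₀ σbar, ∃ N : Set Plane, IsOpen N ∧ frontier Ω ⊆ N ∧
    ∀ x ∈ N ∩ Ω, Φ σ x = x
  Φ_image_p : ∀ σ ∈ Icc σ₀ σbar, Φ σ '' Ωp = Ωp
  Φ_image_m : ∀ σ ∈ Icc σ₀ σbar, Φ σ '' Ωm = Ωm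
  Φ_image_crack : ∀ σ ∈ Icc σ₀ σbar, Φ σ '' (γ '' Icc 0 σ ∩ Ω) = γ '' Icc 0 σ₀ ∩ Ω
  /-- the coefficients extend continuously to the closure of `Ω`, and are of class `C²` in `σ`
  with values in the continuous functions on the closure of `Ω` with the uniform norm -/
  coeff_C2 : ∀ i j : Fin 2, ∃ b : ℝ → BoundedContinuousFunction (closure Ω) ℝ,
    ContDiffOn ℝ 2 b (Icc σ₀ σbar) ∧
    ∀ σ ∈ Icc σ₀ σbar, ∀ x : closure Ω, (x : Plane) ∈ Ω → b σ x = coeff (Ψ σ) x i j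

namespace CrackedBody

variable (B : CrackedBody)

/-- Neumann part of the boundary. -/
def neumann : Set Plane := frontier B.Ω \ B.dirichlet

/-- The crack of length `σ`. -/
def crack (σ : ℝ) : Set Plane := B.γ '' Icc 0 σ

/-- The reference configuration without the initial crack. -/
def U : Set Plane := B.Ω \ B.crack B.σ₀

/-- The space of `H¹` functions on the complement of the initial crack with zero trace on the
Dirichlet part of the boundary, normed by the `L²` norm of the gradient. -/
abbrev V : Type := SobolevV B.U B.dirichlet

/-- The coefficients `a_{ij}(σ)` at the point `y`. -/
def A (σ : ℝ) (y : Plane) : Matrix (Fin 2) (Fin 2) ℝ := coeff (B.Ψ σ) y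

/-- The cut-off factor. -/
def cutoff (σ : ℝ) : ℝ := max (B.σbar - max σ B.σ₁) 0 / (B.σbar - B.σ₁)

end CrackedBody

/-- Time-dependent boundary displacement and boundary force on `[0, T]`. -/
structure Loads (B : CrackedBody) (T : ℝ) where
  /-- boundary displacement, extended to `Ω` (with its gradient) -/
  ψ : ℝ → Pair B.Ω
  ψ_mem : ∀ t ∈ Icc 0 T, ψ t ∈ H1 B.Ω
  ψ_W1 : IsW1Infty T ψ
  ψ_bdd : ∃ M : ℝ, ∀ t ∈ Icc 0 T, ∀ᵐ x ∂(volume.restrict B.Ω), |(ψ t).1 x| ≤ M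
  /-- the support of `ψ t` consists of points that are fixed by all the changes of variables -/
  ψ_supp : ∀ t ∈ Icc 0 T, ∀ y ∈ B.Ω, (∃ σ ∈ Icc B.σ₀ B.σbar, B.Ψ σ y ≠ y) →
    ∃ W ∈ 𝓝 y, ∀ᵐ x ∂(volume.restrict B.Ω), x ∈ W → (ψ t).1 x = 0
  /-- boundary force -/
  g : ℝ → Lp ℝ 2 ((μH[1] : Measure Plane).restrict B.neumann)
  g_W1 : IsW1Infty T g
  /-- the support of `g t` does not intersect the crack path -/
  g_supp : ∀ t ∈ Icc 0 T, ∀ y ∈ B.crack B.σmax,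
    ∃ W ∈ 𝓝 y, ∀ᵐ x ∂((μH[1] : Measure Plane).restrict B.neumann), x ∈ W → g t x = 0

variable {B : CrackedBody} {T : ℝ}

/-- The energy `ℱ(t, v, σ)`. -/
def Loads.F (P : Loads B T) (t : ℝ) (v : B.V) (σ : ℝ) : ℝ :=
  (∫ x in B.U, ∑ i, ∑ j, B.A σ x i j * (v.grad x j + (P.ψ t).2 x j) *
      (v.grad x i + (P.ψ t).2 x i))
    + σ - ∫ x in B.neumann, P.g t x * trace B.U (fun y => v.fn y + (P.ψ t).1 y) x ∂μH[1]

/-- `G` is the gradient of `ℱ(t, ·, σ)` at `v` in the space `V`. -/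
def Loads.IsGradV (P : Loads B T) (t : ℝ) (v : B.V) (σ : ℝ) (G : B.V) : Prop :=
  HasFDerivAt (fun w : B.V => P.F t w σ) (innerSL ℝ G) v

/-- `d` is the partial derivative of `ℱ` with respect to `σ ∈ [σ₀, σbar]`
(one-sided at the end points). -/
def Loads.IsDerivσ (P : Loads B T) (t : ℝ) (v : B.V) (σ d : ℝ) : Prop :=
  HasDerivWithinAt (fun s : ℝ => P.F t v s) d (Icc B.σ₀ B.σbar) σ

/-- The partial derivative of `ℱ` with respect to time. -/
def Loads.dtF (P : Loads B T) (t : ℝ) (v : B.V) (σ : ℝ) : ℝ :=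
  deriv (fun r : ℝ => P.F r v σ) t

/-- `(v, σ)`, with derivatives `(v', σ')`, is a solution on `[0, T]` of the initial value problem
for the modified `ε`-gradient flow, with initial data `(u₀, σ₀)`. -/
structure Loads.IsFlow (P : Loads B T) (ε : ℝ) (u₀ : B.V) (v v' : ℝ → B.V) (σ σ' : ℝ → ℝ) :
    Prop where
  deriv_v : ∀ t ∈ Icc 0 T, HasDerivWithinAt v (v' t) (Icc 0 T) t
  continuous_v' : ContinuousOn v' (Icc 0 T)
  deriv_σ : ∀ t ∈ Icc 0 T, HasDerivWithinAt σ (σ' t) (Icc 0 T) t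
  continuous_σ' : ContinuousOn σ' (Icc 0 T)
  σ_mem : ∀ t ∈ Icc 0 T, σ t ∈ Icc B.σ₀ B.σbar
  σ_mono : MonotoneOn σ (Icc 0 T)
  eq_v : ∀ t ∈ Icc 0 T, ∃ G : B.V, P.IsGradV t (v t) (σ t) G ∧
    ∀ w : B.V, inner ℝ (ε • v' t) w = - inner ℝ G w
  eq_σ : ∀ t ∈ Icc 0 T, ∃ d : ℝ, P.IsDerivσ t (v t) (σ t) d ∧
    ε * σ' t = max (-d) 0 * B.cutoff (σ t)
  v_zero : v 0 = u₀
  σ_zero : σ 0 = B.σ₀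

end Crack

end

open scoped ENNReal

noncomputable section

namespace Crack

/-! The system is an ordinary differential equation in `V × ℝ`. The energy has the form `b σ (Dv + p
t) (Dv + p t) + σ - (g t | tr v) - m t`, where `b σ` is a bounded bilinear form of class `C²` in
`σ`, `p t` is the gradient of `ψ t`, and `m t` is the work of `g t` on `ψ t`. Its partial gradients
in `v` and in `σ` are therefore bounded and Lipschitz in `(t, v, σ)` as long as `v` stays bounded,
and the gradient in `v` grows at most linearly in `v`, uniformly in `t` and `σ`. Picard-Lindelöf
together with Gronwall's inequality gives a solution on all of `[0, T]`
(`exists_solution_of_linear_growth`). The factor `λ` vanishes at `σbar`, so the constant `σbar`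
solves the scalar equation; by uniqueness `σ` cannot reach it, and `λ(σ) > 0` persists
(`EnergyData.IsSol.lt_σbar`).

The loads are only Lipschitz in time. The energy along the solution is then Lipschitz, hence the
integral of its derivative, and the chain rule holds at almost every time. Inserting the equations
turns the contribution of the velocities into `-ε‖v'‖² - ε σ'² / λ(σ)`, and integration gives the
energy inequality, in fact with equality (`EnergyData.IsSol.energy_balance`).

What remains is that the spaces behave as this argument requires. Two facts are needed: `V` with the
`L²` norm of the gradient is complete and its norm is definite, and the trace is a bounded operator
into `L²` of the Neumann boundary. The first follows from a Poincaré inequality on each of the two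
sides of the crack path, each of which carries a piece of the Dirichlet boundary of positive length
(`CrackedBody.exists_poincare`); the second is `CrackedBody.traceBound`. Both are derived from one
identity: the increment of a Sobolev function along a segment is the integral of its weak gradient
(`IsSobolev.ae_sub_eq`). Averaging it over a ball gives Poincaré inequalities in balls; translations
in graph charts carry them up to the boundary, and connectedness and compactness make them global.
Applied along the vertical lines of a chart, it yields the boundary values, and Lebesgue points show
that these are the limits of means over small balls by which the trace is defined. -/

/-! ### Difference quotients of Sobolev functions -/

/-- `u` is a square integrable function on `U` with square integrable distributional gradient `p`,
both given by measurable representatives. -/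
structure IsSobolev (U : Set Plane) (u : Plane → ℝ) (p : Plane → Plane) : Prop where
  meas : StronglyMeasurable u
  meas_grad : StronglyMeasurable p
  memLp : MemLp u 2 (volume.restrict U)
  memLp_grad : MemLp p 2 (volume.restrict U)
  weak : IsWeakGrad U u p

theorem eq_sum_unitVec (z : Plane) : z = z 0 • unitVec 0 + z 1 • unitVec 1 := by
  ext i
  fin_cases i <;> simp [unitVec]

theorem MemLp.inner_plane {μ : Measure Plane} {p : Plane → Plane} (hp : MemLp p 2 μ) (z : Plane) :
    MemLp (fun x => inner ℝ (p x) z) 2 μ := by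
  have := (innerSL ℝ z).comp_memLp' hp
  refine this.congr_norm ?_ ?_
  · exact (hp.1.inner aestronglyMeasurable_const)
  · filter_upwards with x
    simp [real_inner_comm]

theorem IsSobolev.weak_dir {U : Set Plane} {u : Plane → ℝ} {p : Plane → Plane}
    (h : IsSobolev U u p) (z : Plane) {φ : Plane → ℝ} (hφ : ContDiff ℝ ∞ φ)
    (hc : HasCompactSupport φ) (hs : tsupport φ ⊆ U) :
    ∫ x in U, u x * fderiv ℝ φ x z = - ∫ x in U, inner ℝ (p x) z * φ x := by
  have hi : ∀ i, Integrable (fun x => u x * fderiv ℝ φ x (unitVec i)) (volume.restrict U) := by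
    intro i
    have hd : Continuous fun x => fderiv ℝ φ x (unitVec i) :=
      (hφ.continuous_fderiv (by simp)).clm_apply continuous_const
    exact h.memLp.integrable_mul (hd.memLp_of_hasCompactSupport (μ := volume.restrict U) (p := 2)
      (hc.fderiv_apply (𝕜 := ℝ) (unitVec i)))
  have hj : ∀ i : Fin 2, Integrable (fun x => p x i * φ x) (volume.restrict U) := by
    intro i
    have h' : MemLp (fun x => p x i) 2 (volume.restrict U) :=
      (EuclideanSpace.proj (𝕜 := ℝ) i).comp_memLp' h.memLp_grad
    exact h'.integrable_mul
      (hφ.continuous.memLp_of_hasCompactSupport (μ := volume.restrict U) (p := 2) hc)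
  have e1 : ∀ x, u x * fderiv ℝ φ x z = z 0 * (u x * fderiv ℝ φ x (unitVec 0)) +
      z 1 * (u x * fderiv ℝ φ x (unitVec 1)) := by
    intro x
    conv_lhs => rw [eq_sum_unitVec z]
    simp only [map_add, map_smul, smul_eq_mul]
    ring
  have e2 : ∀ x, inner ℝ (p x) z * φ x = z 0 * (p x 0 * φ x) + z 1 * (p x 1 * φ x) := by
    intro x
    simp only [PiLp.inner_apply, Fin.sum_univ_two, RCLike.inner_apply, conj_trivial]
    ring
  simp only [e1, e2]
  rw [integral_add ((hi 0).const_mul _) ((hi 1).const_mul _),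
    integral_add ((hj 0).const_mul _) ((hj 1).const_mul _)]
  simp only [integral_const_mul]
  rw [h.weak φ hφ hc hs 0, h.weak φ hφ hc hs 1]
  ring

/-- Since `|q| ≤ 1 + q²`, translation invariance bounds the integral over `K` by `|K| + ‖q‖²` for
every value of the shift parameter. This legitimates the Fubini exchanges along segments. -/
theorem integrable_line_shift {q : Plane → ℝ} (hqm : StronglyMeasurable q)
    (hq : MemLp q 2 volume) (z : Plane) {K : Set Plane} (hK : volume K < ⊤) :
    Integrable (fun y : Plane × ℝ => q (y.1 + y.2 • z))
      ((volume.restrict K).prod (volume.restrict (Ioc (0 : ℝ) 1))) := by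
  have hm : StronglyMeasurable (fun y : Plane × ℝ => q (y.1 + y.2 • z)) :=
    hqm.comp_measurable (by fun_prop)
  refine ⟨hm.aestronglyMeasurable, ?_⟩
  have hfin : ∫⁻ x, ‖q x‖ₑ ^ 2 < ⊤ := by
    have := hq.eLpNorm_lt_top
    rw [eLpNorm_lt_top_iff_lintegral_rpow_enorm_lt_top (by simp) (by simp)] at this
    simpa using this
  have : IsFiniteMeasure (volume.restrict K) := ⟨by simpa using hK⟩
  rw [hasFiniteIntegral_iff_enorm, lintegral_prod_symm _ hm.enorm.aemeasurable]
  calc _ ≤ ∫⁻ _ in Ioc (0 : ℝ) 1, (volume K + ∫⁻ x, ‖q x‖ₑ ^ 2) := by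
        refine lintegral_mono fun τ => ?_
        calc ∫⁻ x in K, ‖q (x + τ • z)‖ₑ ≤ ∫⁻ x in K, (1 + ‖q (x + τ • z)‖ₑ ^ 2) := by
              refine lintegral_mono fun x => ?_
              rcases le_total ‖q (x + τ • z)‖ₑ 1 with h | h
              · exact h.trans le_self_add
              · calc _ = ‖q (x + τ • z)‖ₑ * 1 := (mul_one _).symm
                  _ ≤ ‖q (x + τ • z)‖ₑ ^ 2 := by rw [sq]; gcongr
                  _ ≤ _ := le_add_self
          _ = volume K + ∫⁻ x in K, ‖q (x + τ • z)‖ₑ ^ 2 := by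
              rw [lintegral_add_left measurable_const]; simp
          _ ≤ volume K + ∫⁻ x, ‖q (x + τ • z)‖ₑ ^ 2 := by
              gcongr; exact Measure.restrict_le_self
          _ = _ := by
              rw [lintegral_add_right_eq_self (fun x => ‖q x‖ₑ ^ 2)]
    _ < ⊤ := by simp [hK, hfin]

/-- Fundamental theorem of calculus along a fixed translation, obtained by duality. Against a test
function `φ` supported in `W`, the increment of `u` becomes an increment of `φ`, which is an
integral of `-∂_z φ (· - τ z)` over `τ`. For each `τ` the translate of `φ` is still supported in
`U`, so the weak gradient can be inserted; undoing the translation puts `p (x + τ z)` against `φ`.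
-/
theorem IsSobolev.ae_sub_eq {U W : Set Plane} {u : Plane → ℝ} {p : Plane → Plane}
    (h : IsSobolev U u p) (hU : IsOpen U) (hW : IsOpen W) (z : Plane)
    (hWU : ∀ x ∈ W, ∀ τ ∈ Icc (0 : ℝ) 1, x + τ • z ∈ U) :
    ∀ᵐ x, x ∈ W → u (x + z) - u x = ∫ τ in (0 : ℝ)..1, inner ℝ (p (x + τ • z)) z := by
  -- Extension by zero outside `U` lets every integral run over the whole plane, where translations
  -- preserve the measure.
  set q : Plane → ℝ := U.indicator fun y => inner ℝ (p y) z with hqdef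
  set v : Plane → ℝ := U.indicator u with hvdef
  have hqm : StronglyMeasurable q :=
    (h.meas_grad.inner stronglyMeasurable_const).indicator hU.measurableSet
  have hvm : StronglyMeasurable v := h.meas.indicator hU.measurableSet
  have hq : MemLp q 2 volume :=
    (memLp_indicator_iff_restrict hU.measurableSet).2 (MemLp.inner_plane h.memLp_grad z)
  have hv : MemLp v 2 volume := (memLp_indicator_iff_restrict hU.measurableSet).2 h.memLp
  have hvz : MemLp (fun x => v (x + z)) 2 volume :=
    hv.comp_measurePreserving (measurePreserving_add_right volume z)
  set Q : Plane → ℝ := fun x => ∫ τ in (0 : ℝ)..1, q (x + τ • z) with hQ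
  have hQint : ∀ K : Set Plane, volume K < ⊤ → IntegrableOn Q K := by
    intro K hK
    have := (integrable_line_shift hqm hq z hK).integral_prod_left
    simp only [hQ, intervalIntegral.integral_of_le zero_le_one]
    exact this
  have hQloc : LocallyIntegrable Q volume := by
    rw [locallyIntegrable_iff]
    exact fun K hK => hQint K hK.measure_lt_top
  have hfloc : LocallyIntegrable (fun x => v (x + z) - v x - Q x) volume :=
    ((hvz.locallyIntegrable (by norm_num)).sub (hv.locallyIntegrable (by norm_num))).sub hQloc
  have key := hW.ae_eq_zero_of_integral_contDiff_smul_eq_zero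
    (hfloc.locallyIntegrableOn W) (fun φ hφ hc hs => ?_)
  · filter_upwards [key] with x hx hxW
    have h0 : x ∈ U := by simpa using hWU x hxW 0 (by simp)
    have h1 : x + z ∈ U := by simpa using hWU x hxW 1 (by simp)
    have h2 : Q x = ∫ τ in (0 : ℝ)..1, inner ℝ (p (x + τ • z)) z := by
      refine intervalIntegral.integral_congr fun τ hτ => ?_
      rw [uIcc_of_le zero_le_one] at hτ
      simp [hqdef, hWU x hxW τ hτ]
    have := hx hxW
    simp only [hvdef, indicator_of_mem h0, indicator_of_mem h1] at this
    rw [← h2]; linarith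
  have hφc : Continuous φ := hφ.continuous
  have hφ2 : MemLp φ 2 volume := hφc.memLp_of_hasCompactSupport hc
  have hdc : Continuous fun x => fderiv ℝ φ x z :=
    (hφ.continuous_fderiv (by simp)).clm_apply continuous_const
  obtain ⟨C, hC⟩ := hdc.bounded_above_of_compact_support (hc.fderiv_apply (𝕜 := ℝ) z)
  -- the region swept by the support
  set K : Set Plane := (fun y : Plane × ℝ => y.1 + y.2 • z) '' (tsupport φ ×ˢ Icc (0 : ℝ) 1)
    with hKdef
  have hKc : IsCompact K := (hc.isCompact.prod isCompact_Icc).image (by fun_prop)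
  have hsupp : ∀ y, ∀ τ ∈ Icc (0 : ℝ) 1, y - τ • z ∈ tsupport φ → y ∈ K := fun y τ hτ hy =>
    ⟨(y - τ • z, τ), ⟨hy, hτ⟩, by simp⟩
  have eA : ∫ x, φ x * (v (x + z) - v x) = ∫ y, v y * (φ (y - z) - φ y) := by
    have hφz : MemLp (fun x => φ (x - z)) 2 volume :=
      hφ2.comp_measurePreserving (measurePreserving_sub_right volume z)
    simp only [mul_sub]
    have a1 : Integrable fun x => φ x * v (x + z) := hφ2.integrable_mul hvz
    have a2 : Integrable fun x => φ x * v x := hφ2.integrable_mul hv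
    have a3 : Integrable fun x => v x * φ (x - z) := hv.integrable_mul hφz
    have a4 : Integrable fun x => v x * φ x := hv.integrable_mul hφ2
    rw [integral_sub a1 a2, integral_sub a3 a4]
    congr 1
    · rw [← integral_sub_right_eq_self (fun x => φ x * v (x + z)) z]
      simp [mul_comm]
    · simp [mul_comm]
  have eB : ∀ y, φ (y - z) - φ y = ∫ τ in (0 : ℝ)..1, - fderiv ℝ φ (y - τ • z) z := by
    intro y
    have hd : ∀ τ : ℝ, HasDerivAt (fun τ : ℝ => φ (y - τ • z)) (- fderiv ℝ φ (y - τ • z) z) τ := by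
      intro τ
      have h1 : HasDerivAt (fun τ : ℝ => y - τ • z) (-z) τ := by
        simpa using ((hasDerivAt_id τ).smul_const z).const_sub y
      have h2 := ((hφ.differentiable (by simp)) (y - τ • z)).hasFDerivAt.comp_hasDerivAt τ h1
      simpa [Function.comp_def] using h2
    rw [intervalIntegral.integral_eq_sub_of_hasDerivAt (fun τ _ => hd τ)
      ((by fun_prop : Continuous fun τ : ℝ => - fderiv ℝ φ (y - τ • z) z).intervalIntegrable _ _)]
    simp
  have eC : ∫ y, v y * (φ (y - z) - φ y) =
      ∫ τ in (0 : ℝ)..1, ∫ y, v y * - fderiv ℝ φ (y - τ • z) z := by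
    simp only [eB, ← intervalIntegral.integral_const_mul]
    simp only [intervalIntegral.integral_of_le zero_le_one]
    rw [integral_integral_swap]
    -- Fubini majorant: `C |v|` on the compact region `K`. Off `K` the derivative of every translate
    -- of `φ` vanishes, and on `K` the square integrable `v` is integrable.
    have hKi : Integrable (K.indicator v) volume := by
      rw [integrable_indicator_iff hKc.measurableSet]
      exact (hv.locallyIntegrable (by norm_num)).integrableOn_isCompact hKc
    have hprod : Integrable (fun y : Plane × ℝ => K.indicator v y.1 * C)
        (volume.prod (volume.restrict (Ioc (0 : ℝ) 1))) :=
      hKi.mul_prod (integrable_const C)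
    refine hprod.mono ?_ ?_
    · refine ((hvm.comp_measurable measurable_fst).mul ?_).aestronglyMeasurable
      exact (hdc.comp (by fun_prop : Continuous fun y : Plane × ℝ =>
        y.1 - y.2 • z)).neg.stronglyMeasurable
    · have : ∀ᵐ y : Plane × ℝ ∂(volume.prod (volume.restrict (Ioc (0 : ℝ) 1))),
          y.2 ∈ Ioc (0 : ℝ) 1 :=
        Measure.quasiMeasurePreserving_snd.ae (ae_restrict_mem measurableSet_Ioc)
      filter_upwards [this] with y hy
      by_cases hyK : y.1 ∈ K
      · simp only [Function.uncurry, indicator_of_mem hyK, norm_mul, norm_neg]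
        gcongr
        exact (hC _).trans (le_abs_self C)
      · have : fderiv ℝ φ (y.1 - y.2 • z) = 0 := by
          by_contra hne
          exact hyK (hsupp _ _ (Ioc_subset_Icc_self hy)
            (support_fderiv_subset ℝ (Function.mem_support.2 hne)))
        simp [Function.uncurry, this, hyK]
  have eD : ∀ τ ∈ Icc (0 : ℝ) 1, ∫ y, v y * - fderiv ℝ φ (y - τ • z) z =
      ∫ x, φ x * q (x + τ • z) := by
    intro τ hτ
    have hφτ : ContDiff ℝ ∞ fun y => φ (y - τ • z) := hφ.comp (by fun_prop)
    have hcτ : HasCompactSupport fun y => φ (y - τ • z) := by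
      have := hc.comp_homeomorph (Homeomorph.subRight (τ • z))
      simpa [Function.comp_def] using this
    have hsτ : tsupport (fun y => φ (y - τ • z)) ⊆ U := by
      have h1 : tsupport (fun y => φ (y - τ • z)) = (fun y => y - τ • z) ⁻¹' tsupport φ :=
        tsupport_comp_eq_preimage φ (Homeomorph.subRight (τ • z))
      rw [h1]
      intro y hy
      simpa using hWU _ (hs hy) τ hτ
    have hw := h.weak_dir z hφτ hcτ hsτ
    have hf : ∀ y, fderiv ℝ (fun y => φ (y - τ • z)) y z = fderiv ℝ φ (y - τ • z) z := by
      intro y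
      rw [fderiv_comp_sub]
    simp only [hf] at hw
    rw [← integral_indicator hU.measurableSet, ← integral_indicator hU.measurableSet] at hw
    calc ∫ y, v y * - fderiv ℝ φ (y - τ • z) z
        = - ∫ y, U.indicator (fun x => u x * fderiv ℝ φ (x - τ • z) z) y := by
          rw [← integral_neg]
          refine integral_congr_ae (Eventually.of_forall fun y => ?_)
          by_cases hy : y ∈ U <;> simp [hvdef, hy]
      _ = ∫ y, U.indicator (fun x => inner ℝ (p x) z * φ (x - τ • z)) y := by rw [hw, neg_neg]
      _ = ∫ y, φ (y - τ • z) * q y := by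
          refine integral_congr_ae (Eventually.of_forall fun y => ?_)
          by_cases hy : y ∈ U <;> simp [hqdef, hy, mul_comm]
      _ = _ := by
          rw [← integral_sub_right_eq_self (fun x => φ x * q (x + τ • z)) (τ • z)]
          simp
  have eE : ∫ τ in (0 : ℝ)..1, ∫ x, φ x * q (x + τ • z) = ∫ x, φ x * Q x := by
    simp only [hQ, ← intervalIntegral.integral_const_mul]
    simp only [intervalIntegral.integral_of_le zero_le_one]
    rw [integral_integral_swap]
    obtain ⟨D, hD⟩ := hφc.bounded_above_of_compact_support hc
    have h1 := integrable_line_shift hqm hq z hc.isCompact.measure_lt_top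
    have h2 : Integrable (fun y : Plane × ℝ => φ y.1 * q (y.1 + y.2 • z))
        ((volume.restrict (tsupport φ)).prod (volume.restrict (Ioc (0 : ℝ) 1))) :=
      h1.bdd_mul (c := D) (hφc.comp continuous_fst).aestronglyMeasurable
        (Eventually.of_forall fun y => hD _)
    have h3 : Integrable (fun y : Plane × ℝ => φ y.1 * q (y.1 + y.2 • z))
        (volume.prod (volume.restrict (Ioc (0 : ℝ) 1))) := by
      have hr : (volume.restrict (tsupport φ)).prod (volume.restrict (Ioc (0 : ℝ) 1)) =
          (volume.prod (volume.restrict (Ioc (0 : ℝ) 1))).restrict (tsupport φ ×ˢ univ) := by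
        rw [← Measure.prod_restrict, Measure.restrict_univ]
      rw [hr] at h2
      refine (integrableOn_iff_integrable_of_support_subset fun y hy => ?_).1 h2
      refine ⟨subset_tsupport _ ?_, mem_univ _⟩
      exact fun h0 => hy (by simp [h0])
    exact h3.swap
  have eF : ∫ x, φ x * (v (x + z) - v x) = ∫ x, φ x * Q x := by
    rw [eA, eC, ← eE]
    refine intervalIntegral.integral_congr fun τ hτ => ?_
    rw [uIcc_of_le zero_le_one] at hτ
    exact eD τ hτ
  have i1 : Integrable (fun x => φ x * (v (x + z) - v x)) volume := hφ2.integrable_mul (hvz.sub hv)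
  have i2 : Integrable (fun x => φ x * Q x) volume := by
    simpa using hQloc.integrable_smul_left_of_hasCompactSupport hφc hc
  simp only [smul_eq_mul, mul_sub (φ _) _ (Q _)]
  rw [integral_sub i1 i2, eF, sub_self]

theorem ENNReal_add_sq_le (a b : ℝ≥0∞) : (a + b) ^ 2 ≤ 2 * (a ^ 2 + b ^ 2) := by
  rcases eq_or_ne a ⊤ with rfl | ha
  · simp
  rcases eq_or_ne b ⊤ with rfl | hb
  · simp
  lift a to ℝ≥0 using ha
  lift b to ℝ≥0 using hb
  exact_mod_cast add_sq_le (a := a) (b := b)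

theorem enorm_sub_sq_le {F : Type*} [SeminormedAddCommGroup F] (a b c : F) :
    ‖a - c‖ₑ ^ 2 ≤ 2 * (‖a - b‖ₑ ^ 2 + ‖b - c‖ₑ ^ 2) := by
  refine le_trans ?_ (ENNReal_add_sq_le _ _)
  gcongr
  calc ‖a - c‖ₑ = ‖(a - b) + (b - c)‖ₑ := by rw [sub_add_sub_cancel]
    _ ≤ _ := by
        simp only [enorm_eq_nnnorm, ← ENNReal.coe_add, ENNReal.coe_le_coe]
        exact nnnorm_add_le _ _

theorem sq_lintegral_le {α : Type*} [MeasurableSpace α] (μ : Measure α) {f : α → ℝ≥0∞}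
    (hf : AEMeasurable f μ) : (∫⁻ x, f x ∂μ) ^ 2 ≤ μ univ * ∫⁻ x, f x ^ 2 ∂μ := by
  have h := ENNReal.lintegral_mul_le_Lp_mul_Lq μ Real.HolderConjugate.two_two hf
    (aemeasurable_const (b := (1 : ℝ≥0∞)))
  simp only [Pi.mul_apply, mul_one, lintegral_const, ENNReal.rpow_ofNat, one_pow, one_mul] at h
  calc (∫⁻ x, f x ∂μ) ^ 2 ≤ ((∫⁻ x, f x ^ 2 ∂μ) ^ (1 / 2 : ℝ) * μ univ ^ (1 / 2 : ℝ)) ^ 2 := by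
        gcongr
    _ = _ := by
        rw [mul_pow, ← ENNReal.rpow_natCast, ← ENNReal.rpow_natCast, ← ENNReal.rpow_mul,
          ← ENNReal.rpow_mul]
        norm_num [mul_comm]

/-- Square the integral formula along segments, use Cauchy-Schwarz in the segment parameter and
exchange the integrals: each translate of `|p|²`, extended by zero, has the same total integral. -/
theorem IsSobolev.lintegral_sub_sq_le {U W : Set Plane} {u : Plane → ℝ} {p : Plane → Plane}
    (h : IsSobolev U u p) (hU : IsOpen U) (hW : IsOpen W) (z : Plane)
    (hWU : ∀ x ∈ W, ∀ τ ∈ Icc (0 : ℝ) 1, x + τ • z ∈ U) :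
    ∫⁻ x in W, ‖u (x + z) - u x‖ₑ ^ 2 ≤ ‖z‖ₑ ^ 2 * ∫⁻ x in U, ‖p x‖ₑ ^ 2 := by
  set P : Plane → ℝ≥0∞ := U.indicator fun x => ‖p x‖ₑ ^ 2 with hP
  have hPm : Measurable P := (h.meas_grad.enorm.pow_const 2).indicator hU.measurableSet
  have hpm : Measurable p := h.meas_grad.measurable
  calc ∫⁻ x in W, ‖u (x + z) - u x‖ₑ ^ 2
      ≤ ∫⁻ x in W, ‖z‖ₑ ^ 2 * ∫⁻ τ in Ioc (0 : ℝ) 1, P (x + τ • z) := by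
        refine lintegral_mono_ae ?_
        refine (ae_restrict_iff' hW.measurableSet).2 ?_
        filter_upwards [h.ae_sub_eq hU hW z hWU] with x hx hxW
        rw [hx hxW, intervalIntegral.integral_of_le zero_le_one]
        calc _ ≤ (∫⁻ τ in Ioc (0 : ℝ) 1, ‖inner ℝ (p (x + τ • z)) z‖ₑ) ^ 2 := by
              gcongr; exact enorm_integral_le_lintegral_enorm _
          _ ≤ (∫⁻ τ in Ioc (0 : ℝ) 1, ‖z‖ₑ * ‖p (x + τ • z)‖ₑ) ^ 2 := by
              gcongr with τ
              rw [mul_comm]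
              simp only [enorm_eq_nnnorm, ← ENNReal.coe_mul, ENNReal.coe_le_coe]
              exact nnnorm_inner_le_nnnorm _ _
          _ = ‖z‖ₑ ^ 2 * (∫⁻ τ in Ioc (0 : ℝ) 1, ‖p (x + τ • z)‖ₑ) ^ 2 := by
              rw [lintegral_const_mul' _ _ (by simp), mul_pow]
          _ ≤ ‖z‖ₑ ^ 2 * ∫⁻ τ in Ioc (0 : ℝ) 1, ‖p (x + τ • z)‖ₑ ^ 2 := by
              gcongr
              refine (sq_lintegral_le _ ?_).trans ?_
              · exact (hpm.comp (by fun_prop)).enorm.aemeasurable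
              · simp
          _ = _ := by
              congr 1
              refine setLIntegral_congr_fun measurableSet_Ioc fun τ hτ => ?_
              simp [hP, hWU x hxW τ (Ioc_subset_Icc_self hτ)]
    _ = ‖z‖ₑ ^ 2 * ∫⁻ τ in Ioc (0 : ℝ) 1, ∫⁻ x in W, P (x + τ • z) := by
        rw [lintegral_const_mul' _ _ (by simp), lintegral_lintegral_swap]
        exact (hPm.comp (by fun_prop : Measurable fun y : Plane × ℝ => y.1 + y.2 • z)).aemeasurable
    _ ≤ ‖z‖ₑ ^ 2 * ∫⁻ _ in Ioc (0 : ℝ) 1, ∫⁻ x, P x := by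
        refine mul_le_mul' le_rfl (lintegral_mono fun τ => ?_)
        calc ∫⁻ x in W, P (x + τ • z) ≤ ∫⁻ x, P (x + τ • z) :=
              lintegral_mono' Measure.restrict_le_self le_rfl
          _ = _ := lintegral_add_right_eq_self P (τ • z)
    _ = _ := by simp [hP, lintegral_indicator hU.measurableSet]

/-! ### Poincaré inequalities -/

/-- On `P` the functions of `H¹(U)` satisfy a Poincaré inequality up to constants. -/
def PoincareOn (U P : Set Plane) : Prop :=
  ∃ C : ℝ≥0, ∀ u p, IsSobolev U u p →
    ∃ c : ℝ, ∫⁻ x in P, ‖u x - c‖ₑ ^ 2 ≤ C * ∫⁻ x in U, ‖p x‖ₑ ^ 2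

theorem PoincareOn.mono {U P Q : Set Plane} (h : PoincareOn U P) (hQ : Q ⊆ P) :
    PoincareOn U Q := by
  obtain ⟨C, hC⟩ := h
  refine ⟨C, fun u p hu => ?_⟩
  obtain ⟨c, hc⟩ := hC u p hu
  exact ⟨c, (lintegral_mono_set hQ).trans hc⟩

/-- Estimate the double integral of `|u y - u x|²` over the ball. With `z = y - x` as variable, the
difference estimate applies for each `z`, and only `|z| < 2δ` contributes. The constant subtracted
is a value `u x` at a point where the inner integral does not exceed its average. -/
theorem poincareOn_ball {U : Set Plane} (hU : IsOpen U) {x₀ : Plane} {δ : ℝ} (hδ : 0 < δ)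
    (hB : Metric.ball x₀ δ ⊆ U) : PoincareOn U (Metric.ball x₀ δ) := by
  set B := Metric.ball x₀ δ with hBdef
  have hBo : IsOpen B := Metric.isOpen_ball
  have hB0 : volume B ≠ 0 := (Metric.measure_ball_pos volume x₀ hδ).ne'
  have hBt : volume B ≠ ⊤ := measure_ball_lt_top.ne
  set D : Set Plane := Metric.ball 0 (2 * δ) with hD
  have hDm : MeasurableSet D := measurableSet_ball
  set M : ℝ≥0∞ := (volume B)⁻¹ * (ENNReal.ofReal (2 * δ) ^ 2 * volume D) with hM
  have hMt : M ≠ ⊤ := ENNReal.mul_ne_top (by simp [hB0])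
    (ENNReal.mul_ne_top (by finiteness) measure_ball_lt_top.ne)
  refine ⟨M.toNNReal, fun u p hu => ?_⟩
  have hum : Measurable u := hu.meas.measurable
  set E := ∫⁻ x in U, ‖p x‖ₑ ^ 2 with hE
  have hmeas : Measurable fun y : Plane × Plane => ‖u y.2 - u y.1‖ₑ ^ 2 := by fun_prop
  have key : ∫⁻ x in B, ∫⁻ y in B, ‖u y - u x‖ₑ ^ 2 ≤ ENNReal.ofReal (2 * δ) ^ 2 * volume D * E := by
    calc ∫⁻ x in B, ∫⁻ y in B, ‖u y - u x‖ₑ ^ 2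
        = ∫⁻ x in B, ∫⁻ z, B.indicator (fun y => ‖u y - u x‖ₑ ^ 2) (x + z) := by
          refine lintegral_congr fun x => ?_
          rw [← lintegral_indicator hBo.measurableSet]
          exact (lintegral_add_left_eq_self _ x).symm
      _ = ∫⁻ z, ∫⁻ x in B, B.indicator (fun y => ‖u y - u x‖ₑ ^ 2) (x + z) := by
          rw [lintegral_lintegral_swap]
          have hS : MeasurableSet ((fun y : Plane × Plane => y.1 + y.2) ⁻¹' B) :=
            hBo.measurableSet.preimage (by fun_prop)
          have hF : Measurable fun y : Plane × Plane => ‖u (y.1 + y.2) - u y.1‖ₑ ^ 2 := by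
            fun_prop
          exact (hF.indicator hS).aemeasurable
      _ ≤ ∫⁻ z, D.indicator (fun _ => ENNReal.ofReal (2 * δ) ^ 2 * E) z := by
          refine lintegral_mono fun z => ?_
          set W := B ∩ (fun x => x + z) ⁻¹' B with hW
          have hWo : IsOpen W := hBo.inter (hBo.preimage (by fun_prop))
          have e1 : ∫⁻ x in B, B.indicator (fun y => ‖u y - u x‖ₑ ^ 2) (x + z) =
              ∫⁻ x in W, ‖u (x + z) - u x‖ₑ ^ 2 := by
            rw [← lintegral_indicator hBo.measurableSet, ← lintegral_indicator hWo.measurableSet]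
            refine lintegral_congr fun x => ?_
            by_cases h1 : x ∈ B <;> by_cases h2 : x + z ∈ B <;> simp [hW, h1, h2]
          rw [e1]
          by_cases hz : z ∈ D
          · rw [indicator_of_mem hz]
            refine (hu.lintegral_sub_sq_le hU hWo z fun x hx τ hτ => hB ?_).trans ?_
            · have := (convex_ball x₀ δ).add_smul_sub_mem hx.1 hx.2 hτ
              rwa [add_sub_cancel_left] at this
            · gcongr
              rw [← ofReal_norm]
              gcongr
              simpa [hD] using (Metric.mem_ball.1 hz).le
          · have : W = ∅ := by
              refine eq_empty_iff_forall_notMem.2 fun x hx => hz ?_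
              have h1 : dist x x₀ < δ := hx.1
              have h2 : dist (x + z) x₀ < δ := hx.2
              have h3 : dist (x + z) x < 2 * δ :=
                (dist_triangle_right _ _ _).trans_lt ((add_lt_add h2 h1).trans_eq (two_mul δ).symm)
              rwa [dist_self_add_left, ← mem_ball_zero_iff] at h3
            simp [this]
      _ = _ := by
          rw [lintegral_indicator hDm, setLIntegral_const]
          ring
  -- A function is at most its average at some point; no mean value of `u` has to be formed.
  obtain ⟨x, -, hx⟩ := exists_le_setLAverage hB0 hBt
    (f := fun x => ∫⁻ y in B, ‖u y - u x‖ₑ ^ 2)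
    (hmeas.lintegral_prod_right' (ν := volume.restrict B)).aemeasurable
  refine ⟨u x, hx.trans ?_⟩
  rw [setLAverage_eq, ENNReal.coe_toNNReal hMt, hM, ENNReal.div_eq_inv_mul, mul_assoc]
  gcongr

/-- Compares `u x` with `u (x + z)` by the difference estimate, then uses the inequality where `x +
z` lies. It transports the inequality from an interior ball to a region touching the boundary. -/
theorem PoincareOn.shift {U W P : Set Plane} (hP : PoincareOn U P) (hU : IsOpen U)
    (hW : IsOpen W) (z : Plane) (hWU : ∀ x ∈ W, ∀ τ ∈ Icc (0 : ℝ) 1, x + τ • z ∈ U)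
    (hWP : ∀ x ∈ W, x + z ∈ P) : PoincareOn U W := by
  obtain ⟨C, hC⟩ := hP
  refine ⟨2 * (‖z‖₊ ^ 2 + C), fun u p hu => ?_⟩
  obtain ⟨c, hc⟩ := hC u p hu
  have hum : Measurable u := hu.meas.measurable
  refine ⟨c, ?_⟩
  calc ∫⁻ x in W, ‖u x - c‖ₑ ^ 2
      ≤ ∫⁻ x in W, 2 * (‖u (x + z) - u x‖ₑ ^ 2 + ‖u (x + z) - c‖ₑ ^ 2) := by
        refine lintegral_mono fun x => ?_
        rw [← enorm_sub_rev (u x)]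
        exact enorm_sub_sq_le _ _ _
    _ = 2 * ((∫⁻ x in W, ‖u (x + z) - u x‖ₑ ^ 2) + ∫⁻ x in W, ‖u (x + z) - c‖ₑ ^ 2) := by
        rw [lintegral_const_mul' _ _ (by simp), lintegral_add_left (by fun_prop)]
    _ ≤ 2 * ((‖z‖ₑ ^ 2 * ∫⁻ x in U, ‖p x‖ₑ ^ 2) + C * ∫⁻ x in U, ‖p x‖ₑ ^ 2) := by
        gcongr
        · exact hu.lintegral_sub_sq_le hU hW z hWU
        · refine le_trans ?_ hc
          have hmp := measurePreserving_add_right (volume : Measure Plane) z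
          have h1 : ∫⁻ x in (fun x => x + z) '' W, ‖u x - c‖ₑ ^ 2 =
              ∫⁻ x in W, ‖u (x + z) - c‖ₑ ^ 2 :=
            hmp.setLIntegral_comp_emb (measurableEmbedding_addRight z) (fun x => ‖u x - c‖ₑ ^ 2) W |>.symm
          rw [← h1]
          exact lintegral_mono_set (by rintro _ ⟨x, hx, rfl⟩; exact hWP x hx)
    _ = _ := by
        push_cast
        rw [enorm_eq_nnnorm]
        ring

/-- The two optimal constants `c` and `d` are both close to `u` on the overlap; since the overlap
has positive measure, `|d - c|²` is controlled by the Dirichlet integral. -/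
theorem PoincareOn.union {U P Q : Set Plane} (hP : PoincareOn U P) (hQ : PoincareOn U Q)
    (hQt : volume Q ≠ ⊤)
    (hPQ : volume (P ∩ Q) ≠ 0) : PoincareOn U (P ∪ Q) := by
  obtain ⟨C, hC⟩ := hP
  obtain ⟨C', hC'⟩ := hQ
  have ht : volume (P ∩ Q) ≠ ⊤ := measure_ne_top_of_subset inter_subset_right hQt
  set m := volume (P ∩ Q) with hm
  set M : ℝ≥0∞ := C + 2 * (C' + m⁻¹ * (2 * (C + C')) * volume Q) with hM
  have hMt : M ≠ ⊤ := by
    have : m⁻¹ ≠ ⊤ := by simp [hPQ]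
    finiteness
  refine ⟨M.toNNReal, fun u p hu => ?_⟩
  obtain ⟨c, hc⟩ := hC u p hu
  obtain ⟨d, hd⟩ := hC' u p hu
  have hum : Measurable u := hu.meas.measurable
  refine ⟨c, ?_⟩
  set E := ∫⁻ x in U, ‖p x‖ₑ ^ 2 with hE
  have h1 : ‖d - c‖ₑ ^ 2 * m ≤ 2 * (C + C') * E := by
    calc ‖d - c‖ₑ ^ 2 * m = ∫⁻ _ in P ∩ Q, ‖d - c‖ₑ ^ 2 := by simp [hm]
      _ ≤ ∫⁻ x in P ∩ Q, 2 * (‖u x - c‖ₑ ^ 2 + ‖u x - d‖ₑ ^ 2) := by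
          refine lintegral_mono fun x => ?_
          rw [add_comm, ← enorm_sub_rev d]
          exact enorm_sub_sq_le _ _ _
      _ = 2 * ((∫⁻ x in P ∩ Q, ‖u x - c‖ₑ ^ 2) + ∫⁻ x in P ∩ Q, ‖u x - d‖ₑ ^ 2) := by
          rw [lintegral_const_mul' _ _ (by simp), lintegral_add_left (by fun_prop)]
      _ ≤ 2 * (C * E + C' * E) := by
          gcongr
          · exact (lintegral_mono_set inter_subset_left).trans hc
          · exact (lintegral_mono_set inter_subset_right).trans hd
      _ = _ := by ring
  have h2 : ‖d - c‖ₑ ^ 2 ≤ m⁻¹ * (2 * (C + C')) * E := by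
    calc ‖d - c‖ₑ ^ 2 = m⁻¹ * (‖d - c‖ₑ ^ 2 * m) := by
          rw [mul_comm (‖d - c‖ₑ ^ 2), ← mul_assoc, ENNReal.inv_mul_cancel hPQ ht, one_mul]
      _ ≤ m⁻¹ * (2 * (C + C') * E) := by gcongr
      _ = _ := by ring
  rw [ENNReal.coe_toNNReal hMt]
  calc ∫⁻ x in P ∪ Q, ‖u x - c‖ₑ ^ 2
      ≤ (∫⁻ x in P, ‖u x - c‖ₑ ^ 2) + ∫⁻ x in Q, ‖u x - c‖ₑ ^ 2 := lintegral_union_le _ _ _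
    _ ≤ C * E + ∫⁻ x in Q, 2 * (‖u x - d‖ₑ ^ 2 + ‖d - c‖ₑ ^ 2) := by
        gcongr with x
        exact enorm_sub_sq_le _ _ _
    _ = C * E + 2 * ((∫⁻ x in Q, ‖u x - d‖ₑ ^ 2) + ‖d - c‖ₑ ^ 2 * volume Q) := by
        rw [lintegral_const_mul' _ _ (by simp), lintegral_add_left (by fun_prop)]
        simp
    _ ≤ C * E + 2 * (C' * E + m⁻¹ * (2 * (C + C')) * E * volume Q) := by gcongr
    _ = _ := by rw [hM]; ring

/-- Poincaré inequalities on the members of a finite open cover propagate to the whole of a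
connected open set. -/
theorem poincareOn_of_finite_cover {U : Set Plane} (hU : IsOpen U) (hc : IsConnected U)
    (hb : Bornology.IsBounded U) {ι : Type*} (t : Finset ι) (N : ι → Set Plane)
    (hN : ∀ i ∈ t, IsOpen (N i)) (hcov : U ⊆ ⋃ i ∈ t, N i)
    (hP : ∀ i ∈ t, PoincareOn U (N i ∩ U)) : PoincareOn U U := by
  classical
  have hbt : volume U ≠ ⊤ := hb.measure_lt_top.ne
  -- a maximal subfamily on whose union the inequality holds
  set good : Finset (Finset ι) := t.powerset.filter fun s =>
    s.Nonempty ∧ (∀ i ∈ s, (N i ∩ U).Nonempty) ∧ PoincareOn U (⋃ i ∈ s, N i ∩ U) with hgood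
  have hne : good.Nonempty := by
    obtain ⟨x, hx⟩ := hc.nonempty
    obtain ⟨i, hi, hxi⟩ := mem_iUnion₂.1 (hcov hx)
    refine ⟨{i}, ?_⟩
    simp only [hgood, Finset.mem_filter, Finset.mem_powerset, Finset.singleton_subset_iff]
    refine ⟨hi, Finset.singleton_nonempty i, ?_, ?_⟩
    · simpa using ⟨x, hxi, hx⟩
    · simpa using hP i hi
  obtain ⟨s, hs, hmax⟩ := good.exists_max_image Finset.card hne
  simp only [hgood, Finset.mem_filter, Finset.mem_powerset] at hs
  obtain ⟨hst, hsne, hsN, hsP⟩ := hs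
  set A := ⋃ i ∈ s, N i ∩ U with hA
  have hAo : IsOpen A := isOpen_biUnion fun i hi => (hN i (hst hi)).inter hU
  have hAU : A ⊆ U := iUnion₂_subset fun i _ => inter_subset_right
  suffices U ⊆ A by rwa [hAU.antisymm this] at hsP
  by_contra hUA
  obtain ⟨y, hyU, hyA⟩ := not_subset.1 hUA
  set A' := ⋃ i ∈ t \ s, N i ∩ U with hA'
  have hA'o : IsOpen A' := isOpen_biUnion fun i hi => (hN i (Finset.mem_sdiff.1 hi).1).inter hU
  have hcover : U ⊆ A ∪ A' := by
    intro x hx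
    obtain ⟨i, hi, hxi⟩ := mem_iUnion₂.1 (hcov hx)
    by_cases his : i ∈ s
    · exact Or.inl (mem_biUnion his ⟨hxi, hx⟩)
    · exact Or.inr (mem_biUnion (Finset.mem_coe.2 (Finset.mem_sdiff.2 ⟨hi, his⟩)) ⟨hxi, hx⟩)
  obtain ⟨i₀, hi₀⟩ := hsne
  obtain ⟨x₀, hx₀⟩ := hsN i₀ hi₀
  -- By connectedness the open set `A` meets the union of the remaining pieces, so some piece
  -- outside `s` overlaps `A` in a nonempty open set and can be added, against maximality.
  obtain ⟨w, -, hwA, hwA'⟩ := hc.isPreconnected A A' hAo hA'o hcover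
    ⟨x₀, hx₀.2, mem_biUnion (Finset.mem_coe.2 hi₀) hx₀⟩
    ⟨y, hyU, (hcover hyU).resolve_left hyA⟩
  obtain ⟨j, hj, hwj⟩ := mem_iUnion₂.1 hwA'
  obtain ⟨hjt, hjs⟩ := Finset.mem_sdiff.1 hj
  have hjo : IsOpen (N j ∩ U) := (hN j hjt).inter hU
  have hunion : PoincareOn U (A ∪ N j ∩ U) :=
    hsP.union (hP j hjt)
      (measure_ne_top_of_subset inter_subset_right hbt)
      ((hAo.inter hjo).measure_pos volume ⟨w, hwA, hwj⟩).ne'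
  have hmem : insert j s ∈ good := by
    simp only [hgood, Finset.mem_filter, Finset.mem_powerset]
    refine ⟨Finset.insert_subset hjt hst, Finset.insert_nonempty _ _, ?_, ?_⟩
    · intro i hi
      rcases Finset.mem_insert.1 hi with rfl | hi
      · exact ⟨w, hwj⟩
      · exact hsN i hi
    · rw [Finset.set_biUnion_insert, union_comm]
      exact hunion
  have := hmax _ hmem
  rw [Finset.card_insert_of_notMem hjs] at this
  omega

/-! ### Graph charts at boundary points -/

/-- A bi-Lipschitz, volume preserving chart of the plane at the point `x₀`, moving in a fixed
direction in the second variable, in which the set `S` is a half plane near `x₀`. -/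
structure GraphChart (S : Set Plane) (x₀ : Plane) where
  /-- the parametrization -/
  Θ : ℝ × ℝ ≃ₜ Plane
  /-- Lipschitz constant -/
  M : ℝ≥0
  lip : LipschitzWith M Θ
  lip_symm : LipschitzWith M Θ.symm
  measurePreserving : MeasurePreserving Θ volume volume
  /-- direction of the lines of the chart -/
  e : Plane
  norm_e : ‖e‖ = 1
  shift : ∀ a b s, Θ (a, b + s) = Θ (a, b) + s • e
  /-- size of the chart -/
  r : ℝ
  r_pos : 0 < r
  map_zero : Θ 0 = x₀
  mem_iff : ∀ a b, |a| < r → |b| < r → (Θ (a, b) ∈ S ↔ 0 < b)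

theorem plane_norm_le (x : Plane) : ‖x‖ ≤ |x 0| + |x 1| := by
  rw [EuclideanSpace.norm_eq, Fin.sum_univ_two]
  refine Real.sqrt_le_iff.2 ⟨by positivity, ?_⟩
  simp only [Real.norm_eq_abs]
  nlinarith [abs_nonneg (x 0), abs_nonneg (x 1)]

/-- Shear along the graph of `f`, followed by an isometry. -/
def graphHomeo (x₀ : Plane) (L : Plane ≃ₗᵢ[ℝ] Plane) (f : ℝ → ℝ) (hf : Continuous f) :
    ℝ × ℝ ≃ₜ Plane where
  toFun q := x₀ + L.symm (!₂[q.1, f q.1 + q.2] : Plane)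
  invFun y := (L (y - x₀) 0, L (y - x₀) 1 - f (L (y - x₀) 0))
  left_inv q := by simp
  right_inv y := by
    have : (!₂[L (y - x₀) 0, f (L (y - x₀) 0) + (L (y - x₀) 1 - f (L (y - x₀) 0))] : Plane) =
        L (y - x₀) := by
      ext i
      fin_cases i <;> simp
    dsimp only
    rw [this]
    simp
  continuous_toFun := by
    refine continuous_const.add (L.symm.continuous.comp ?_)
    refine (PiLp.continuous_toLp 2 _).comp (continuous_pi fun i => ?_)
    fin_cases i
    · exact continuous_fst
    · exact (hf.comp continuous_fst).add continuous_snd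
  continuous_invFun := by
    have h : ∀ i : Fin 2, Continuous fun y : Plane => L (y - x₀) i := fun i =>
      (EuclideanSpace.proj (𝕜 := ℝ) i).continuous.comp
        (L.continuous.comp (continuous_id.sub continuous_const))
    exact (h 0).prodMk ((h 1).sub (hf.comp (h 0)))

theorem graphHomeo_apply (x₀ : Plane) (L : Plane ≃ₗᵢ[ℝ] Plane) (f : ℝ → ℝ) (hf : Continuous f)
    (q : ℝ × ℝ) : graphHomeo x₀ L f hf q = x₀ + L.symm (!₂[q.1, f q.1 + q.2] : Plane) := rfl

/-- A shear translates each vertical line, so it preserves area by Fubini even if `f` is merely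
continuous. -/
theorem graphHomeo_measurePreserving (x₀ : Plane) (L : Plane ≃ₗᵢ[ℝ] Plane) (f : ℝ → ℝ)
    (hf : Continuous f) : MeasurePreserving (graphHomeo x₀ L f hf) volume volume := by
  have h1 : MeasurePreserving (fun q : ℝ × ℝ => (q.1, f q.1 + q.2)) volume volume :=
    (MeasurePreserving.id (volume : Measure ℝ)).skew_product (g := fun a b => f a + b)
      (by fun_prop) (Eventually.of_forall fun a => (measurePreserving_add_left volume (f a)).map_eq)
  have h2 := (volume_preserving_finTwoArrow ℝ).symm.comp h1
  have h3 := (PiLp.volume_preserving_toLp (Fin 2)).comp h2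
  have h4 := L.symm.measurePreserving.comp h3
  have h5 := (measurePreserving_add_left volume x₀).comp h4
  have h6 : (fun y => x₀ + y) ∘ (L.symm ∘ WithLp.toLp 2 ∘ MeasurableEquiv.finTwoArrow.symm ∘
      fun q : ℝ × ℝ => (q.1, f q.1 + q.2)) = graphHomeo x₀ L f hf := by
    funext q
    rw [graphHomeo_apply]
    simp only [Function.comp_apply]
    congr 3
  rwa [h6] at h5

theorem exists_graphChart {S : Set Plane} (hS : IsOpen S) (h : HasLipschitzBoundary S)
    {x₀ : Plane} (hx : x₀ ∈ frontier S) : Nonempty (GraphChart S x₀) := by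
  obtain ⟨L, r, η, K, f, hr, hη, hf, -, hmem⟩ := h x₀ hx
  have hcoord : ∀ i : Fin 2, Continuous fun y : Plane => L (y - x₀) i := fun i =>
    (EuclideanSpace.proj (𝕜 := ℝ) i).continuous.comp
      (L.continuous.comp (continuous_id.sub continuous_const))
  -- The graph must pass through `x₀`: a negative value would put `x₀` inside the open set `S`, a
  -- positive one would keep a neighbourhood of `x₀` off `S`.
  have hf0 : f 0 = 0 := by
    rcases lt_trichotomy (f 0) 0 with h0 | h0 | h0
    · have : x₀ ∈ S := (hmem x₀ (by simpa) (by simpa)).2 (by simpa)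
      exact absurd hx (by simp [hS.frontier_eq, this])
    · exact h0
    · exfalso
      have hcl : x₀ ∈ closure S := frontier_subset_closure hx
      have ev : ∀ᶠ y in 𝓝 x₀, y ∉ S := by
        have e1 : ∀ᶠ y in 𝓝 x₀, |L (y - x₀) 0| < r :=
          (hcoord 0).abs.continuousAt.eventually_lt continuousAt_const (by simpa)
        have e2 : ∀ᶠ y in 𝓝 x₀, |L (y - x₀) 1| < η :=
          (hcoord 1).abs.continuousAt.eventually_lt continuousAt_const (by simpa)
        have e3 : ∀ᶠ y in 𝓝 x₀, L (y - x₀) 1 < f (L (y - x₀) 0) :=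
          (hcoord 1).continuousAt.eventually_lt (hf.continuous.comp (hcoord 0)).continuousAt
            (by simpa)
        filter_upwards [e1, e2, e3] with y h1 h2 h3 hy
        exact absurd ((hmem y h1 h2).1 hy) h3.le.not_gt
      exact (mem_closure_iff_frequently.1 hcl) ev
  have hfa : ∀ a, |f a| ≤ K * |a| := fun a => by
    simpa [Real.dist_eq, hf0] using hf.dist_le_mul a 0
  refine ⟨{
    Θ := graphHomeo x₀ L f hf.continuous
    M := 2 + K
    lip := ?_
    lip_symm := ?_
    measurePreserving := graphHomeo_measurePreserving x₀ L f hf.continuous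
    e := L.symm (unitVec 1)
    norm_e := by simp [unitVec]
    shift := ?_
    -- With this size, `|f a + b| ≤ K |a| + |b| < (K + 1) r ≤ η`, so the whole square stays in the
    -- rectangle where the graph description is valid.
    r := min r (η / (K + 1))
    r_pos := lt_min hr (by positivity)
    map_zero := ?_
    mem_iff := ?_ }⟩
  · refine LipschitzWith.of_dist_le_mul fun q q' => ?_
    have h1 : dist (graphHomeo x₀ L f hf.continuous q) (graphHomeo x₀ L f hf.continuous q') =
        ‖(!₂[q.1, f q.1 + q.2] : Plane) - !₂[q'.1, f q'.1 + q'.2]‖ := by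
      rw [graphHomeo_apply, graphHomeo_apply, dist_add_left]
      rw [LinearIsometryEquiv.dist_map, dist_eq_norm]
    rw [h1]
    refine (plane_norm_le _).trans ?_
    have h2 := hf.dist_le_mul q.1 q'.1
    have h3 : |q.1 - q'.1| ≤ dist q q' := by rw [← Real.dist_eq]; exact le_max_left _ _
    have h4 : |q.2 - q'.2| ≤ dist q q' := by rw [← Real.dist_eq]; exact le_max_right _ _
    rw [Real.dist_eq, Real.dist_eq] at h2
    simp only [PiLp.sub_apply, Matrix.cons_val_zero, Matrix.cons_val_one, NNReal.coe_add,
      NNReal.coe_ofNat]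
    have h5 : |f q.1 + q.2 - (f q'.1 + q'.2)| ≤ |f q.1 - f q'.1| + |q.2 - q'.2| := by
      rw [add_sub_add_comm]; exact abs_add_le _ _
    have h6 : (K : ℝ) * |q.1 - q'.1| ≤ K * dist q q' := by gcongr
    linarith
  · refine LipschitzWith.of_dist_le_mul fun y y' => ?_
    have h0 : ∀ i : Fin 2, |L (y - x₀) i - L (y' - x₀) i| ≤ dist y y' := by
      intro i
      have := PiLp.norm_apply_le (L (y - x₀) - L (y' - x₀)) i
      rw [← map_sub, L.norm_map, sub_sub_sub_cancel_right, ← dist_eq_norm] at this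
      simpa using this
    have h2 := hf.dist_le_mul (L (y - x₀) 0) (L (y' - x₀) 0)
    rw [Real.dist_eq, Real.dist_eq] at h2
    have h3 : (K : ℝ) * |L (y - x₀) 0 - L (y' - x₀) 0| ≤ K * dist y y' := by gcongr; exact h0 0
    have hd : 0 ≤ dist y y' := dist_nonneg
    have hK : 0 ≤ (K : ℝ) * dist y y' := by positivity
    refine max_le ?_ ?_
    · change |L (y - x₀) 0 - L (y' - x₀) 0| ≤ _
      rw [NNReal.coe_add, NNReal.coe_ofNat]
      linarith [h0 0]
    · change |(L (y - x₀) 1 - f (L (y - x₀) 0)) - (L (y' - x₀) 1 - f (L (y' - x₀) 0))| ≤ _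
      have h5 : |(L (y - x₀) 1 - f (L (y - x₀) 0)) - (L (y' - x₀) 1 - f (L (y' - x₀) 0))| ≤
          |L (y - x₀) 1 - L (y' - x₀) 1| + |f (L (y - x₀) 0) - f (L (y' - x₀) 0)| := by
        rw [sub_sub_sub_comm]; exact abs_sub _ _
      rw [NNReal.coe_add, NNReal.coe_ofNat]
      linarith [h0 1]
  · intro a b s
    simp only [graphHomeo_apply]
    rw [add_assoc, ← map_smul, ← map_add]
    congr 2
    ext i
    fin_cases i <;> simp [unitVec, add_assoc]
  · have : (!₂[(0 : ℝ), 0] : Plane) = 0 := by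
      ext i
      fin_cases i <;> simp
    simp [graphHomeo_apply, hf0, this]
  · intro a b ha hb
    have h1 : |f a + b| < η := by
      calc |f a + b| ≤ |f a| + |b| := abs_add_le _ _
        _ < K * min r (η / (K + 1)) + min r (η / (K + 1)) := by
            refine add_lt_add_of_le_of_lt ((hfa a).trans ?_) hb
            gcongr
        _ = (K + 1) * min r (η / (K + 1)) := by ring
        _ ≤ (K + 1) * (η / (K + 1)) := by gcongr; exact min_le_right _ _
        _ = η := by field_simp
    have := hmem (x₀ + L.symm (!₂[a, f a + b] : Plane)) (by simpa using (lt_min_iff.1 ha).1)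
      (by simpa using h1)
    simpa [graphHomeo_apply] using this

namespace GraphChart

/-- The open neighbourhood of `x₀` covered by the chart. -/
def nhd {S : Set Plane} {x₀ : Plane} (c : GraphChart S x₀) : Set Plane := c.Θ '' Metric.ball 0 c.r

theorem mem_ball_iff (q : ℝ × ℝ) (r : ℝ) :
    q ∈ Metric.ball (0 : ℝ × ℝ) r ↔ |q.1| < r ∧ |q.2| < r := by
  rw [mem_ball_zero_iff, Prod.norm_def, max_lt_iff, Real.norm_eq_abs, Real.norm_eq_abs]

theorem isOpen_nhd {S : Set Plane} {x₀ : Plane} (c : GraphChart S x₀) :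
    IsOpen c.nhd := c.Θ.isOpenMap _ Metric.isOpen_ball

theorem mem_nhd {S : Set Plane} {x₀ : Plane} (c : GraphChart S x₀) : x₀ ∈ c.nhd :=
  ⟨0, Metric.mem_ball_self c.r_pos, c.map_zero⟩

theorem mem_frontier_iff {S : Set Plane} {x₀ : Plane} (c : GraphChart S x₀) (hS : IsOpen S)
    {a b : ℝ} (ha : |a| < c.r) (hb : |b| < c.r) :
    c.Θ (a, b) ∈ frontier S ↔ b = 0 := by
  rw [hS.frontier_eq, Set.mem_sdiff, c.mem_iff a b ha hb, not_lt]
  have hev : ∀ᶠ t in 𝓝 b, |t| < c.r := continuous_abs.continuousAt.eventually_lt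
    continuousAt_const hb
  constructor
  · rintro ⟨hcl, hb0⟩
    by_contra hne
    have hlt : b < 0 := lt_of_le_of_ne hb0 hne
    have hO : IsOpen (c.Θ '' {q | |q.1| < c.r ∧ |q.2| < c.r ∧ q.2 < 0}) := by
      have h1 : Continuous fun q : ℝ × ℝ => |q.1| := by fun_prop
      have h2 : Continuous fun q : ℝ × ℝ => |q.2| := by fun_prop
      exact c.Θ.isOpenMap _ ((isOpen_lt h1 continuous_const).inter
        ((isOpen_lt h2 continuous_const).inter (isOpen_lt continuous_snd continuous_const)))
    obtain ⟨y, ⟨⟨a', b'⟩, ⟨h1, h2, h3⟩, rfl⟩, hy⟩ := mem_closure_iff.1 hcl _ hO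
      ⟨(a, b), ⟨ha, hb, hlt⟩, rfl⟩
    exact absurd ((c.mem_iff a' b' h1 h2).1 hy) h3.le.not_gt
  · rintro rfl
    refine ⟨?_, le_rfl⟩
    have ht : Tendsto (fun t : ℝ => c.Θ (a, t)) (𝓝[>] 0) (𝓝 (c.Θ (a, 0))) :=
      ((c.Θ.continuous.comp (by fun_prop : Continuous fun t : ℝ => (a, t))).tendsto 0).mono_left
        nhdsWithin_le_nhds
    refine mem_closure_of_tendsto ht ?_
    filter_upwards [hev.filter_mono nhdsWithin_le_nhds, self_mem_nhdsWithin] with t h1 h2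
    exact (c.mem_iff a t ha h1).2 h2

/-- A small ball about `x₀ + s e` lies inside `S`. Points of `S` close to `x₀` move into that ball
along `e` without leaving `S`, so the inequality is carried back by translation. -/
theorem poincareOn_nhds {S : Set Plane} {x₀ : Plane} (c : GraphChart S x₀) (hS : IsOpen S) :
    ∃ N : Set Plane, IsOpen N ∧ x₀ ∈ N ∧ PoincareOn S (N ∩ S) := by
  set s : ℝ := c.r / 2 with hs
  have hr := c.r_pos
  have hM : 0 < (c.M : ℝ) + 1 := by positivity
  -- Chosen so that a ball of radius `δ` about `x₀` or `x₀ + s e` corresponds in the chart to points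
  -- within `r / 4` of `(0, 0)` or `(0, r / 2)`.
  set δ : ℝ := c.r / 4 / (c.M + 1) with hδ
  have hδ0 : 0 < δ := by positivity
  have hMδ : (c.M : ℝ) * δ ≤ c.r / 4 := by
    rw [hδ, mul_div_assoc', div_le_iff₀ hM]
    nlinarith
  -- points near `x₀ + s e` are in `S`
  have hx : x₀ + s • c.e = c.Θ (0, s) := by
    have h1 := c.shift 0 0 s
    rw [zero_add] at h1
    have h2 : c.Θ (0, 0) = x₀ := c.map_zero
    rw [h1, h2]
  have hB : Metric.ball (x₀ + s • c.e) δ ⊆ S := by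
    intro y hy
    obtain ⟨⟨a, b⟩, rfl⟩ := c.Θ.surjective y
    have h1 : dist (a, b) ((0 : ℝ), s) < c.r / 4 + 0 := by
      have h2 := c.lip_symm.dist_le_mul (c.Θ (a, b)) (c.Θ (0, s))
      rw [c.Θ.symm_apply_apply, c.Θ.symm_apply_apply] at h2
      rw [hx, Metric.mem_ball] at hy
      have h3 : (c.M : ℝ) * dist (c.Θ (a, b)) (c.Θ (0, s)) ≤
        (c.M : ℝ) * dist (c.Θ (a, b)) (c.Θ (0, s)) := le_rfl
      have h4 : (c.M + 1 : ℝ) * dist (c.Θ (a, b)) (c.Θ (0, s)) < (c.M + 1) * δ := by gcongr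
      have h5 : (c.M + 1 : ℝ) * δ = c.r / 4 := by rw [hδ]; field_simp
      have h6 : 0 ≤ dist (c.Θ (a, b)) (c.Θ (0, s)) := dist_nonneg
      linarith
    rw [add_zero, Prod.dist_eq, max_lt_iff, Real.dist_eq, Real.dist_eq, abs_lt, abs_lt] at h1
    simp only at h1
    refine (c.mem_iff a b ?_ ?_).2 ?_
    · rw [abs_lt]; constructor <;> linarith
    · rw [abs_lt]; constructor <;> linarith
    · linarith
  refine ⟨Metric.ball x₀ δ, Metric.isOpen_ball, Metric.mem_ball_self hδ0, ?_⟩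
  refine (poincareOn_ball hS hδ0 hB).shift hS (Metric.isOpen_ball.inter hS) (s • c.e) ?_ ?_
  · rintro x ⟨hxB, hxS⟩ τ hτ
    obtain ⟨⟨a, b⟩, rfl⟩ := c.Θ.surjective x
    have h1 : dist (a, b) ((0 : ℝ), (0 : ℝ)) ≤ c.r / 4 := by
      have h2 := c.lip_symm.dist_le_mul (c.Θ (a, b)) (c.Θ 0)
      rw [c.Θ.symm_apply_apply, c.Θ.symm_apply_apply] at h2
      rw [c.map_zero] at h2
      refine h2.trans (le_trans ?_ hMδ)
      have h3 : dist (c.Θ (a, b)) x₀ < δ := hxB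
      gcongr
    rw [Prod.dist_eq, max_le_iff, Real.dist_eq, Real.dist_eq, sub_zero, sub_zero] at h1
    simp only at h1
    have hb : 0 < b := (c.mem_iff a b (by linarith) (by linarith)).1 hxS
    rw [smul_smul, ← c.shift]
    have hτs : 0 ≤ τ * s ∧ τ * s ≤ c.r / 2 := by
      constructor
      · have := hτ.1; positivity
      · nlinarith [hτ.2]
    have hb' := h1.2
    rw [abs_of_pos hb] at hb'
    refine (c.mem_iff _ _ (by linarith) ?_).2 (by linarith)
    rw [abs_lt]
    constructor <;> linarith
  · rintro x ⟨hxB, -⟩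
    rw [Metric.mem_ball] at hxB ⊢
    simpa using hxB

end GraphChart

theorem poincareOn_self {S : Set Plane} (hS : IsOpen S) (hc : IsConnected S)
    (hb : Bornology.IsBounded S) (hL : HasLipschitzBoundary S) : PoincareOn S S := by
  have hloc : ∀ x ∈ closure S, ∃ N : Set Plane, IsOpen N ∧ x ∈ N ∧ PoincareOn S (N ∩ S) := by
    intro x hx
    by_cases hxS : x ∈ S
    · obtain ⟨δ, hδ, hB⟩ := Metric.isOpen_iff.1 hS x hxS
      exact ⟨Metric.ball x δ, Metric.isOpen_ball, Metric.mem_ball_self hδ,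
        (poincareOn_ball hS hδ hB).mono inter_subset_left⟩
    · obtain ⟨c⟩ := exists_graphChart hS hL (x₀ := x) (by rw [hS.frontier_eq]; exact ⟨hx, hxS⟩)
      exact c.poincareOn_nhds hS
  choose! N hNo hxN hNP using hloc
  have hcpt : IsCompact (closure S) := hb.isCompact_closure
  obtain ⟨t, ht, hcov⟩ := hcpt.elim_nhds_subcover N fun x hx => (hNo x hx).mem_nhds (hxN x hx)
  exact poincareOn_of_finite_cover hS hc hb t N (fun i hi => hNo i (ht i hi))
    (subset_closure.trans hcov) fun i hi => hNP i (ht i hi)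

/-! ### Traces along lines -/

/-- Almost every `b` satisfies `z b' = z b` for almost every later `b'`. Two such points share a
common later `b'`, so `z` takes the same value at both. -/
theorem exists_ae_const_of_shift {z : ℝ → ℝ} {r : ℝ} (hr : 0 < r)
    (h : ∀ᵐ b, ∀ᵐ s, 0 < s → 0 < b → b + s < r → z (b + s) = z b) :
    ∃ k, ∀ᵐ b, b ∈ Ioo 0 r → z b = k := by
  have h' : ∀ᵐ b, 0 < b → ∀ᵐ b', b < b' → b' < r → z b' = z b := by
    filter_upwards [h] with b hb hb0
    filter_upwards [(measurePreserving_sub_right volume b).quasiMeasurePreserving.ae hb]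
      with b' hb' h1 h2
    have := hb' (by linarith) hb0 (by linarith)
    rwa [add_sub_cancel] at this
  have huniq : ∀ b₁ b₂ : ℝ, b₁ < r → b₂ < r → (∀ᵐ b', b₁ < b' → b' < r → z b' = z b₁) →
      (∀ᵐ b', b₂ < b' → b' < r → z b' = z b₂) → z b₁ = z b₂ := by
    intro b₁ b₂ h1 h2 ha hb
    have hpos : volume (Ioo (max b₁ b₂) r) ≠ 0 := by
      simp [h1, h2]
    obtain ⟨x, hx, hx1, hx2⟩ :=
      Frequently.exists ((frequently_ae_mem_iff.2 hpos).and_eventually (ha.and hb))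
    rw [← hx1 ((le_max_left _ _).trans_lt hx.1) hx.2, hx2 ((le_max_right _ _).trans_lt hx.1) hx.2]
  have hpos : volume (Ioo (0 : ℝ) r) ≠ 0 := by simp [hr]
  obtain ⟨b₀, hb₀, hg⟩ := Frequently.exists ((frequently_ae_mem_iff.2 hpos).and_eventually h')
  refine ⟨z b₀, ?_⟩
  filter_upwards [h'] with b hb hbr
  exact huniq b b₀ hbr.2 hb₀.2 (hb hbr.1) (hg hb₀.1)

/-- Subtracting from `v` the primitive `Q` of `q` along vertical lines leaves a function `z`
invariant under vertical shifts. The invariance is known for each shift up to a null set of points;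
Fubini converts this into: on almost every line, for almost every point and shift. Hence `z` is
almost everywhere constant on almost every line, and that constant is the boundary value. -/
theorem exists_trace_on_lines {v q : ℝ × ℝ → ℝ} (hv : StronglyMeasurable v)
    (hq : StronglyMeasurable q) {I : Set ℝ} (hI : MeasurableSet I) {r : ℝ} (hr : 0 < r)
    (hqi : IntegrableOn q (I ×ˢ Ioo 0 r))
    (hshift : ∀ s ∈ Ioo 0 r, ∀ᵐ y : ℝ × ℝ, y.1 ∈ I → 0 < y.2 → y.2 + s < r →
      v (y.1, y.2 + s) - v y = ∫ t in y.2..(y.2 + s), q (y.1, t)) :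
    ∃ w : ℝ → ℝ, Measurable w ∧
      ∀ᵐ a, a ∈ I → ∀ᵐ b, b ∈ Ioo 0 r → v (a, b) = w a + ∫ t in (0 : ℝ)..b, q (a, t) := by
  -- Written with an indicator so that joint measurability follows from that of parametric
  -- integrals; it is the primitive starting at `0` when `y.2 ≥ 0`.
  set Q : ℝ × ℝ → ℝ := fun y => ∫ t, (Ioc 0 y.2).indicator (fun t => q (y.1, t)) t with hQ
  have hQm : StronglyMeasurable Q := by
    have hS : MeasurableSet {y : (ℝ × ℝ) × ℝ | y.2 ∈ Ioc 0 y.1.2} :=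
      (measurableSet_lt measurable_const measurable_snd).inter
        (measurableSet_le measurable_snd measurable_fst.snd)
    have h1 : StronglyMeasurable fun y : (ℝ × ℝ) × ℝ => q (y.1.1, y.2) :=
      hq.comp_measurable (by fun_prop)
    exact (h1.indicator hS).integral_prod_right' (ν := volume)
  have hQeq : ∀ a b, 0 ≤ b → Q (a, b) = ∫ t in (0 : ℝ)..b, q (a, t) := by
    intro a b hb
    simp only [hQ]
    rw [integral_indicator measurableSet_Ioc, intervalIntegral.integral_of_le hb]
  have hqa : ∀ᵐ a, a ∈ I → IntegrableOn (fun t => q (a, t)) (Ioo 0 r) := by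
    have h1 : Integrable q ((volume.restrict I).prod (volume.restrict (Ioo 0 r))) := by
      rw [Measure.prod_restrict]; exact hqi
    exact (ae_restrict_iff' hI).1 h1.prod_right_ae
  set z : ℝ × ℝ → ℝ := fun y => v y - Q y with hz
  have hzm : StronglyMeasurable z := hv.sub hQm
  have hzme : Measurable z := hzm.measurable
  -- invariance of `z` along the lines
  have hzs : ∀ s : ℝ, ∀ᵐ y : ℝ × ℝ, y.1 ∈ I → 0 < s → 0 < y.2 → y.2 + s < r →
      z (y.1, y.2 + s) = z y := by
    intro s
    by_cases hs : s ∈ Ioo 0 r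
    · have hqa' : ∀ᵐ y : ℝ × ℝ, y.1 ∈ I → IntegrableOn (fun t => q (y.1, t)) (Ioo 0 r) :=
        Measure.quasiMeasurePreserving_fst.ae hqa
      filter_upwards [hshift s hs, hqa'] with y h1 h2 hyI hs0 hy0 hyr
      have h3 := h1 hyI hy0 hyr
      have h4 := h2 hyI
      have hi : ∀ c d, 0 < d → d < r → c ∈ Icc 0 d → IntervalIntegrable (fun t => q (y.1, t))
          volume c d := by
        intro c d hd hdr hc
        rw [intervalIntegrable_iff_integrableOn_Ioc_of_le hc.2]
        exact h4.mono_set fun t ht => ⟨hc.1.trans_lt ht.1, ht.2.trans_lt hdr⟩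
      simp only [hz]
      rw [hQeq _ _ (by linarith), show Q y = Q (y.1, y.2) from rfl, hQeq _ _ hy0.le,
        ← intervalIntegral.integral_add_adjacent_intervals (b := y.2)
          (hi 0 y.2 hy0 (by linarith) ⟨le_rfl, hy0.le⟩)
          (hi _ _ (by linarith) hyr ⟨hy0.le, by linarith⟩), ← h3]
      ring
    · refine Eventually.of_forall fun y _ h0 h1 h2 => absurd ⟨h0, by linarith⟩ hs
  have hmeas : MeasurableSet {x : ℝ × (ℝ × ℝ) | x.2.1 ∈ I → 0 < x.1 → 0 < x.2.2 →
      x.2.2 + x.1 < r → z (x.2.1, x.2.2 + x.1) = z x.2} := by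
    have m1 : MeasurableSet {x : ℝ × (ℝ × ℝ) | x.2.1 ∈ I} := hI.preimage (by fun_prop)
    have m2 : MeasurableSet {x : ℝ × (ℝ × ℝ) | 0 < x.1} :=
      measurableSet_lt measurable_const (by fun_prop)
    have m3 : MeasurableSet {x : ℝ × (ℝ × ℝ) | 0 < x.2.2} :=
      measurableSet_lt measurable_const (by fun_prop)
    have m4 : MeasurableSet {x : ℝ × (ℝ × ℝ) | x.2.2 + x.1 < r} :=
      measurableSet_lt (by fun_prop) measurable_const
    have m5 : MeasurableSet {x : ℝ × (ℝ × ℝ) | z (x.2.1, x.2.2 + x.1) = z x.2} :=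
      measurableSet_eq_fun (hzme.comp (by fun_prop)) (hzme.comp (by fun_prop))
    exact m1.imp (m2.imp (m3.imp (m4.imp m5)))
  have hz1 : ∀ᵐ a, ∀ᵐ b, ∀ᵐ s, a ∈ I → 0 < s → 0 < b → b + s < r → z (a, b + s) = z (a, b) :=
    Measure.ae_ae_of_ae_prod
      ((Measure.ae_ae_comm (μ := (volume : Measure ℝ)) (ν := (volume : Measure (ℝ × ℝ)))
        hmeas).1 (Eventually.of_forall hzs))
  -- The constant on each line is recovered as the mean of `z`, which depends measurably on the
  -- line.
  refine ⟨fun a => r⁻¹ * ∫ b in Ioo 0 r, z (a, b), ?_, ?_⟩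
  · exact (hzm.integral_prod_right' (ν := volume.restrict (Ioo 0 r))).measurable.const_mul _
  · filter_upwards [hz1] with a ha haI
    obtain ⟨k, hk⟩ := exists_ae_const_of_shift (z := fun b => z (a, b)) hr
      (by filter_upwards [ha] with b hb; filter_upwards [hb] with s hs using hs haI)
    have hint : ∫ b in Ioo 0 r, z (a, b) = r * k := by
      rw [setIntegral_congr_ae measurableSet_Ioo hk]
      simp [hr.le]
    filter_upwards [hk] with b hb hbr
    rw [hint, ← hQeq a b hbr.1.le, ← mul_assoc, inv_mul_cancel₀ hr.ne', one_mul, ← hb hbr]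
    simp [hz]

/-- Square integrability of the trace in terms of the function and of its derivative. -/
theorem lintegral_trace_sq_le {v q : ℝ × ℝ → ℝ} (hv : StronglyMeasurable v)
    (hq : StronglyMeasurable q) {I : Set ℝ} (hI : MeasurableSet I) {r : ℝ} (hr : 0 < r)
    {w : ℝ → ℝ}
    (hw : ∀ᵐ a, a ∈ I → ∀ᵐ b, b ∈ Ioo 0 r → v (a, b) = w a + ∫ t in (0 : ℝ)..b, q (a, t))
    (k : ℝ) :
    ∫⁻ a in I, ‖w a - k‖ₑ ^ 2 ≤ (ENNReal.ofReal r)⁻¹ * 2 *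
      (∫⁻ y in I ×ˢ Ioo 0 r, ‖v y - k‖ₑ ^ 2) +
      2 * ENNReal.ofReal r * ∫⁻ y in I ×ˢ Ioo 0 r, ‖q y‖ₑ ^ 2 := by
  have hvm := hv.measurable
  have hqm := hq.measurable
  set ρ := ENNReal.ofReal r with hρ
  have hρ0 : ρ ≠ 0 := by simp [hρ, hr]
  have hρt : ρ ≠ ⊤ := by simp [hρ]
  have hvol : volume (Ioo (0 : ℝ) r) = ρ := by simp [hρ]
  have key : ∀ᵐ a ∂volume.restrict I, ‖w a - k‖ₑ ^ 2 ≤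
      ρ⁻¹ * 2 * (∫⁻ b in Ioo 0 r, ‖v (a, b) - k‖ₑ ^ 2) +
      2 * ρ * ∫⁻ t in Ioo 0 r, ‖q (a, t)‖ₑ ^ 2 := by
    refine (ae_restrict_iff' hI).2 ?_
    filter_upwards [hw] with a ha haI
    have hb : ∀ᵐ b ∂volume.restrict (Ioo 0 r), ‖w a - k‖ₑ ^ 2 ≤
        2 * (‖v (a, b) - k‖ₑ ^ 2 + ρ * ∫⁻ t in Ioo 0 r, ‖q (a, t)‖ₑ ^ 2) := by
      refine (ae_restrict_iff' measurableSet_Ioo).2 ?_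
      filter_upwards [ha haI] with b hb hbr
      have h1 : ‖w a - v (a, b)‖ₑ ^ 2 ≤ ρ * ∫⁻ t in Ioo 0 r, ‖q (a, t)‖ₑ ^ 2 := by
        have h2 : ‖w a - v (a, b)‖ₑ ≤ ∫⁻ t in Ioo 0 r, ‖q (a, t)‖ₑ := by
          rw [hb hbr, sub_add_cancel_left, enorm_neg, intervalIntegral.integral_of_le hbr.1.le]
          refine (enorm_integral_le_lintegral_enorm _).trans (lintegral_mono_set ?_)
          exact fun t ht => ⟨ht.1, ht.2.trans_lt hbr.2⟩
        calc _ ≤ (∫⁻ t in Ioo 0 r, ‖q (a, t)‖ₑ) ^ 2 := by gcongr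
          _ ≤ volume.restrict (Ioo 0 r) univ * ∫⁻ t in Ioo 0 r, ‖q (a, t)‖ₑ ^ 2 :=
            sq_lintegral_le _ (hqm.comp (by fun_prop)).enorm.aemeasurable
          _ = _ := by rw [Measure.restrict_apply_univ, hvol]
      refine (enorm_sub_sq_le (w a) (v (a, b)) k).trans ?_
      rw [add_comm]
      gcongr
    have mv : Measurable fun b => ‖v (a, b) - k‖ₑ ^ 2 :=
      ((hvm.comp (by fun_prop : Measurable fun b : ℝ => (a, b))).sub_const k).enorm.pow_const 2
    have hfin := lintegral_mono_ae hb
    rw [lintegral_const, Measure.restrict_apply_univ, hvol,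
      lintegral_const_mul' _ _ (by simp),
      lintegral_add_left mv,
      lintegral_const, Measure.restrict_apply_univ, hvol] at hfin
    calc ‖w a - k‖ₑ ^ 2 = ρ⁻¹ * (‖w a - k‖ₑ ^ 2 * ρ) := by
          rw [mul_comm (‖w a - k‖ₑ ^ 2), ← mul_assoc, ENNReal.inv_mul_cancel hρ0 hρt, one_mul]
      _ ≤ ρ⁻¹ * (2 * ((∫⁻ b in Ioo 0 r, ‖v (a, b) - k‖ₑ ^ 2) +
            (ρ * ∫⁻ t in Ioo 0 r, ‖q (a, t)‖ₑ ^ 2) * ρ)) := by gcongr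
      _ = ρ⁻¹ * 2 * (∫⁻ b in Ioo 0 r, ‖v (a, b) - k‖ₑ ^ 2) +
            (ρ⁻¹ * ρ) * (2 * ρ * ∫⁻ t in Ioo 0 r, ‖q (a, t)‖ₑ ^ 2) := by ring
      _ = _ := by rw [ENNReal.inv_mul_cancel hρ0 hρt, one_mul]
  refine (lintegral_mono_ae key).trans ?_
  have m1 : Measurable fun y : ℝ × ℝ => ‖v y - k‖ₑ ^ 2 := (hvm.sub_const k).enorm.pow_const 2
  have m2 : Measurable fun y : ℝ × ℝ => ‖q y‖ₑ ^ 2 := hqm.enorm.pow_const 2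
  rw [Measure.volume_eq_prod, ← Measure.prod_restrict, lintegral_prod _ m1.aemeasurable,
    lintegral_prod _ m2.aemeasurable, lintegral_add_left, lintegral_const_mul' _ _ (by finiteness),
    lintegral_const_mul' _ _ (by finiteness)]
  exact (m1.lintegral_prod_right' (ν := volume.restrict (Ioo 0 r))).const_mul _

theorem integrableOn_of_lintegral_sq {α : Type*} [MeasurableSpace α] {μ : Measure α} {s : Set α}
    (hs : μ s ≠ ⊤) {F : Type*} [NormedAddCommGroup F] {f : α → F} (hf : AEStronglyMeasurable f μ)
    (h : ∫⁻ x in s, ‖f x‖ₑ ^ 2 ∂μ ≠ ⊤) : IntegrableOn f s μ := by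
  have : IsFiniteMeasure (μ.restrict s) := ⟨by simpa using hs.lt_top⟩
  have h2 : MemLp f 2 (μ.restrict s) := by
    refine ⟨hf.restrict, ?_⟩
    rw [eLpNorm_lt_top_iff_lintegral_rpow_enorm_lt_top (by simp) (by simp)]
    simpa using h.lt_top
  exact h2.integrable (by norm_num)

/-- At almost every point, the values of a function near the end of a line are close in mean
to its trace along that line. -/
theorem ae_lintegral_sub_trace_le {v q : ℝ × ℝ → ℝ} (hv : StronglyMeasurable v)
    {I : Set ℝ} (hI : IsOpen I) {r : ℝ} (hr : 0 < r)
    (hqi : IntegrableOn q (I ×ˢ Ioo 0 r)) {w : ℝ → ℝ}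
    (hwi : IntegrableOn w I)
    (hw : ∀ᵐ a, a ∈ I → ∀ᵐ b, b ∈ Ioo 0 r → v (a, b) = w a + ∫ t in (0 : ℝ)..b, q (a, t)) :
    ∀ᵐ a₀, a₀ ∈ I → ∀ ε > 0, ∀ᶠ δ in 𝓝[>] (0 : ℝ),
      ∫⁻ y in Metric.ball a₀ δ ×ˢ Ioo 0 δ, ‖v y - w a₀‖ₑ ≤ ENNReal.ofReal (ε * δ ^ 2) := by
  set w' := I.indicator w with hw'
  have hw'i : Integrable w' := by rwa [integrable_indicator_iff hI.measurableSet]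
  -- `H n a` bounds the variation of `v (a, ·)` on `(0, r / (n + 1))`. Using countably many heights
  -- leaves one null set of exceptional `a₀`, and `H n a₀ → 0` as the strips shrink.
  set H : ℕ → ℝ → ℝ := fun n => I.indicator fun a => ∫ t in Ioo 0 (r / (n + 1)), |q (a, t)|
    with hH
  have hrn : ∀ n : ℕ, r / (n + 1) ≤ r := fun n =>
    div_le_self hr.le (by linarith [n.cast_nonneg (α := ℝ)])
  have hrn0 : ∀ n : ℕ, 0 < r / (n + 1) := fun n => by positivity
  have hHi : ∀ n, Integrable (H n) := by
    intro n
    rw [hH, integrable_indicator_iff hI.measurableSet]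
    have h1 : Integrable (fun y => |q y|)
        ((volume.restrict I).prod (volume.restrict (Ioo 0 (r / (n + 1))))) := by
      rw [Measure.prod_restrict]
      exact (hqi.mono_set (prod_mono le_rfl (Ioo_subset_Ioo le_rfl (hrn n)))).abs
    exact h1.integral_prod_left
  have hqa : ∀ᵐ a, a ∈ I → IntegrableOn (fun t => q (a, t)) (Ioo 0 r) := by
    have h1 : Integrable q ((volume.restrict I).prod (volume.restrict (Ioo 0 r))) := by
      rw [Measure.prod_restrict]; exact hqi
    exact (ae_restrict_iff' hI.measurableSet).1 h1.prod_right_ae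
  have hHn : ∀ᵐ a₀ : ℝ, ∀ n, Tendsto (fun δ => ⨍ a in Metric.closedBall a₀ δ, H n a) (𝓝[>] 0)
      (𝓝 (H n a₀)) := by
    rw [ae_all_iff]
    intro n
    filter_upwards [IsUnifLocDoublingMeasure.ae_tendsto_average volume
      (hHi n).locallyIntegrable 1] with a₀ h
    refine h (fun _ => a₀) (fun δ => δ) tendsto_id ?_
    filter_upwards [self_mem_nhdsWithin] with δ hδ
    exact Metric.mem_closedBall_self (by simpa using (mem_Ioi.1 hδ).le)
  have hwn : ∀ᵐ a₀ : ℝ, Tendsto (fun δ => ⨍ a in Metric.closedBall a₀ δ, ‖w' a - w' a₀‖) (𝓝[>] 0)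
      (𝓝 0) := by
    filter_upwards [IsUnifLocDoublingMeasure.ae_tendsto_average_norm_sub volume
      hw'i.locallyIntegrable 1] with a₀ h
    refine h (fun _ => a₀) (fun δ => δ) tendsto_id ?_
    filter_upwards [self_mem_nhdsWithin] with δ hδ
    exact Metric.mem_closedBall_self (by simpa using (mem_Ioi.1 hδ).le)
  filter_upwards [hqa, hHn, hwn] with a₀ hqa₀ hHa₀ hwa₀ haI ε hε
  have hH0 : Tendsto (fun n => H n a₀) atTop (𝓝 0) := by
    have h1 : Tendsto (fun n : ℕ => ∫ t in Ioo 0 (r / (n + 1 : ℝ)), |q (a₀, t)|) atTop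
        (𝓝 (∫ t in ⋂ n : ℕ, Ioo 0 (r / (n + 1 : ℝ)), |q (a₀, t)|)) := by
      refine tendsto_setIntegral_of_antitone (fun _ => measurableSet_Ioo) ?_ ⟨0, ?_⟩
      · intro m n hmn
        refine Ioo_subset_Ioo le_rfl ?_
        gcongr
      · exact ((hqa₀ haI).mono_set (Ioo_subset_Ioo le_rfl (hrn 0))).abs
    have h2 : ⋂ n : ℕ, Ioo 0 (r / (n + 1 : ℝ)) = ∅ := by
      refine eq_empty_iff_forall_notMem.2 fun t ht => ?_
      rw [mem_iInter] at ht
      obtain ⟨n, hn⟩ := exists_nat_gt (r / t)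
      have ht0 : 0 < t := (ht 0).1
      have h3 := (ht n).2
      rw [lt_div_iff₀ (by positivity)] at h3
      rw [div_lt_iff₀ ht0] at hn
      nlinarith
    rw [h2] at h1
    simpa [hH, haI] using h1
  -- The averages over `J` of `|w - w a₀|` and of `H n` both end up below `ε / 4`; multiplied by the
  -- area `2 δ²` of `J × (0, δ)` they give at most `ε δ²`.
  obtain ⟨n, hn⟩ := (hH0.eventually_lt_const (show (0 : ℝ) < ε / 4 by positivity)).exists
  have hball : ∀ᶠ δ in 𝓝[>] (0 : ℝ), Metric.closedBall a₀ δ ⊆ I := by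
    obtain ⟨δ₀, hδ₀, hb⟩ := Metric.isOpen_iff.1 hI a₀ haI
    filter_upwards [Ioo_mem_nhdsGT hδ₀] with δ hδ
    exact (Metric.closedBall_subset_ball hδ.2).trans hb
  filter_upwards [self_mem_nhdsWithin, hball, Ioo_mem_nhdsGT (hrn0 n),
    (hHa₀ n).eventually_lt_const hn, hwa₀.eventually_lt_const (show (0 : ℝ) < ε / 4 by positivity)]
    with δ hδ0 hδI hδn hHδ hwδ
  have hδ : 0 < δ := hδ0
  set J := Metric.closedBall a₀ δ with hJ
  have hJm : MeasurableSet J := measurableSet_closedBall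
  have hJt : volume J ≠ ⊤ := measure_closedBall_lt_top.ne
  have hJv : volume.real J = 2 * δ := by
    rw [measureReal_def, hJ, Real.volume_closedBall, ENNReal.toReal_ofReal (by positivity)]
  have m1 : Measurable fun y : ℝ × ℝ => ‖v y - w a₀‖ₑ := (hv.measurable.sub_const _).enorm
  have hint : IntegrableOn (fun a => ‖w' a - w' a₀‖ + H n a) J := by
    refine Integrable.add ?_ (hHi n).integrableOn
    exact (hw'i.integrableOn.sub (integrableOn_const hJt)).norm
  calc ∫⁻ y in Metric.ball a₀ δ ×ˢ Ioo 0 δ, ‖v y - w a₀‖ₑ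
      ≤ ∫⁻ y in J ×ˢ Ioo 0 δ, ‖v y - w a₀‖ₑ :=
        lintegral_mono_set (prod_mono Metric.ball_subset_closedBall le_rfl)
    _ = ∫⁻ a in J, ∫⁻ b in Ioo 0 δ, ‖v (a, b) - w a₀‖ₑ := by
        rw [Measure.volume_eq_prod, ← Measure.prod_restrict, lintegral_prod _ m1.aemeasurable]
    _ ≤ ∫⁻ a in J, ENNReal.ofReal (‖w' a - w' a₀‖ + H n a) * ENNReal.ofReal δ := by
        refine lintegral_mono_ae ((ae_restrict_iff' hJm).2 ?_)
        filter_upwards [hw, hqa] with a h1 h2 haJ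
        have ha := hδI haJ
        calc ∫⁻ b in Ioo 0 δ, ‖v (a, b) - w a₀‖ₑ
            ≤ ∫⁻ _ in Ioo 0 δ, ENNReal.ofReal (‖w' a - w' a₀‖ + H n a) := by
              refine lintegral_mono_ae ((ae_restrict_iff' measurableSet_Ioo).2 ?_)
              filter_upwards [h1 ha] with b h3 hb
              have hbr : b < r := hb.2.trans (hδn.2.trans_le (hrn n))
              rw [h3 ⟨hb.1, hbr⟩, ← ofReal_norm]
              refine ENNReal.ofReal_le_ofReal ?_
              rw [hw', indicator_of_mem ha, indicator_of_mem haI, add_sub_right_comm]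
              refine (norm_add_le _ _).trans ?_
              gcongr
              rw [intervalIntegral.integral_of_le hb.1.le]
              refine (norm_integral_le_integral_norm _).trans ?_
              simp only [hH, indicator_of_mem ha]
              refine setIntegral_mono_set
                ((h2 ha).mono_set (Ioo_subset_Ioo le_rfl (hrn n))).abs
                (Eventually.of_forall fun _ => abs_nonneg _) (LE.le.eventuallyLE ?_)
              exact fun t ht => ⟨ht.1, ht.2.trans_lt (hb.2.trans hδn.2)⟩
          _ = _ := by simp
    _ = ENNReal.ofReal ((∫ a in J, ‖w' a - w' a₀‖ + H n a) * δ) := by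
        rw [lintegral_mul_const' _ _ (by simp), ENNReal.ofReal_mul' hδ.le,
          ofReal_integral_eq_lintegral_ofReal hint]
        refine Eventually.of_forall fun a => add_nonneg (norm_nonneg _) ?_
        exact indicator_nonneg (fun a _ => integral_nonneg fun _ => abs_nonneg _) _
    _ ≤ _ := by
        refine ENNReal.ofReal_le_ofReal ?_
        have e1 : ∫ a in J, ‖w' a - w' a₀‖ + H n a =
            2 * δ * ((⨍ a in J, ‖w' a - w' a₀‖) + ⨍ a in J, H n a) := by
          rw [setAverage_eq, setAverage_eq, hJv, smul_eq_mul, smul_eq_mul, integral_add]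
          · field_simp
          · exact (hw'i.integrableOn.sub (integrableOn_const hJt)).norm
          · exact (hHi n).integrableOn
        rw [e1]
        have : (⨍ a in J, ‖w' a - w' a₀‖) + ⨍ a in J, H n a ≤ ε / 2 := by linarith
        calc _ ≤ 2 * δ * (ε / 2) * δ := by gcongr
          _ = _ := by ring

/-! ### Existence and bounds of the trace in a graph chart -/

namespace GraphChart

variable {S : Set Plane} {x₀ : Plane}

theorem setLIntegral_comp_le (c : GraphChart S x₀) (F : Plane → ℝ≥0∞) :
    ∫⁻ y in Metric.ball 0 c.r ×ˢ Ioo 0 c.r, F (c.Θ y) ≤ ∫⁻ x in S, F x := by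
  have h := c.measurePreserving.setLIntegral_comp_emb c.Θ.measurableEmbedding F
    (Metric.ball 0 c.r ×ˢ Ioo 0 c.r)
  rw [h]
  refine lintegral_mono_set ?_
  rintro _ ⟨⟨a, b⟩, ⟨ha, hb⟩, rfl⟩
  refine (c.mem_iff a b ?_ ?_).2 hb.1
  · simpa using ha
  · rw [abs_of_pos hb.1]; exact hb.2

/-- Smallness in mean in the chart implies existence of the trace. -/
theorem hasTraceAt (c : GraphChart S x₀) {u : Plane → ℝ} (hu : StronglyMeasurable u)
    {a₀ k : ℝ} (ha₀ : |a₀| < c.r)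
    (h : ∀ ε > 0, ∀ᶠ δ in 𝓝[>] (0 : ℝ),
      ∫⁻ y in Metric.ball a₀ δ ×ˢ Ioo 0 δ, ‖u (c.Θ y) - k‖ₑ ≤ ENNReal.ofReal (ε * δ ^ 2)) :
    HasTraceAt S u (c.Θ (a₀, 0)) k := by
  set x := c.Θ (a₀, 0) with hx
  set M : ℝ := c.M + 1 with hM
  have hM0 : 0 < M := by positivity
  unfold HasTraceAt
  rw [Metric.tendsto_nhds]
  intro η hη
  have htend : Tendsto (fun ρ : ℝ => M * ρ) (𝓝[>] 0) (𝓝[>] 0) := by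
    refine tendsto_nhdsWithin_of_tendsto_nhds_of_eventually_within _ ?_ ?_
    · have : Tendsto (fun ρ : ℝ => M * ρ) (𝓝 0) (𝓝 (M * 0)) :=
        (continuous_const.mul continuous_id).tendsto 0
      rw [mul_zero] at this
      exact this.mono_left nhdsWithin_le_nhds
    · filter_upwards [self_mem_nhdsWithin] with ρ hρ
      exact mul_pos hM0 hρ
  have hsmall : 0 < c.r - |a₀| := by linarith
  -- The ball of radius `ρ` lies in the chart square of size `M ρ` and `S ∩ B(x, ρ)` has volume at
  -- least `2 (ρ / M)²`. The factor `M⁻⁴` makes the integral at most `η (ρ / M)²`, hence the mean at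
  -- most `η / 2`.
  filter_upwards [self_mem_nhdsWithin, htend.eventually (h (η / M ^ 4) (by positivity)),
    htend.eventually (Ioo_mem_nhdsGT hsmall), Ioo_mem_nhdsGT (mul_pos hsmall hM0)]
    with ρ hρ0 hρ hρs hρs'
  have hρ0 : 0 < ρ := hρ0
  have hρr : M * ρ < c.r - |a₀| := hρs.2
  -- upper bound for the integral
  have hup : ∫⁻ y in S ∩ Metric.ball x ρ, ‖u y - k‖ₑ ≤
      ENNReal.ofReal (η / M ^ 4 * (M * ρ) ^ 2) := by
    refine le_trans ?_ hρ
    rw [c.measurePreserving.setLIntegral_comp_emb c.Θ.measurableEmbedding (fun y => ‖u y - k‖ₑ)]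
    refine lintegral_mono_set ?_
    rintro y ⟨hyS, hy⟩
    obtain ⟨⟨a, b⟩, rfl⟩ := c.Θ.surjective y
    refine ⟨(a, b), ?_, rfl⟩
    have h2 := c.lip_symm.dist_le_mul (c.Θ (a, b)) x
    rw [hx, c.Θ.symm_apply_apply, c.Θ.symm_apply_apply, ← hx] at h2
    have h3 : dist (a, b) (a₀, 0) < M * ρ := by
      have h4 : dist (c.Θ (a, b)) x < ρ := hy
      have h5 : (c.M : ℝ) * dist (c.Θ (a, b)) x ≤ c.M * ρ := by gcongr
      have h6 : M * ρ = c.M * ρ + ρ := by rw [hM]; ring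
      linarith
    rw [Prod.dist_eq, max_lt_iff, Real.dist_eq, Real.dist_eq, sub_zero] at h3
    simp only at h3
    have h7 : |a| < c.r := by
      have := abs_sub_abs_le_abs_sub a a₀
      linarith
    have h8 : |b| < c.r := by linarith [abs_nonneg a₀]
    have h9 : 0 < b := (c.mem_iff a b h7 h8).1 hyS
    refine ⟨?_, h9, ?_⟩
    · rw [Metric.mem_ball, Real.dist_eq]; exact h3.1
    · rw [← abs_of_pos h9]; exact h3.2
  -- lower bound for the volume
  have hlow : ENNReal.ofReal (2 * (ρ / M) ^ 2) ≤ volume (S ∩ Metric.ball x ρ) := by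
    have h1 : volume (Metric.ball a₀ (ρ / M) ×ˢ Ioo 0 (ρ / M)) =
        ENNReal.ofReal (2 * (ρ / M) ^ 2) := by
      rw [Measure.volume_eq_prod, Measure.prod_prod, Real.volume_ball, Real.volume_Ioo,
        ← ENNReal.ofReal_mul (by positivity)]
      congr 1; ring
    rw [← h1, ← c.measurePreserving.measure_preimage_emb c.Θ.measurableEmbedding]
    refine measure_mono ?_
    rintro ⟨a, b⟩ ⟨ha, hb⟩
    have ha' : |a - a₀| < ρ / M := by rwa [Metric.mem_ball, Real.dist_eq] at ha
    have hb' : b < ρ / M := hb.2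
    have hb0 : 0 < b := hb.1
    have h2 : ρ / M < c.r - |a₀| := by rw [div_lt_iff₀ hM0]; exact hρs'.2
    have h7 : |a| < c.r := by
      have := abs_sub_abs_le_abs_sub a a₀
      linarith
    refine ⟨(c.mem_iff a b h7 ?_).2 hb0, ?_⟩
    · rw [abs_of_pos hb0]; linarith [abs_nonneg a₀]
    · have h3 := c.lip.dist_le_mul (a, b) (a₀, 0)
      have h4 : dist (a, b) (a₀, 0) < ρ / M := by
        rw [Prod.dist_eq, max_lt_iff, Real.dist_eq, Real.dist_eq, sub_zero]
        exact ⟨ha', by simpa [abs_of_pos hb0] using hb'⟩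
      have h5 : (c.M : ℝ) * dist (a, b) (a₀, 0) ≤ c.M * (ρ / M) := by gcongr
      have h6 : c.M * (ρ / M) < ρ := by
        rw [mul_div_assoc', div_lt_iff₀ hM0, hM]; nlinarith
      exact Metric.mem_ball.2 (lt_of_le_of_lt (h3.trans h5) h6)
  have hvt : volume (S ∩ Metric.ball x ρ) ≠ ⊤ :=
    measure_ne_top_of_subset inter_subset_right measure_ball_lt_top.ne
  have hlowr : 2 * (ρ / M) ^ 2 ≤ volume.real (S ∩ Metric.ball x ρ) :=
    (ENNReal.ofReal_le_iff_le_toReal hvt).1 hlow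
  have hvpos : 0 < volume.real (S ∩ Metric.ball x ρ) := lt_of_lt_of_le (by positivity) hlowr
  have hupr : ∫ y in S ∩ Metric.ball x ρ, |u y - k| ≤ η / M ^ 4 * (M * ρ) ^ 2 := by
    have e := integral_norm_eq_lintegral_enorm (μ := volume.restrict (S ∩ Metric.ball x ρ))
      (f := fun y => u y - k) (hu.sub stronglyMeasurable_const).aestronglyMeasurable
    simp only [Real.norm_eq_abs] at e
    rw [e]
    exact ENNReal.toReal_le_of_le_ofReal (by positivity) hup
  rw [Real.dist_eq, sub_zero, setAverage_eq, smul_eq_mul, abs_of_nonneg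
    (mul_nonneg (by positivity) (integral_nonneg fun _ => abs_nonneg _)), inv_mul_lt_iff₀ hvpos]
  calc ∫ y in S ∩ Metric.ball x ρ, |u y - k| ≤ η / M ^ 4 * (M * ρ) ^ 2 := hupr
    _ = (ρ / M) ^ 2 * η := by field_simp
    _ < 2 * (ρ / M) ^ 2 * η := by nlinarith [show 0 < (ρ / M) ^ 2 * η by positivity]
    _ ≤ _ := by gcongr

/-- Pull `u` back by the chart. Only the derivative in the direction `e` of the chart lines enters,
and the segment formula supplies it directly, so no chain rule through the merely Lipschitz chart is
needed; preservation of volume transfers the integrals. -/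
theorem exists_trace (c : GraphChart S x₀) (hS : IsOpen S) {u : Plane → ℝ} {p : Plane → Plane}
    (h : IsSobolev S u p) :
    ∃ w : ℝ → ℝ, Measurable w ∧
      (∀ᵐ a, a ∈ Metric.ball 0 c.r → HasTraceAt S u (c.Θ (a, 0)) (w a)) ∧
      ∀ k : ℝ, ∫⁻ a in Metric.ball 0 c.r, ‖w a - k‖ₑ ^ 2 ≤ (ENNReal.ofReal c.r)⁻¹ * 2 *
        (∫⁻ x in S, ‖u x - k‖ₑ ^ 2) + 2 * ENNReal.ofReal c.r * ∫⁻ x in S, ‖p x‖ₑ ^ 2 := by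
  have hr := c.r_pos
  set I : Set ℝ := Metric.ball 0 c.r with hI
  have hIo : IsOpen I := Metric.isOpen_ball
  set v : ℝ × ℝ → ℝ := fun y => u (c.Θ y) with hv
  set q : ℝ × ℝ → ℝ := fun y => inner ℝ (p (c.Θ y)) c.e with hq
  have hvm : StronglyMeasurable v := h.meas.comp_measurable c.Θ.continuous.measurable
  have hqm : StronglyMeasurable q :=
    (h.meas_grad.comp_measurable c.Θ.continuous.measurable).inner stronglyMeasurable_const
  have hq2 : ∫⁻ y in I ×ˢ Ioo 0 c.r, ‖q y‖ₑ ^ 2 ≤ ∫⁻ x in S, ‖p x‖ₑ ^ 2 := by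
    refine le_trans ?_ (c.setLIntegral_comp_le fun x => ‖p x‖ₑ ^ 2)
    refine lintegral_mono fun y => ?_
    gcongr
    have := norm_inner_le_norm (𝕜 := ℝ) (p (c.Θ y)) c.e
    rw [c.norm_e, mul_one] at this
    exact enorm_le_iff_norm_le.2 this
  have hpt : ∫⁻ x in S, ‖p x‖ₑ ^ 2 ≠ ⊤ := by
    have := h.memLp_grad.2
    rw [eLpNorm_lt_top_iff_lintegral_rpow_enorm_lt_top (by simp) (by simp)] at this
    simpa using this.ne
  have hut : ∫⁻ x in S, ‖u x‖ₑ ^ 2 ≠ ⊤ := by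
    have := h.memLp.2
    rw [eLpNorm_lt_top_iff_lintegral_rpow_enorm_lt_top (by simp) (by simp)] at this
    simpa using this.ne
  have hIv : volume (I ×ˢ Ioo 0 c.r) ≠ ⊤ := by
    rw [Measure.volume_eq_prod, Measure.prod_prod]
    simp only [hI, Real.volume_ball, Real.volume_Ioo]
    finiteness
  have hqi : IntegrableOn q (I ×ˢ Ioo 0 c.r) :=
    integrableOn_of_lintegral_sq hIv hqm.aestronglyMeasurable (ne_top_of_le_ne_top hpt hq2)
  have hshift : ∀ s ∈ Ioo 0 c.r, ∀ᵐ y : ℝ × ℝ, y.1 ∈ I → 0 < y.2 → y.2 + s < c.r →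
      v (y.1, y.2 + s) - v y = ∫ t in y.2..(y.2 + s), q (y.1, t) := by
    intro s hs
    set W : Set Plane := c.Θ '' (I ×ˢ Ioo 0 (c.r - s)) with hW
    have hWo : IsOpen W := c.Θ.isOpenMap _ (hIo.prod isOpen_Ioo)
    have hWS : ∀ x ∈ W, ∀ τ ∈ Icc (0 : ℝ) 1, x + τ • (s • c.e) ∈ S := by
      rintro _ ⟨⟨a, b⟩, ⟨ha, hb⟩, rfl⟩ τ hτ
      rw [smul_smul, ← c.shift]
      have h1 : 0 ≤ τ * s := mul_nonneg hτ.1 hs.1.le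
      have h2 : τ * s ≤ s := mul_le_of_le_one_left hs.1.le hτ.2
      have h3 : 0 < b := hb.1
      have h4 : b < c.r - s := hb.2
      refine (c.mem_iff _ _ (by simpa [hI] using ha) ?_).2 (by linarith)
      rw [abs_lt]; constructor <;> linarith
    have := c.measurePreserving.quasiMeasurePreserving.ae (h.ae_sub_eq hS hWo (s • c.e) hWS)
    filter_upwards [this] with ⟨a, b⟩ h1 ha hb hbs
    have h2 := h1 ⟨(a, b), ⟨ha, hb, by simp only at hbs ⊢; linarith⟩, rfl⟩
    simp only [smul_smul, ← c.shift, inner_smul_right] at h2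
    rw [intervalIntegral.integral_const_mul] at h2
    -- The parameter of the segment of direction `s e` runs over `[0, 1]`; rescaling by `s` turns it
    -- into the height in the chart.
    have h3 := intervalIntegral.mul_integral_comp_mul_add (a := (0 : ℝ)) (b := 1)
      (f := fun t => inner ℝ (p (c.Θ (a, t))) c.e) s b
    rw [mul_zero, mul_one, zero_add, add_comm s b] at h3
    simp only [hv, hq]
    rw [h2, ← h3]
    congr 1
    refine intervalIntegral.integral_congr fun τ _ => ?_
    simp only [mul_comm s τ, add_comm b]
  obtain ⟨w, hwm, hw⟩ := exists_trace_on_lines hvm hqm hIo.measurableSet hr hqi hshift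
  have hbound : ∀ k : ℝ, ∫⁻ a in I, ‖w a - k‖ₑ ^ 2 ≤ (ENNReal.ofReal c.r)⁻¹ * 2 *
      (∫⁻ x in S, ‖u x - k‖ₑ ^ 2) + 2 * ENNReal.ofReal c.r * ∫⁻ x in S, ‖p x‖ₑ ^ 2 := by
    intro k
    refine (lintegral_trace_sq_le hvm hqm hIo.measurableSet hr hw k).trans ?_
    gcongr
    exact c.setLIntegral_comp_le fun x => ‖u x - k‖ₑ ^ 2
  refine ⟨w, hwm, ?_, hbound⟩
  have hwi : IntegrableOn w I := by
    refine integrableOn_of_lintegral_sq measure_ball_lt_top.ne hwm.aestronglyMeasurable ?_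
    have := hbound 0
    simp only [sub_zero] at this
    refine ne_top_of_le_ne_top ?_ this
    have : (ENNReal.ofReal c.r)⁻¹ ≠ ⊤ := by simp [hr]
    finiteness
  filter_upwards [ae_lintegral_sub_trace_le hvm hIo hr hqi hwi hw] with a ha haI
  exact c.hasTraceAt h.meas (by simpa [hI] using haI) (ha haI)

end GraphChart

/-! ### The trace inequality on the boundary -/

/-- Near a point of the closure, `S ∩ B(x, r)` has positive measure, so the constant `|c - c'|` is
at most the sum of two means that tend to zero. -/
theorem HasTraceAt.unique {S : Set Plane} (hS : IsOpen S) {u : Plane → ℝ}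
    (hu : MemLp u 2 (volume.restrict S)) {x : Plane} (hx : x ∈ closure S) {c c' : ℝ}
    (h : HasTraceAt S u x c) (h' : HasTraceAt S u x c') : c = c' := by
  have hsum := h.add h'
  rw [_root_.add_zero] at hsum
  have hle : ∀ᶠ r in 𝓝[>] (0 : ℝ), |c - c'| ≤
      (⨍ y in S ∩ Metric.ball x r, |u y - c|) + ⨍ y in S ∩ Metric.ball x r, |u y - c'| := by
    filter_upwards [self_mem_nhdsWithin] with r hr
    set A := S ∩ Metric.ball x r with hA
    have hne : A.Nonempty := by
      obtain ⟨y, hy1, hy2⟩ := mem_closure_iff.1 hx _ Metric.isOpen_ball (Metric.mem_ball_self hr)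
      exact ⟨y, hy2, hy1⟩
    have hv0 : volume A ≠ 0 := ((hS.inter Metric.isOpen_ball).measure_pos volume hne).ne'
    have hvt : volume A ≠ ⊤ := measure_ne_top_of_subset inter_subset_right measure_ball_lt_top.ne
    have : IsFiniteMeasure (volume.restrict A) := ⟨by simpa using hvt.lt_top⟩
    have hui : Integrable u (volume.restrict A) :=
      (hu.mono_measure (Measure.restrict_mono inter_subset_left le_rfl)).integrable (by norm_num)
    have i1 : Integrable (fun y => |u y - c|) (volume.restrict A) :=
      (hui.sub (integrable_const c)).abs
    have i2 : Integrable (fun y => |u y - c'|) (volume.restrict A) :=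
      (hui.sub (integrable_const c')).abs
    have e : ⨍ _ in A, |c - c'| = |c - c'| := setAverage_const hv0 hvt _
    rw [← e, setAverage_eq, setAverage_eq, setAverage_eq, ← smul_add, ← integral_add i1 i2]
    refine smul_le_smul_of_nonneg_left ?_ (by positivity)
    refine integral_mono (integrable_const _) (i1.add i2) fun y => ?_
    have := abs_sub_le c (u y) c'
    rw [abs_sub_comm c (u y)] at this
    exact this
  have h0 : |c - c'| ≤ 0 := ge_of_tendsto hsum hle
  exact sub_eq_zero.1 (abs_nonpos_iff.1 h0)

theorem HasTraceAt.trace_eq {S : Set Plane} (hS : IsOpen S) {u : Plane → ℝ}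
    (hu : MemLp u 2 (volume.restrict S)) {x : Plane} (hx : x ∈ closure S) {c : ℝ}
    (h : HasTraceAt S u x c) : trace S u x = c := by
  have hex : ∃ c, HasTraceAt S u x c := ⟨c, h⟩
  rw [trace, dif_pos hex]
  exact hex.choose_spec.unique hS hu hx h

/-- Sobolev functions on `S` have a trace at almost every point of `Γ`, controlled by the Sobolev
norm. -/
def TraceBound (S Γ : Set Plane) : Prop :=
  ∃ C : ℝ≥0, ∀ u p, IsSobolev S u p →
    (∀ᵐ x ∂(μH[1] : Measure Plane).restrict Γ, HasTraceAt S u x (trace S u x)) ∧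
    AEStronglyMeasurable (trace S u) ((μH[1] : Measure Plane).restrict Γ) ∧
    ∀ k : ℝ, ∫⁻ x in Γ, ‖trace S u x - k‖ₑ ^ 2 ∂μH[1] ≤
      C * ((∫⁻ x in S, ‖u x - k‖ₑ ^ 2) + ∫⁻ x in S, ‖p x‖ₑ ^ 2)

theorem TraceBound.mono {S Γ Γ' : Set Plane} (h : TraceBound S Γ) (hΓ : Γ' ⊆ Γ) :
    TraceBound S Γ' := by
  obtain ⟨C, hC⟩ := h
  refine ⟨C, fun u p hu => ?_⟩
  obtain ⟨h1, h2, h3⟩ := hC u p hu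
  exact ⟨ae_restrict_of_ae_restrict_of_subset hΓ h1,
    h2.mono_measure (Measure.restrict_mono hΓ le_rfl),
    fun k => (lintegral_mono_set hΓ).trans (h3 k)⟩

theorem TraceBound.union {S Γ Γ' : Set Plane} (h : TraceBound S Γ) (h' : TraceBound S Γ') :
    TraceBound S (Γ ∪ Γ') := by
  obtain ⟨C, hC⟩ := h
  obtain ⟨C', hC'⟩ := h'
  refine ⟨C + C', fun u p hu => ?_⟩
  obtain ⟨h1, h2, h3⟩ := hC u p hu
  obtain ⟨h1', h2', h3'⟩ := hC' u p hu
  refine ⟨(ae_restrict_union_iff _ _ _).2 ⟨h1, h1'⟩, aestronglyMeasurable_union_iff.2 ⟨h2, h2'⟩,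
    fun k => ?_⟩
  rw [ENNReal.coe_add, add_mul]
  exact (lintegral_union_le _ _ _).trans (add_le_add (h3 k) (h3' k))

theorem traceBound_empty (S : Set Plane) : TraceBound S ∅ := ⟨0, fun u p _ => by simp⟩

theorem IsSobolev.mono {S U : Set Plane} {u : Plane → ℝ} {p : Plane → Plane}
  (hu : IsSobolev U u p) (hSU : S ⊆ U) (hU : IsOpen U) : IsSobolev S u p := by
  refine ⟨hu.meas, hu.meas_grad, hu.memLp.mono_measure (Measure.restrict_mono hSU le_rfl),
    hu.memLp_grad.mono_measure (Measure.restrict_mono hSU le_rfl), fun φ hφ hc hs i => ?_⟩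
  have h1 := hu.weak φ hφ hc (hs.trans hSU) i
  have e1 : ∫ x in U, u x * fderiv ℝ φ x (unitVec i) =
      ∫ x in S, u x * fderiv ℝ φ x (unitVec i) := by
    refine (setIntegral_eq_of_subset_of_forall_sdiff_eq_zero hU.measurableSet hSU ?_)
    intro x hx
    have : fderiv ℝ φ x = 0 := by
      by_contra hne
      exact hx.2 (hs (support_fderiv_subset ℝ (Function.mem_support.2 hne)))
    simp [this]
  have e2 : ∫ x in U, p x i * φ x = ∫ x in S, p x i * φ x := by
    refine (setIntegral_eq_of_subset_of_forall_sdiff_eq_zero hU.measurableSet hSU ?_)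
    intro x hx
    have : φ x = 0 := by
      by_contra hne
      exact hx.2 (hs (subset_tsupport _ (Function.mem_support.2 hne)))
    simp [this]
  rw [← e1, ← e2, h1]

/-- The trace inequality passes to a larger open set that has the same germ at each boundary
point. -/
theorem TraceBound.of_eventually_eq {S U Γ : Set Plane} (h : TraceBound S Γ) (hSU : S ⊆ U)
    (hΓ : MeasurableSet Γ) (hU : IsOpen U)
    (hloc : ∀ x ∈ Γ, x ∈ closure S ∧
      ∀ᶠ r in 𝓝[>] (0 : ℝ), U ∩ Metric.ball x r = S ∩ Metric.ball x r) : TraceBound U Γ := by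
  obtain ⟨C, hC⟩ := h
  refine ⟨C, fun u p hu => ?_⟩
  have hu' : IsSobolev S u p := hu.mono hSU hU
  obtain ⟨h1, h2, h3⟩ := hC u p hu'
  have hiff : ∀ x ∈ Γ, ∀ k, HasTraceAt S u x k → HasTraceAt U u x k := by
    intro x hx k hk
    refine hk.congr' ?_
    filter_upwards [(hloc x hx).2] with r hr
    rw [hr]
  have h4 : ∀ᵐ x ∂(μH[1] : Measure Plane).restrict Γ, trace U u x = trace S u x ∧
      HasTraceAt U u x (trace U u x) := by
    filter_upwards [h1, ae_restrict_mem hΓ] with x hx hxΓ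
    have h5 := hiff x hxΓ _ hx
    have h6 := h5.trace_eq hU hu.memLp (closure_mono hSU (hloc x hxΓ).1)
    exact ⟨h6, h6 ▸ h5⟩
  refine ⟨h4.mono fun x hx => hx.2, h2.congr (h4.mono fun x hx => hx.1.symm), fun k => ?_⟩
  calc _ = ∫⁻ x in Γ, ‖trace S u x - k‖ₑ ^ 2 ∂μH[1] :=
        lintegral_congr_ae (h4.mono fun x hx => by simp only [hx.1])
    _ ≤ _ := h3 k
    _ ≤ _ := by gcongr

/-- Inside the chart the boundary is the image of an interval under a Lipschitz map, so its length
measure is at most `M` times the image of Lebesgue measure. Null sets and integral bounds in the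
parameter `a` thus pass to the boundary. -/
theorem GraphChart.traceBound {S : Set Plane} {x₀ : Plane} (c : GraphChart S x₀) (hS : IsOpen S) :
    TraceBound S (frontier S ∩ c.nhd) := by
  have hr := c.r_pos
  set I : Set ℝ := Metric.ball 0 c.r with hI
  set g : ℝ → Plane := fun a => c.Θ (a, 0) with hg
  have hgl : LipschitzWith c.M g := by
    have := c.lip.comp (LipschitzWith.prodMk_right (0 : ℝ) (α := ℝ))
    simpa [hg, Function.comp_def] using this
  have hπ : Continuous fun x => (c.Θ.symm x).1 := continuous_fst.comp c.Θ.symm.continuous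
  have hπg : ∀ a, (c.Θ.symm (g a)).1 = a := fun a => by simp [hg]
  have hginj : Function.Injective g := fun a b hab => by rw [← hπg a, hab, hπg b]
  have hemb : MeasurableEmbedding g :=
    hgl.continuous.measurableEmbedding hginj
  have hset : frontier S ∩ c.nhd = g '' I := by
    ext x
    constructor
    · rintro ⟨hx, ⟨⟨a, b⟩, hab, rfl⟩⟩
      rw [mem_ball_iff] at hab
      have hb := (c.mem_frontier_iff hS hab.1 hab.2).1 hx
      simp only at hb
      exact ⟨a, by simpa [hI] using hab.1, by rw [hg, hb]⟩
    · rintro ⟨a, ha, rfl⟩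
      have ha' : |a| < c.r := by simpa [hI] using ha
      refine ⟨(c.mem_frontier_iff hS ha' (by simpa using hr)).2 rfl, (a, 0), ?_, rfl⟩
      rw [mem_ball_iff]
      exact ⟨ha', by simpa using hr⟩
  have hmeasle : (μH[1] : Measure Plane).restrict (g '' I) ≤
      (c.M : ℝ≥0∞) • (volume.restrict I).map g := by
    refine Measure.le_iff.2 fun A hA => ?_
    rw [Measure.restrict_apply hA, Measure.smul_apply, Measure.map_apply hemb.measurable hA,
      Measure.restrict_apply (hemb.measurable hA)]
    have : A ∩ g '' I = g '' (g ⁻¹' A ∩ I) := by rw [image_preimage_inter]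
    rw [this, ← hausdorffMeasure_real, smul_eq_mul]
    have := (hgl.lipschitzOnWith (s := g ⁻¹' A ∩ I)).hausdorffMeasure_image_le zero_le_one
    simpa using this
  set K₁ : ℝ≥0∞ := (ENNReal.ofReal c.r)⁻¹ * 2 with hK₁
  set K₂ : ℝ≥0∞ := 2 * ENNReal.ofReal c.r with hK₂
  have hK₁t : K₁ ≠ ⊤ := ENNReal.mul_ne_top (by simpa using hr) (by simp)
  have hK₂t : K₂ ≠ ⊤ := ENNReal.mul_ne_top (by simp) (by simp)
  refine ⟨c.M * (K₁ + K₂).toNNReal, fun u p hu => ?_⟩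
  obtain ⟨w, hwm, hwt, hwb⟩ := c.exists_trace hS hu
  rw [hset]
  have hae : ∀ᵐ x ∂(μH[1] : Measure Plane).restrict (g '' I),
      HasTraceAt S u x (w (c.Θ.symm x).1) ∧ x ∈ closure S := by
    have h1 : ∀ᵐ x ∂(volume.restrict I).map g,
        HasTraceAt S u x (w (c.Θ.symm x).1) ∧ x ∈ closure S := by
      refine hemb.ae_map_iff.2 ((ae_restrict_iff' Metric.isOpen_ball.measurableSet).2 ?_)
      filter_upwards [hwt] with a ha haI
      rw [hπg]
      refine ⟨ha haI, frontier_subset_closure ?_⟩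
      exact (hset.symm.subset ⟨a, haI, rfl⟩).1
    exact (Measure.absolutelyContinuous_of_le hmeasle).ae_le
      (Measure.ae_smul_measure h1 _)
  have hae' : ∀ᵐ x ∂(μH[1] : Measure Plane).restrict (g '' I),
      HasTraceAt S u x (trace S u x) ∧ w (c.Θ.symm x).1 = trace S u x := by
    filter_upwards [hae] with x hx
    have := hx.1.trace_eq hS hu.memLp hx.2
    exact ⟨this ▸ hx.1, this.symm⟩
  have hwπ : Measurable fun x => w (c.Θ.symm x).1 := hwm.comp hπ.measurable
  refine ⟨hae'.mono fun x hx => hx.1, ?_, fun k => ?_⟩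
  · exact hwπ.aestronglyMeasurable.congr (hae'.mono fun x hx => hx.2)
  · calc ∫⁻ x in g '' I, ‖trace S u x - k‖ₑ ^ 2 ∂μH[1]
        = ∫⁻ x in g '' I, ‖w (c.Θ.symm x).1 - k‖ₑ ^ 2 ∂μH[1] :=
          lintegral_congr_ae (hae'.mono fun x hx => by simp only [hx.2])
      _ ≤ ∫⁻ x, ‖w (c.Θ.symm x).1 - k‖ₑ ^ 2 ∂((c.M : ℝ≥0∞) • (volume.restrict I).map g) :=
          lintegral_mono' hmeasle le_rfl
      _ = c.M * ∫⁻ a in I, ‖w a - k‖ₑ ^ 2 := by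
          rw [lintegral_smul_measure, hemb.lintegral_map]
          simp only [hπg, smul_eq_mul]
      _ ≤ c.M * (K₁ * (∫⁻ x in S, ‖u x - k‖ₑ ^ 2) + K₂ * ∫⁻ x in S, ‖p x‖ₑ ^ 2) := by
          gcongr; exact hwb k
      _ ≤ c.M * ((K₁ + K₂) * (∫⁻ x in S, ‖u x - k‖ₑ ^ 2) +
            (K₁ + K₂) * ∫⁻ x in S, ‖p x‖ₑ ^ 2) := by
          gcongr
          · exact le_self_add
          · exact le_add_self
      _ = _ := by
          rw [ENNReal.coe_mul, ENNReal.coe_toNNReal (by finiteness)]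
          ring

theorem traceBound_frontier {S : Set Plane} (hS : IsOpen S) (hb : Bornology.IsBounded S)
    (hL : HasLipschitzBoundary S) : TraceBound S (frontier S) := by
  have hloc : ∀ x ∈ frontier S, ∃ N : Set Plane, IsOpen N ∧ x ∈ N ∧
      TraceBound S (frontier S ∩ N) := by
    intro x hx
    obtain ⟨c⟩ := exists_graphChart hS hL hx
    exact ⟨c.nhd, c.isOpen_nhd, c.mem_nhd, c.traceBound hS⟩
  choose! N hNo hxN hN using hloc
  have hcpt : IsCompact (frontier S) :=
    hb.isCompact_closure.of_isClosed_subset isClosed_frontier frontier_subset_closure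
  obtain ⟨t, ht, hcov⟩ := hcpt.elim_nhds_subcover N fun x hx => (hNo x hx).mem_nhds (hxN x hx)
  have : ∀ s : Finset Plane, (∀ x ∈ s, x ∈ frontier S) →
      TraceBound S (frontier S ∩ ⋃ x ∈ s, N x) := by
    classical
    intro s
    induction s using Finset.induction_on with
    | empty => intro _; simpa using traceBound_empty S
    | insert a s ha ih =>
      intro hs
      rw [Finset.set_biUnion_insert, inter_union_distrib_left]
      exact (hN a (hs a (Finset.mem_insert_self _ _))).union
        (ih fun x hx => hs x (Finset.mem_insert_of_mem hx))
  exact (this t ht).mono (subset_inter le_rfl hcov)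

/-- Poincaré inequality for Sobolev functions vanishing on a part of the boundary of positive
length. -/
theorem exists_poincare {S D : Set Plane} (hS : IsOpen S) (hc : IsConnected S)
    (hb : Bornology.IsBounded S) (hL : HasLipschitzBoundary S) (hD : MeasurableSet D)
    (hDS : D ⊆ frontier S) (hD0 : 0 < μH[1] D) :
    ∃ C : ℝ≥0, ∀ u p, IsSobolev S u p →
      (∀ᵐ x ∂(μH[1] : Measure Plane).restrict D, HasTraceAt S u x 0) →
      ∫⁻ x in S, ‖u x‖ₑ ^ 2 ≤ C * ∫⁻ x in S, ‖p x‖ₑ ^ 2 := by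
  obtain ⟨C, hC⟩ := poincareOn_self hS hc hb hL
  obtain ⟨C', hC'⟩ := (traceBound_frontier hS hb hL).mono hDS
  -- The minimum with `1` keeps the inverse meaningful without knowing that the length of `D` is
  -- finite.
  set m : ℝ≥0∞ := min (μH[1] D) 1 with hm
  have hm0 : m ≠ 0 := by simp [hm, hD0.ne']
  have hmt : m ≠ ⊤ := ne_top_of_le_ne_top ENNReal.one_ne_top (min_le_right _ _)
  have hvt : volume S ≠ ⊤ := hb.measure_lt_top.ne
  set M : ℝ≥0∞ := 2 * (C + m⁻¹ * (C' * (C + 1)) * volume S) with hM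
  have hMt : M ≠ ⊤ := by
    have : m⁻¹ ≠ ⊤ := by simp [hm0]
    finiteness
  refine ⟨M.toNNReal, fun u p hu h0 => ?_⟩
  obtain ⟨k, hk⟩ := hC u p hu
  obtain ⟨-, -, h3⟩ := hC' u p hu
  set E := ∫⁻ x in S, ‖p x‖ₑ ^ 2 with hE
  have hum : Measurable u := hu.meas.measurable
  -- On `D` the trace is zero, so the trace bound for `u - k` measures the size of the constant `k`
  -- itself.
  have h4 : ‖k‖ₑ ^ 2 * m ≤ C' * (C + 1) * E := by
    calc ‖k‖ₑ ^ 2 * m ≤ ‖k‖ₑ ^ 2 * μH[1] D := by gcongr; exact min_le_left _ _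
      _ = ∫⁻ x in D, ‖trace S u x - k‖ₑ ^ 2 ∂μH[1] := by
          rw [← setLIntegral_const]
          refine lintegral_congr_ae ?_
          filter_upwards [h0, ae_restrict_mem hD] with x hx hxD
          rw [hx.trace_eq hS hu.memLp (frontier_subset_closure (hDS hxD)), zero_sub, enorm_neg]
      _ ≤ _ := h3 k
      _ ≤ C' * (C * E + E) := by gcongr
      _ = _ := by ring
  have h5 : ‖k‖ₑ ^ 2 ≤ m⁻¹ * (C' * (C + 1)) * E := by
    calc ‖k‖ₑ ^ 2 = m⁻¹ * (‖k‖ₑ ^ 2 * m) := by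
          rw [mul_comm (‖k‖ₑ ^ 2), ← mul_assoc, ENNReal.inv_mul_cancel hm0 hmt, one_mul]
      _ ≤ m⁻¹ * (C' * (C + 1) * E) := by gcongr
      _ = _ := by ring
  rw [ENNReal.coe_toNNReal hMt]
  calc ∫⁻ x in S, ‖u x‖ₑ ^ 2 ≤ ∫⁻ x in S, 2 * (‖u x - k‖ₑ ^ 2 + ‖k‖ₑ ^ 2) := by
        refine lintegral_mono fun x => ?_
        simpa using enorm_sub_sq_le (u x) k 0
    _ = 2 * ((∫⁻ x in S, ‖u x - k‖ₑ ^ 2) + ‖k‖ₑ ^ 2 * volume S) := by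
        rw [lintegral_const_mul' _ _ (by simp), lintegral_add_left (by fun_prop),
          setLIntegral_const]
    _ ≤ 2 * (C * E + m⁻¹ * (C' * (C + 1)) * E * volume S) := by gcongr
    _ = _ := by rw [hM]; ring

/-! ### The cracked body -/

theorem traceBound_of_null {S Γ : Set Plane} (h : μH[1] Γ = 0) : TraceBound S Γ := by
  refine ⟨0, fun u p _ => ?_⟩
  rw [Measure.restrict_eq_zero.2 h]
  simp

namespace CrackedBody

variable (B : CrackedBody)

theorem σ₀_lt_σbar : B.σ₀ < B.σbar := B.σ₀_lt.trans B.σ₁_lt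

theorem isCompact_crack {σ : ℝ} (hσ : σ ≤ B.σmax) : IsCompact (B.crack σ) :=
  isCompact_Icc.image_of_continuousOn
    (B.contDiff_γ.continuousOn.mono (Icc_subset_Icc le_rfl hσ))

theorem crack_mono {σ σ' : ℝ} (h : σ ≤ σ') : B.crack σ ⊆ B.crack σ' :=
  image_mono (Icc_subset_Icc le_rfl h)

/-- A Lipschitz image of an interval has Hausdorff dimension at most one. -/
theorem volume_crack : volume (B.crack B.σmax) = 0 := by
  have hK : ∃ K, LipschitzOnWith K B.γ (Icc 0 B.σmax) :=
    (B.contDiff_γ.of_le (by norm_num : (1 : WithTop ℕ∞) ≤ 3)).exists_lipschitzOnWith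
      (by decide) (convex_Icc _ _) isCompact_Icc
  obtain ⟨K, hK⟩ := hK
  have hd : dimH (B.crack B.σmax) < ((2 : ℝ≥0) : ℝ≥0∞) := by
    calc dimH (B.crack B.σmax) ≤ dimH (Icc 0 B.σmax) := hK.dimH_image_le
      _ ≤ dimH (univ : Set ℝ) := dimH_mono (subset_univ _)
      _ = 1 := Real.dimH_univ
      _ < _ := by norm_num
  refine measure_zero_of_dimH_lt ?_ hd
  have h2 : ((2 : ℝ≥0) : ℝ) = Module.finrank ℝ Plane := by simp
  rw [h2]
  exact Measure.absolutelyContinuous_isAddHaarMeasure _ _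

/-- Only the two end points of the path lie on the boundary, and `μH[1]` has no atoms. -/
theorem hausdorff_frontier_inter_crack : μH[1] (frontier B.Ω ∩ B.crack B.σmax) = 0 := by
  refine measure_mono_null (t := {B.γ 0, B.γ B.σmax}) ?_ ?_
  · rintro _ ⟨hx, s, hs, rfl⟩
    rcases eq_or_lt_of_le hs.1 with h0 | h0
    · exact Or.inl (by rw [← h0])
    rcases eq_or_lt_of_le hs.2 with h1 | h1
    · exact Or.inr (by rw [h1]; rfl)
    · exact absurd hx (by simp [B.isOpen_Ω.frontier_eq, B.γ_mem s ⟨h0, h1⟩])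
  · have := Measure.nullSingletonClass_hausdorff Plane (one_pos : (0 : ℝ) < 1)
    exact (Set.toFinite _).measure_zero _

theorem dirichlet_disjoint_crack {x : Plane} (hx : x ∈ B.dirichlet) : x ∉ B.crack B.σmax := by
  rintro ⟨s, hs, rfl⟩
  rcases eq_or_lt_of_le hs.1 with h0 | h0
  · exact B.γ_zero_mem.2 (by rwa [h0])
  rcases eq_or_lt_of_le hs.2 with h1 | h1
  · exact B.γ_σmax_mem.2 (by rwa [← h1])
  · exact absurd (B.dirichlet_subset hx) (by simp [B.isOpen_Ω.frontier_eq, B.γ_mem s ⟨h0, h1⟩])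

theorem isOpen_U : IsOpen B.U :=
  B.isOpen_Ω.sdiff (B.isCompact_crack (B.σ₀_lt_σbar.trans B.σbar_lt).le).isClosed

theorem U_subset : B.U ⊆ B.Ω := sdiff_subset

theorem union_subset_U : B.Ωp ∪ B.Ωm ⊆ B.U := by
  rw [B.union_eq]
  exact sdiff_subset_sdiff_right (B.crack_mono (B.σ₀_lt_σbar.trans B.σbar_lt).le)

theorem Ωp_subset_U : B.Ωp ⊆ B.U := subset_union_left.trans B.union_subset_U

theorem Ωm_subset_U : B.Ωm ⊆ B.U := subset_union_right.trans B.union_subset_U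

theorem U_ae_eq : B.U =ᵐ[volume] B.Ω :=
  sdiff_null_ae_eq_self (measure_mono_null (B.crack_mono (B.σ₀_lt_σbar.trans B.σbar_lt).le)
    B.volume_crack)

theorem restrict_U : volume.restrict B.U = volume.restrict B.Ω :=
  Measure.restrict_congr_set B.U_ae_eq

theorem union_ae_eq : (B.Ωp ∪ B.Ωm : Set Plane) =ᵐ[volume] B.U := by
  rw [B.union_eq]
  exact (sdiff_null_ae_eq_self B.volume_crack).trans B.U_ae_eq.symm

/-- Near a boundary point off the crack path, the cracked body lies on one side of the path. -/
theorem side_dichotomy {x : Plane} (hx : x ∈ frontier B.Ω) (hxc : x ∉ B.crack B.σmax) :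
    (x ∈ closure B.Ωp ∧ ∀ᶠ r in 𝓝[>] (0 : ℝ), B.U ∩ Metric.ball x r = B.Ωp ∩ Metric.ball x r) ∨
    (x ∈ closure B.Ωm ∧ ∀ᶠ r in 𝓝[>] (0 : ℝ), B.U ∩ Metric.ball x r = B.Ωm ∩ Metric.ball x r) := by
  obtain ⟨c⟩ := exists_graphChart B.isOpen_Ω B.lipschitz_Ω hx
  have hcl : IsClosed (B.crack B.σmax) := (B.isCompact_crack le_rfl).isClosed
  have hO : IsOpen (c.Θ ⁻¹' (B.crack B.σmax)ᶜ) := hcl.isOpen_compl.preimage c.Θ.continuous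
  obtain ⟨δ₀, hδ₀, hb⟩ := Metric.isOpen_iff.1 hO 0 (by simpa [c.map_zero] using hxc)
  set δ := min δ₀ c.r with hδ
  have hδ0 : 0 < δ := lt_min hδ₀ c.r_pos
  set N : Set Plane := c.Θ '' Metric.ball 0 δ with hN
  have hNo : IsOpen N := c.Θ.isOpenMap _ Metric.isOpen_ball
  have hxN : x ∈ N := ⟨0, Metric.mem_ball_self hδ0, c.map_zero⟩
  -- In the chart, `Ω` near `x` is a rectangle and hence connected; being disjoint from the path, it
  -- lies entirely in one of the two sides.
  set A : Set Plane := c.Θ '' (Metric.ball 0 δ ×ˢ Ioo 0 δ) with hA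
  have hAc : IsPreconnected A :=
    (((convex_ball (0 : ℝ) δ).prod (convex_Ioo 0 δ)).isPreconnected).image _
      c.Θ.continuous.continuousOn
  have hNA : N ∩ B.Ω ⊆ A := by
    rintro _ ⟨⟨⟨a, b⟩, hab, rfl⟩, hΩ⟩
    rw [GraphChart.mem_ball_iff] at hab
    have h1 : |a| < c.r := hab.1.trans_le (min_le_right _ _)
    have h2 : |b| < c.r := hab.2.trans_le (min_le_right _ _)
    have h3 := (c.mem_iff a b h1 h2).1 hΩ
    exact ⟨(a, b), ⟨by simpa using hab.1, h3, (abs_of_pos h3) ▸ hab.2⟩, rfl⟩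
  have hAu : A ⊆ B.Ωp ∪ B.Ωm := by
    rw [B.union_eq]
    rintro _ ⟨⟨a, b⟩, ⟨ha, hb'⟩, rfl⟩
    have ha' : |a| < δ := by simpa using ha
    have hb'' : |b| < δ := by rw [abs_of_pos hb'.1]; exact hb'.2
    refine ⟨(c.mem_iff a b (ha'.trans_le (min_le_right _ _))
      (hb''.trans_le (min_le_right _ _))).2 hb'.1, ?_⟩
    have : (a, b) ∈ Metric.ball (0 : ℝ × ℝ) δ₀ :=
      (GraphChart.mem_ball_iff _ _).2 ⟨ha'.trans_le (min_le_left _ _),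
        hb''.trans_le (min_le_left _ _)⟩
    exact hb this
  have hconcl : ∀ S : Set Plane, S ⊆ B.U → A ⊆ S → x ∈ closure S ∧
      ∀ᶠ r in 𝓝[>] (0 : ℝ), B.U ∩ Metric.ball x r = S ∩ Metric.ball x r := by
    intro S hSU hAS
    constructor
    · rw [mem_closure_iff]
      intro O hO hxO
      obtain ⟨y, ⟨hyO, hyN⟩, hyΩ⟩ := mem_closure_iff.1 (frontier_subset_closure hx) (O ∩ N)
        (hO.inter hNo) ⟨hxO, hxN⟩
      exact ⟨y, hyO, hAS (hNA ⟨hyN, hyΩ⟩)⟩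
    · obtain ⟨r₀, hr₀, hball⟩ := Metric.isOpen_iff.1 hNo x hxN
      filter_upwards [Ioo_mem_nhdsGT hr₀] with r hr
      refine Subset.antisymm (fun y hy => ⟨?_, hy.2⟩) (inter_subset_inter_left _ hSU)
      exact hAS (hNA ⟨hball (Metric.ball_subset_ball hr.2.le hy.2), B.U_subset hy.1⟩)
  rcases hAc.subset_or_subset B.isOpen_Ωp B.isOpen_Ωm B.disjoint_pm hAu with h | h
  · exact Or.inl (hconcl _ B.Ωp_subset_U h)
  · exact Or.inr (hconcl _ B.Ωm_subset_U h)

theorem side_p_of_mem {x : Plane} (hx : x ∈ frontier B.Ω) (hxc : x ∉ B.crack B.σmax)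
    (hxp : x ∈ closure B.Ωp) :
    ∀ᶠ r in 𝓝[>] (0 : ℝ), B.U ∩ Metric.ball x r = B.Ωp ∩ Metric.ball x r := by
  rcases B.side_dichotomy hx hxc with h | h
  · exact h.2
  · obtain ⟨r, hr, hr0⟩ := (h.2.and self_mem_nhdsWithin).exists
    obtain ⟨y, hy1, hy2⟩ := mem_closure_iff.1 hxp _ Metric.isOpen_ball (Metric.mem_ball_self hr0)
    have := hr.subset ⟨B.Ωp_subset_U hy2, hy1⟩
    exact absurd this.1 (disjoint_left.1 B.disjoint_pm hy2)

theorem side_m_of_mem {x : Plane} (hx : x ∈ frontier B.Ω) (hxc : x ∉ B.crack B.σmax)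
    (hxm : x ∈ closure B.Ωm) :
    ∀ᶠ r in 𝓝[>] (0 : ℝ), B.U ∩ Metric.ball x r = B.Ωm ∩ Metric.ball x r := by
  rcases B.side_dichotomy hx hxc with h | h
  · obtain ⟨r, hr, hr0⟩ := (h.2.and self_mem_nhdsWithin).exists
    obtain ⟨y, hy1, hy2⟩ := mem_closure_iff.1 hxm _ Metric.isOpen_ball (Metric.mem_ball_self hr0)
    have := hr.subset ⟨B.Ωm_subset_U hy2, hy1⟩
    exact absurd hy2 (disjoint_left.1 B.disjoint_pm this.1)
  · exact h.2

theorem isBounded_Ωp : Bornology.IsBounded B.Ωp :=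
  B.isBounded_Ω.subset (B.Ωp_subset_U.trans B.U_subset)

theorem isBounded_Ωm : Bornology.IsBounded B.Ωm :=
  B.isBounded_Ω.subset (B.Ωm_subset_U.trans B.U_subset)

theorem mem_frontier_of_mem_closure {S : Set Plane} (hS : IsOpen S) (hSΩ : S ⊆ B.Ω) {x : Plane}
    (hx : x ∈ frontier B.Ω) (hxS : x ∈ closure S) : x ∈ frontier S := by
  rw [hS.frontier_eq]
  refine ⟨hxS, fun h => ?_⟩
  rw [B.isOpen_Ω.frontier_eq] at hx
  exact hx.2 (hSΩ h)

/-- `U` itself, slit along the crack, need not have a Lipschitz boundary. Away from the path every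
boundary point sees `U` as one of the Lipschitz sets `Ωp`, `Ωm`, whose trace bounds apply; the
remaining boundary points form a null set. -/
theorem traceBound : TraceBound B.U (frontier B.Ω) := by
  have hcm : MeasurableSet (B.crack B.σmax) := (B.isCompact_crack le_rfl).measurableSet
  have hfm : MeasurableSet (frontier B.Ω \ B.crack B.σmax) :=
    isClosed_frontier.measurableSet.diff hcm
  have hp : TraceBound B.U ((frontier B.Ω \ B.crack B.σmax) ∩ frontier B.Ωp) := by
    refine ((traceBound_frontier B.isOpen_Ωp B.isBounded_Ωp B.lipschitz_Ωp).mono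
      inter_subset_right).of_eventually_eq B.Ωp_subset_U
      (hfm.inter isClosed_frontier.measurableSet) B.isOpen_U ?_
    rintro x ⟨⟨hx, hxc⟩, hxp⟩
    exact ⟨frontier_subset_closure hxp, B.side_p_of_mem hx hxc (frontier_subset_closure hxp)⟩
  have hm : TraceBound B.U ((frontier B.Ω \ B.crack B.σmax) ∩ frontier B.Ωm) := by
    refine ((traceBound_frontier B.isOpen_Ωm B.isBounded_Ωm B.lipschitz_Ωm).mono
      inter_subset_right).of_eventually_eq B.Ωm_subset_U
      (hfm.inter isClosed_frontier.measurableSet) B.isOpen_U ?_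
    rintro x ⟨⟨hx, hxc⟩, hxm⟩
    exact ⟨frontier_subset_closure hxm, B.side_m_of_mem hx hxc (frontier_subset_closure hxm)⟩
  refine ((hp.union hm).union (traceBound_of_null B.hausdorff_frontier_inter_crack)).mono ?_
  intro x hx
  by_cases hxc : x ∈ B.crack B.σmax
  · exact Or.inr ⟨hx, hxc⟩
  · refine Or.inl ?_
    rcases B.side_dichotomy hx hxc with h | h
    · exact Or.inl ⟨⟨hx, hxc⟩, B.mem_frontier_of_mem_closure B.isOpen_Ωp
        (B.Ωp_subset_U.trans B.U_subset) hx h.1⟩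
    · exact Or.inr ⟨⟨hx, hxc⟩, B.mem_frontier_of_mem_closure B.isOpen_Ωm
        (B.Ωm_subset_U.trans B.U_subset) hx h.1⟩

/-- The Dirichlet boundary avoids the path, so there `U` and the side `S` have the same germ and a
zero trace relative to `U` is a zero trace relative to `S`. -/
theorem poincare_side {S : Set Plane} (hS : IsOpen S) (hc : IsConnected S)
    (hL : HasLipschitzBoundary S) (hSU : S ⊆ B.U) (hD : 0 < μH[1] (B.dirichlet ∩ frontier S))
    (hloc : ∀ x ∈ frontier B.Ω, x ∉ B.crack B.σmax → x ∈ closure S →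
      ∀ᶠ r in 𝓝[>] (0 : ℝ), B.U ∩ Metric.ball x r = S ∩ Metric.ball x r) :
    ∃ C : ℝ≥0, ∀ u p, IsSobolev B.U u p →
      (∀ᵐ x ∂μH[1], x ∈ B.dirichlet → HasTraceAt B.U u x 0) →
      ∫⁻ x in S, ‖u x‖ₑ ^ 2 ≤ C * ∫⁻ x in B.U, ‖p x‖ₑ ^ 2 := by
  have hm : MeasurableSet (B.dirichlet ∩ frontier S) :=
    B.isClosed_dirichlet.measurableSet.inter isClosed_frontier.measurableSet
  obtain ⟨C, hC⟩ := exists_poincare hS hc (B.isBounded_Ω.subset (hSU.trans B.U_subset)) hL hm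
    inter_subset_right hD
  refine ⟨C, fun u p hu h0 => ?_⟩
  refine (hC u p (hu.mono hSU B.isOpen_U) ((ae_restrict_iff' hm).2 ?_)).trans ?_
  · filter_upwards [h0] with x hx hxD
    refine (hx hxD.1).congr' ?_
    filter_upwards [hloc x (B.dirichlet_subset hxD.1) (B.dirichlet_disjoint_crack hxD.1)
      (frontier_subset_closure hxD.2)] with r hr
    rw [hr]
  · gcongr

/-- The two sides are treated separately, each with its own piece of the Dirichlet boundary;
together they fill `U` up to the null path. -/
theorem exists_poincare :
    ∃ C : ℝ≥0, ∀ u p, IsSobolev B.U u p →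
      (∀ᵐ x ∂μH[1], x ∈ B.dirichlet → HasTraceAt B.U u x 0) →
      ∫⁻ x in B.U, ‖u x‖ₑ ^ 2 ≤ C * ∫⁻ x in B.U, ‖p x‖ₑ ^ 2 := by
  obtain ⟨C, hC⟩ := B.poincare_side B.isOpen_Ωp B.isConnected_Ωp B.lipschitz_Ωp B.Ωp_subset_U
    B.dirichlet_pos_p fun x => B.side_p_of_mem
  obtain ⟨C', hC'⟩ := B.poincare_side B.isOpen_Ωm B.isConnected_Ωm B.lipschitz_Ωm B.Ωm_subset_U
    B.dirichlet_pos_m fun x => B.side_m_of_mem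
  refine ⟨C + C', fun u p hu h0 => ?_⟩
  rw [← Measure.restrict_congr_set B.union_ae_eq, ENNReal.coe_add, add_mul]
  refine (lintegral_union_le _ _ _).trans (add_le_add ?_ ?_)
  · rw [Measure.restrict_congr_set B.union_ae_eq]
    exact hC u p hu h0
  · rw [Measure.restrict_congr_set B.union_ae_eq]
    exact hC' u p hu h0

end CrackedBody

/-! ### The Sobolev space as a Banach space and the trace operator -/

theorem lintegral_enorm_sq_coeFn {α F : Type*} {m : MeasurableSpace α} {μ : Measure α}
    [NormedAddCommGroup F] (f : Lp F 2 μ) : ∫⁻ x, ‖f x‖ₑ ^ 2 ∂μ = ‖f‖ₑ ^ 2 := by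
  have h := eLpNorm_nnreal_pow_eq_lintegral (f := f) (μ := μ) (p := 2) (by norm_num)
  rw [Lp.enorm_def]
  simpa using h.symm

theorem isSobolev_of_mem_H1 {U : Set Plane} {q : Pair U} (hq : q ∈ H1 U) :
    IsSobolev U q.1 q.2 where
  meas := Lp.stronglyMeasurable _
  meas_grad := Lp.stronglyMeasurable _
  memLp := Lp.memLp _
  memLp_grad := Lp.memLp _
  weak := hq

theorem continuous_integral_inner {α F : Type*} {m : MeasurableSpace α} {μ : Measure α}
    [NormedAddCommGroup F] [InnerProductSpace ℝ F] {g : α → F} (hg : MemLp g 2 μ) :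
    Continuous fun f : Lp F 2 μ => ∫ x, inner ℝ (f x) (g x) ∂μ := by
  have : (fun f : Lp F 2 μ => ∫ x, inner ℝ (f x) (g x) ∂μ) =
      fun f => inner ℝ f (hg.toLp g) := by
    funext f
    rw [L2.inner_def]
    refine integral_congr_ae ?_
    filter_upwards [hg.coeFn_toLp] with x hx
    rw [hx]
  rw [this]
  fun_prop

theorem isClosed_H1 (U : Set Plane) : IsClosed (H1 U : Set (Pair U)) := by
  have : (H1 U : Set (Pair U)) = ⋂ (φ : Plane → ℝ) (_ : ContDiff ℝ ∞ φ)
      (_ : HasCompactSupport φ) (_ : tsupport φ ⊆ U) (i : Fin 2),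
      {q : Pair U | ∫ x in U, q.1 x * fderiv ℝ φ x (unitVec i) = - ∫ x in U, q.2 x i * φ x} := by
    ext q
    simp only [mem_iInter]
    rfl
  rw [this]
  refine isClosed_iInter fun φ => isClosed_iInter fun hφ => isClosed_iInter fun hc =>
    isClosed_iInter fun _ => isClosed_iInter fun i => isClosed_eq ?_ ?_
  · have hd : Continuous fun x => fderiv ℝ φ x (unitVec i) :=
      (hφ.continuous_fderiv (by simp)).clm_apply continuous_const
    have hg := hd.memLp_of_hasCompactSupport (μ := volume.restrict U) (p := 2)
      (hc.fderiv_apply (𝕜 := ℝ) (unitVec i))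
    refine ((continuous_integral_inner hg).comp continuous_fst).congr fun q => ?_
    simp [mul_comm]
  · have hd : Continuous fun x => φ x • unitVec i := hφ.continuous.smul continuous_const
    have hg := hd.memLp_of_hasCompactSupport (μ := volume.restrict U) (p := 2) hc.smul_right
    refine ((continuous_integral_inner hg).comp continuous_snd).neg.congr fun q => ?_
    simp [inner_smul_right, unitVec, EuclideanSpace.inner_single_right, mul_comm]

theorem HasTraceAt.congr_ae {U : Set Plane} {u u' : Plane → ℝ} {x : Plane} {c : ℝ}
    (h : HasTraceAt U u x c) (hu : u =ᵐ[volume.restrict U] u') : HasTraceAt U u' x c := by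
  unfold HasTraceAt at *
  refine h.congr fun r => ?_
  refine average_congr ?_
  filter_upwards [ae_mono (Measure.restrict_mono (μ := (volume : Measure Plane))
    (inter_subset_left (s := U) (t := Metric.ball x r)) le_rfl) hu] with y hy
  rw [hy]

theorem trace_congr_ae {U : Set Plane} {u u' : Plane → ℝ} (hu : u =ᵐ[volume.restrict U] u')
    (x : Plane) : trace U u x = trace U u' x := by
  have : HasTraceAt U u x = HasTraceAt U u' x := by
    funext c
    exact propext ⟨fun h => h.congr_ae hu, fun h => h.congr_ae hu.symm⟩
  unfold trace
  rw [this]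

theorem integrable_abs_sub_ball {U : Set Plane} {u : Plane → ℝ}
    (hu : MemLp u 2 (volume.restrict U)) (c : ℝ) (x : Plane) (r : ℝ) :
    Integrable (fun y => |u y - c|) (volume.restrict (U ∩ Metric.ball x r)) := by
  have h1 : MemLp u 2 (volume.restrict (U ∩ Metric.ball x r)) :=
    hu.mono_measure (Measure.restrict_mono inter_subset_left le_rfl)
  have hlt : volume (U ∩ Metric.ball x r) < ⊤ :=
    (measure_mono inter_subset_right).trans_lt measure_ball_lt_top
  have : IsFiniteMeasure (volume.restrict (U ∩ Metric.ball x r)) := ⟨by simpa using hlt⟩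
  exact ((h1.integrable (by norm_num)).sub (integrable_const c)).abs

theorem HasTraceAt.add {U : Set Plane} {u u' : Plane → ℝ} {x : Plane} {c c' : ℝ}
    (hu : MemLp u 2 (volume.restrict U)) (hu' : MemLp u' 2 (volume.restrict U))
    (h : HasTraceAt U u x c) (h' : HasTraceAt U u' x c') :
    HasTraceAt U (fun y => u y + u' y) x (c + c') := by
  unfold HasTraceAt at *
  have hsum := Tendsto.add h h'
  rw [_root_.add_zero] at hsum
  refine squeeze_zero (fun r => ?_) (fun r => ?_) hsum
  · rw [setAverage_eq]
    exact smul_nonneg (by positivity) (integral_nonneg fun _ => abs_nonneg _)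
  · simp only [setAverage_eq, ← smul_add]
    refine smul_le_smul_of_nonneg_left ?_ (by positivity)
    rw [← integral_add (integrable_abs_sub_ball hu c x r) (integrable_abs_sub_ball hu' c' x r)]
    refine integral_mono (integrable_abs_sub_ball (hu.add hu') _ x r)
      ((integrable_abs_sub_ball hu c x r).add (integrable_abs_sub_ball hu' c' x r)) fun y => ?_
    change |u y + u' y - (c + c')| ≤ |u y - c| + |u' y - c'|
    rw [add_sub_add_comm]
    exact abs_add_le _ _

theorem HasTraceAt.const_mul {U : Set Plane} {u : Plane → ℝ} {x : Plane} {c : ℝ} (k : ℝ)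
    (h : HasTraceAt U u x c) : HasTraceAt U (fun y => k * u y) x (k * c) := by
  unfold HasTraceAt at *
  have h := Tendsto.const_mul |k| h
  rw [mul_zero] at h
  refine h.congr fun r => ?_
  simp only [setAverage_eq, smul_eq_mul]
  rw [mul_left_comm, ← integral_const_mul]
  simp only [← abs_mul, mul_sub]

namespace TraceBound

variable {S Γ : Set Plane}

theorem ae_hasTraceAt (h : TraceBound S Γ) {q : Pair S} (hq : q ∈ H1 S) :
    ∀ᵐ x ∂(μH[1] : Measure Plane).restrict Γ, HasTraceAt S q.1 x (trace S q.1 x) := by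
  obtain ⟨C, hC⟩ := h
  exact (hC _ _ (isSobolev_of_mem_H1 hq)).1

theorem memLp_trace (h : TraceBound S Γ) {q : Pair S} (hq : q ∈ H1 S) :
    MemLp (trace S q.1) 2 ((μH[1] : Measure Plane).restrict Γ) := by
  obtain ⟨C, hC⟩ := h
  obtain ⟨-, hm, hb⟩ := hC _ _ (isSobolev_of_mem_H1 hq)
  refine ⟨hm, ?_⟩
  rw [eLpNorm_lt_top_iff_lintegral_rpow_enorm_lt_top (by simp) (by simp)]
  have h0 := hb 0
  simp only [sub_zero, lintegral_enorm_sq_coeFn] at h0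
  simp only [ENNReal.toReal_ofNat, ENNReal.rpow_ofNat]
  refine h0.trans_lt (ENNReal.mul_lt_top ENNReal.coe_lt_top ?_)
  exact ENNReal.add_lt_top.2 ⟨ENNReal.pow_lt_top enorm_lt_top, ENNReal.pow_lt_top enorm_lt_top⟩

theorem trace_add (h : TraceBound S Γ) (hS : IsOpen S) (hm : MeasurableSet Γ)
    (hΓ : Γ ⊆ closure S) {q q' : Pair S} (hq : q ∈ H1 S) (hq' : q' ∈ H1 S) :
    ∀ᵐ x ∂(μH[1] : Measure Plane).restrict Γ,
      trace S (q + q').1 x = trace S q.1 x + trace S q'.1 x := by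
  filter_upwards [h.ae_hasTraceAt hq, h.ae_hasTraceAt hq', ae_restrict_mem hm] with x h1 h2 hx
  refine HasTraceAt.trace_eq hS (Lp.memLp _) (hΓ hx) ?_
  refine (h1.add (Lp.memLp _) (Lp.memLp _) h2).congr_ae ?_
  exact (Lp.coeFn_add _ _).symm

theorem trace_smul (h : TraceBound S Γ) (hS : IsOpen S) (hm : MeasurableSet Γ)
    (hΓ : Γ ⊆ closure S) {q : Pair S} (hq : q ∈ H1 S) (k : ℝ) :
    ∀ᵐ x ∂(μH[1] : Measure Plane).restrict Γ, trace S (k • q).1 x = k * trace S q.1 x := by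
  filter_upwards [h.ae_hasTraceAt hq, ae_restrict_mem hm] with x h1 hx
  refine HasTraceAt.trace_eq hS (Lp.memLp _) (hΓ hx) ?_
  exact (h1.const_mul k).congr_ae (Lp.coeFn_smul k q.1).symm

/-- The trace as a linear map. -/
def traceLM (h : TraceBound S Γ) (hS : IsOpen S) (hm : MeasurableSet Γ) (hΓ : Γ ⊆ closure S) :
    H1 S →ₗ[ℝ] Lp ℝ 2 ((μH[1] : Measure Plane).restrict Γ) where
  toFun q := (h.memLp_trace q.2).toLp _
  map_add' q q' := by
    refine Lp.ext ?_
    filter_upwards [(h.memLp_trace (q + q').2).coeFn_toLp, (h.memLp_trace q.2).coeFn_toLp,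
      (h.memLp_trace q'.2).coeFn_toLp, h.trace_add hS hm hΓ q.2 q'.2,
      Lp.coeFn_add ((h.memLp_trace q.2).toLp _) ((h.memLp_trace q'.2).toLp _)]
      with x h1 h2 h3 h4 h5
    rw [h1, h5, Pi.add_apply, h2, h3, ← h4]
    rfl
  map_smul' k q := by
    refine Lp.ext ?_
    filter_upwards [(h.memLp_trace (k • q).2).coeFn_toLp, (h.memLp_trace q.2).coeFn_toLp,
      h.trace_smul hS hm hΓ q.2 k, Lp.coeFn_smul k ((h.memLp_trace q.2).toLp _)]
      with x h1 h2 h4 h5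
    rw [h1, RingHom.id_apply, h5, Pi.smul_apply, h2, smul_eq_mul, ← h4]
    rfl

theorem exists_norm_traceLM_le (h : TraceBound S Γ) (hS : IsOpen S) (hm : MeasurableSet Γ)
    (hΓ : Γ ⊆ closure S) : ∃ C : ℝ, ∀ q, ‖h.traceLM hS hm hΓ q‖ ≤ C * ‖q‖ := by
  obtain ⟨C, hC⟩ := id h
  -- The factor `2` comes from the maximum norm on pairs: the sum of the squares of both components
  -- is at most `2 ‖q‖²`.
  refine ⟨√(2 * C), fun q => ?_⟩
  obtain ⟨-, -, hb⟩ := hC _ _ (isSobolev_of_mem_H1 q.2)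
  have h0 := hb 0
  simp only [sub_zero, lintegral_enorm_sq_coeFn] at h0
  have h1 : ‖h.traceLM hS hm hΓ q‖ₑ ^ 2 ≤ C * (‖q.1.1‖ₑ ^ 2 + ‖q.1.2‖ₑ ^ 2) := by
    refine le_trans (le_of_eq ?_) h0
    rw [← lintegral_enorm_sq_coeFn]
    refine lintegral_congr_ae ?_
    filter_upwards [(h.memLp_trace q.2).coeFn_toLp] with x hx
    rw [← hx]
    rfl
  have h2 : ‖h.traceLM hS hm hΓ q‖ ^ 2 ≤ C * (‖q.1.1‖ ^ 2 + ‖q.1.2‖ ^ 2) := by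
    simp only [enorm_eq_nnnorm] at h1
    exact_mod_cast h1
  have h3 : ‖q.1.1‖ ≤ ‖q‖ := norm_fst_le q.1
  have h4 : ‖q.1.2‖ ≤ ‖q‖ := norm_snd_le q.1
  rw [← Real.sqrt_sq (norm_nonneg q), ← Real.sqrt_mul (by positivity)]
  refine Real.le_sqrt_of_sq_le (h2.trans ?_)
  have h5 := pow_le_pow_left₀ (norm_nonneg _) h3 2
  have h6 := pow_le_pow_left₀ (norm_nonneg _) h4 2
  have : (C : ℝ) * (‖q.1.1‖ ^ 2 + ‖q.1.2‖ ^ 2) ≤ C * (‖q‖ ^ 2 + ‖q‖ ^ 2) := by gcongr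
  linarith

/-- The trace operator. -/
def traceCLM (h : TraceBound S Γ) (hS : IsOpen S) (hm : MeasurableSet Γ) (hΓ : Γ ⊆ closure S) :
    H1 S →L[ℝ] Lp ℝ 2 ((μH[1] : Measure Plane).restrict Γ) :=
  (h.traceLM hS hm hΓ).mkContinuousOfExistsBound (h.exists_norm_traceLM_le hS hm hΓ)

theorem coeFn_traceCLM (h : TraceBound S Γ) (hS : IsOpen S) (hm : MeasurableSet Γ)
    (hΓ : Γ ⊆ closure S) (q : H1 S) :
    h.traceCLM hS hm hΓ q =ᵐ[(μH[1] : Measure Plane).restrict Γ] trace S q.1.1 :=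
  (h.memLp_trace q.2).coeFn_toLp

/-- Presents the boundary condition, stated pointwise by means over balls, as the kernel of a
continuous operator; this makes it stable under limits. -/
theorem mem_H1zero_iff (h : TraceBound S Γ) (hS : IsOpen S) (hm : MeasurableSet Γ)
    (hΓ : Γ ⊆ closure S) (q : H1 S) :
    (q : Pair S) ∈ H1zero S Γ ↔ h.traceCLM hS hm hΓ q = 0 := by
  have e : (q : Pair S) ∈ H1zero S Γ ↔
      ∀ᵐ x ∂(μH[1] : Measure Plane).restrict Γ, HasTraceAt S q.1.1 x 0 := by
    rw [ae_restrict_iff' hm]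
    exact ⟨fun h => h.2, fun h => ⟨q.2, h⟩⟩
  rw [e, Lp.eq_zero_iff_ae_eq_zero]
  constructor
  · intro h0
    filter_upwards [h0, h.coeFn_traceCLM hS hm hΓ q, ae_restrict_mem hm] with x h1 h2 hx
    rw [h2]
    exact HasTraceAt.trace_eq hS (Lp.memLp _) (hΓ hx) h1
  · intro h0
    filter_upwards [h0, h.coeFn_traceCLM hS hm hΓ q, h.ae_hasTraceAt q.2] with x h1 h2 h3
    rwa [← h2, h1] at h3

theorem isClosed_H1zero (h : TraceBound S Γ) (hS : IsOpen S) (hm : MeasurableSet Γ)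
    (hΓ : Γ ⊆ closure S) : IsClosed (H1zero S Γ : Set (Pair S)) := by
  have : (H1zero S Γ : Set (Pair S)) =
      Subtype.val '' {q : H1 S | h.traceCLM hS hm hΓ q = 0} := by
    ext q
    constructor
    · intro hq
      exact ⟨⟨q, hq.1⟩, (h.mem_H1zero_iff hS hm hΓ ⟨q, hq.1⟩).1 hq, rfl⟩
    · rintro ⟨q, hq, rfl⟩
      exact (h.mem_H1zero_iff hS hm hΓ q).2 hq
  rw [this]
  exact (isClosed_H1 S).isClosedEmbedding_subtypeVal.isClosedMap _
    (isClosed_eq (h.traceCLM hS hm hΓ).continuous continuous_const)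

end TraceBound

/-! ### The Neumann trace and the completeness of `V` -/

namespace CrackedBody

variable (B : CrackedBody)

/-- The crack has measure zero, so it contains no nonempty open set and `U` is dense in `Ω`. -/
theorem frontier_subset_closure_U : frontier B.Ω ⊆ closure B.U := by
  have h : B.Ω ⊆ closure B.U := by
    intro x hx
    by_contra hc
    have ho : IsOpen (B.Ω ∩ (closure B.U)ᶜ) := B.isOpen_Ω.inter isClosed_closure.isOpen_compl
    have hs : B.Ω ∩ (closure B.U)ᶜ ⊆ B.crack B.σmax := by
      rintro y ⟨hy, hy'⟩
      by_contra hn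
      refine hy' (subset_closure ⟨hy, fun hm => hn (B.crack_mono ?_ hm)⟩)
      linarith [B.σ₀_lt, B.σ₁_lt, B.σbar_lt]
    exact (ho.measure_pos volume ⟨x, hx, hc⟩).ne'
      (measure_mono_null hs B.volume_crack)
  exact frontier_subset_closure.trans (closure_minimal h isClosed_closure)

theorem neumann_subset : B.neumann ⊆ frontier B.Ω := sdiff_subset

theorem measurableSet_neumann : MeasurableSet B.neumann :=
  isClosed_frontier.measurableSet.diff B.isClosed_dirichlet.measurableSet

/-- The trace operator on the Neumann part of the boundary. -/
def neumannTrace : H1 B.U →L[ℝ] Lp ℝ 2 ((μH[1] : Measure Plane).restrict B.neumann) :=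
  (B.traceBound.mono B.neumann_subset).traceCLM B.isOpen_U B.measurableSet_neumann
    (B.neumann_subset.trans B.frontier_subset_closure_U)

theorem coeFn_neumannTrace (q : H1 B.U) :
    B.neumannTrace q =ᵐ[(μH[1] : Measure Plane).restrict B.neumann] trace B.U q.1.1 :=
  (B.traceBound.mono B.neumann_subset).coeFn_traceCLM B.isOpen_U B.measurableSet_neumann
    (B.neumann_subset.trans B.frontier_subset_closure_U) q

theorem isClosed_H1zero : IsClosed (H1zero B.U B.dirichlet : Set (Pair B.U)) :=
  (B.traceBound.mono B.dirichlet_subset).isClosed_H1zero B.isOpen_U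
    B.isClosed_dirichlet.measurableSet (B.dirichlet_subset.trans B.frontier_subset_closure_U)

theorem exists_norm_fn_le : ∃ C : ℝ≥0, ∀ v : B.V, ‖v.fn‖ ≤ C * ‖v‖ := by
  obtain ⟨C, hC⟩ := B.exists_poincare
  refine ⟨NNReal.sqrt C, fun v => ?_⟩
  have h := hC _ _ (isSobolev_of_mem_H1 v.2.1) v.2.2
  simp only [lintegral_enorm_sq_coeFn] at h
  have h2 : ‖v.fn‖ ^ 2 ≤ C * ‖v‖ ^ 2 := by
    simp only [enorm_eq_nnnorm] at h
    exact_mod_cast h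
  rw [Real.coe_sqrt, ← Real.sqrt_sq (norm_nonneg v), ← Real.sqrt_mul (by positivity)]
  exact Real.le_sqrt_of_sq_le h2

/-- The inclusion of `V` into `H¹`. -/
def toH1LM : B.V →ₗ[ℝ] H1 B.U :=
  Submodule.inclusion (p := H1zero B.U B.dirichlet) (p' := H1 B.U) fun _ h => h.1

theorem exists_norm_toH1LM_le : ∃ C : ℝ, ∀ v, ‖B.toH1LM v‖ ≤ C * ‖v‖ := by
  obtain ⟨C, hC⟩ := B.exists_norm_fn_le
  refine ⟨C + 1, fun v => ?_⟩
  have h1 : ‖B.toH1LM v‖ = max ‖v.fn‖ ‖v‖ := rfl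
  rw [h1]
  refine max_le ((hC v).trans ?_) ?_
  · nlinarith [norm_nonneg v]
  · nlinarith [norm_nonneg v, C.2, mul_nonneg C.2 (norm_nonneg v)]

/-- The inclusion of `V` into `H¹`, as a continuous map. -/
def toH1 : B.V →L[ℝ] H1 B.U := B.toH1LM.mkContinuousOfExistsBound B.exists_norm_toH1LM_le

theorem norm_le_toH1 (v : B.V) : ‖v‖ ≤ ‖B.toH1 v‖ := le_max_right ‖v.fn‖ ‖v‖

/-- By the Poincaré inequality the gradient norm is equivalent on `V` to the full `H¹` norm, and `V`
is closed in the complete space of pairs. -/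
theorem completeSpace_V : CompleteSpace B.V := by
  have ha : AntilipschitzWith 1 B.toH1 :=
    AddMonoidHomClass.antilipschitz_of_bound B.toH1 fun v => by simpa using B.norm_le_toH1 v
  have hi : IsUniformInducing B.toH1 := ha.isUniformInducing B.toH1.uniformContinuous
  have hv : IsUniformInducing (fun q : H1 B.U => (q : Pair B.U)) :=
    isUniformEmbedding_subtype_val.isUniformInducing
  have hc := hv.comp hi
  rw [completeSpace_iff_isComplete_range hc]
  have : range ((fun q : H1 B.U => (q : Pair B.U)) ∘ B.toH1) = H1zero B.U B.dirichlet := by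
    ext q
    exact ⟨fun ⟨v, hv⟩ => hv ▸ v.2, fun hq => ⟨⟨q, hq⟩, rfl⟩⟩
  rw [this]
  exact B.isClosed_H1zero.isComplete

/-- The norm on `V` is introduced only as a seminorm. The Poincaré inequality makes it definite, as
required for treating `V` as a Hilbert space. -/
theorem eq_zero_of_norm_eq_zero (v : B.V) (hv : ‖v‖ = 0) : v = 0 := by
  obtain ⟨C, hC⟩ := B.exists_norm_fn_le
  have h1 : v.fn = 0 := norm_le_zero_iff.1 ((hC v).trans (by simp [hv]))
  have h2 : SobolevV.grad v = 0 := norm_eq_zero.1 hv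
  exact Subtype.ext (Prod.ext h1 h2)

end CrackedBody

/-! ### Bounded Lipschitz maps -/

/-- `f` is Lipschitz and bounded on `s`. -/
structure BddLipOn {α E : Type*} [PseudoMetricSpace α] [SeminormedAddCommGroup E]
    (f : α → E) (s : Set α) : Prop where
  lip : ∃ K, LipschitzOnWith K f s
  bdd : ∃ M : ℝ, ∀ x ∈ s, ‖f x‖ ≤ M

namespace BddLipOn

variable {α β E F G : Type*} [PseudoMetricSpace α] [PseudoMetricSpace β]
  [SeminormedAddCommGroup E] [SeminormedAddCommGroup F] [SeminormedAddCommGroup G]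
  {f : α → E} {s : Set α}

theorem const (c : E) (s : Set α) : BddLipOn (fun _ => c) s :=
  ⟨⟨0, (LipschitzWith.const c).lipschitzOnWith⟩, ⟨‖c‖, fun _ _ => le_rfl⟩⟩

theorem comp_lip {g : β → α} {u : Set β} {K : ℝ≥0} (h : BddLipOn f s)
    (hg : LipschitzOnWith K g u) (hm : MapsTo g u s) : BddLipOn (fun x => f (g x)) u := by
  obtain ⟨⟨K', hK⟩, ⟨M, hM⟩⟩ := h
  exact ⟨⟨_, hK.comp hg hm⟩, ⟨M, fun x hx => hM _ (hm hx)⟩⟩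

theorem lip_comp {g : E → F} {K : ℝ≥0} (hg : LipschitzWith K g) (h : BddLipOn f s) :
    BddLipOn (fun x => g (f x)) s := by
  obtain ⟨⟨K', hK⟩, ⟨M, hM⟩⟩ := h
  refine ⟨⟨_, hg.comp_lipschitzOnWith hK⟩, ⟨‖g 0‖ + K * M, fun x hx => ?_⟩⟩
  have h1 : ‖g (f x) - g 0‖ ≤ K * ‖f x‖ := by
    simpa [dist_eq_norm] using hg.dist_le_mul (f x) 0
  calc ‖g (f x)‖ ≤ ‖g 0‖ + ‖g (f x) - g 0‖ := norm_le_norm_add_norm_sub' _ _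
    _ ≤ _ := by
      gcongr
      exact h1.trans (by gcongr; exact hM x hx)

theorem add {g : α → E} (hf : BddLipOn f s) (hg : BddLipOn g s) :
    BddLipOn (fun x => f x + g x) s := by
  obtain ⟨⟨K, hK⟩, ⟨M, hM⟩⟩ := hf
  obtain ⟨⟨K', hK'⟩, ⟨M', hM'⟩⟩ := hg
  exact ⟨⟨_, hK.add hK'⟩, ⟨M + M', fun x hx =>
    (norm_add_le _ _).trans (add_le_add (hM x hx) (hM' x hx))⟩⟩

theorem neg (hf : BddLipOn f s) : BddLipOn (fun x => - f x) s := by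
  obtain ⟨⟨K, hK⟩, ⟨M, hM⟩⟩ := hf
  exact ⟨⟨_, hK.neg⟩, ⟨M, fun x hx => (norm_neg _).trans_le (hM x hx)⟩⟩

theorem sub {g : α → E} (hf : BddLipOn f s) (hg : BddLipOn g s) :
    BddLipOn (fun x => f x - g x) s := by
  simpa only [sub_eq_add_neg] using hf.add hg.neg

theorem prodMk {g : α → F} (hf : BddLipOn f s) (hg : BddLipOn g s) :
    BddLipOn (fun x => (f x, g x)) s := by
  obtain ⟨⟨K, hK⟩, ⟨M, hM⟩⟩ := hf
  obtain ⟨⟨K', hK'⟩, ⟨M', hM'⟩⟩ := hg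
  exact ⟨⟨_, hK.prodMk hK'⟩, ⟨max M M', fun x hx =>
    max_le_max (hM x hx) (hM' x hx)⟩⟩

variable [NormedSpace ℝ E] [NormedSpace ℝ F] [NormedSpace ℝ G]

theorem clm (L : E →L[ℝ] F) (hf : BddLipOn f s) : BddLipOn (fun x => L (f x)) s :=
  lip_comp L.lipschitz hf

/-- Products are the reason for carrying a bound along with the Lipschitz constant: Lipschitz
factors have a Lipschitz product only where they are bounded. -/
theorem bilin (L : E →L[ℝ] F →L[ℝ] G) {g : α → F} (hf : BddLipOn f s) (hg : BddLipOn g s) :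
    BddLipOn (fun x => L (f x) (g x)) s := by
  obtain ⟨⟨K, hK⟩, ⟨M, hM⟩⟩ := hf
  obtain ⟨⟨K', hK'⟩, ⟨M', hM'⟩⟩ := hg
  refine ⟨⟨(‖L‖ * |M| * K' + ‖L‖ * K * |M'|).toNNReal, LipschitzOnWith.of_dist_le_mul
    fun x hx y hy => ?_⟩, ⟨‖L‖ * |M| * |M'|, fun x hx => ?_⟩⟩
  · have h1 := hK.dist_le_mul x hx y hy
    have h2 := hK'.dist_le_mul x hx y hy
    rw [dist_eq_norm] at h1 h2 ⊢
    rw [Real.coe_toNNReal _ (by positivity)]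
    have e : L (f x) (g x) - L (f y) (g y) = L (f x) (g x - g y) + L (f x - f y) (g y) := by
      simp
    rw [e]
    calc _ ≤ ‖L (f x) (g x - g y)‖ + ‖L (f x - f y) (g y)‖ := norm_add_le _ _
      _ ≤ ‖L‖ * ‖f x‖ * ‖g x - g y‖ + ‖L‖ * ‖f x - f y‖ * ‖g y‖ :=
        add_le_add (L.le_opNorm₂ _ _) (L.le_opNorm₂ _ _)
      _ ≤ ‖L‖ * |M| * (K' * dist x y) + ‖L‖ * (K * dist x y) * |M'| := by
        gcongr
        · exact (hM x hx).trans (le_abs_self M)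
        · exact (hM' y hy).trans (le_abs_self M')
      _ = _ := by ring
  · refine (L.le_opNorm₂ _ _).trans ?_
    gcongr
    · exact (hM x hx).trans (le_abs_self M)
    · exact (hM' x hx).trans (le_abs_self M')

theorem clm_apply {f : α → E →L[ℝ] F} {g : α → E} (hf : BddLipOn f s) (hg : BddLipOn g s) :
    BddLipOn (fun x => f x (g x)) s :=
  bilin (ContinuousLinearMap.id ℝ (E →L[ℝ] F)) hf hg

theorem clm_comp {f : α → F →L[ℝ] G} {g : α → E →L[ℝ] F} (hf : BddLipOn f s)
    (hg : BddLipOn g s) : BddLipOn (fun x => (f x).comp (g x)) s :=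
  bilin (ContinuousLinearMap.compL ℝ E F G) hf hg

end BddLipOn

theorem BddLipOn.of_lipschitzOnWith {α E : Type*} [PseudoMetricSpace α]
    [SeminormedAddCommGroup E] {f : α → E} {s : Set α} {K : ℝ≥0} (h : LipschitzOnWith K f s)
    (hs : IsCompact s) : BddLipOn f s :=
  ⟨⟨K, h⟩, hs.exists_bound_of_continuousOn h.continuousOn⟩

/-! ### Global solutions of differential equations -/

/-- The radial retraction onto the ball of radius `R`. -/
def radialRetract {V : Type*} [NormedAddCommGroup V] [NormedSpace ℝ V] (R : ℝ) (v : V) : V :=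
  (R / max R ‖v‖) • v

section Retract

variable {V : Type*} [NormedAddCommGroup V] [NormedSpace ℝ V]

theorem radialRetract_of_le {R : ℝ} (hR : 0 < R) {v : V} (hv : ‖v‖ ≤ R) :
    radialRetract R v = v := by
  rw [radialRetract, max_eq_left hv, div_self hR.ne', one_smul]

theorem norm_radialRetract_le {R : ℝ} (hR : 0 < R) (v : V) : ‖radialRetract R v‖ ≤ R := by
  have hm : 0 < max R ‖v‖ := lt_max_of_lt_left hR
  rw [radialRetract, norm_smul, Real.norm_of_nonneg (by positivity), div_mul_eq_mul_div,
    div_le_iff₀ hm]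
  gcongr
  exact le_max_right _ _

theorem norm_radialRetract_le_norm {R : ℝ} (hR : 0 < R) (v : V) :
    ‖radialRetract R v‖ ≤ ‖v‖ := by
  have hm : 0 < max R ‖v‖ := lt_max_of_lt_left hR
  rw [radialRetract, norm_smul, Real.norm_of_nonneg (by positivity)]
  refine mul_le_of_le_one_left (norm_nonneg _) ?_
  rw [div_le_one hm]
  exact le_max_left _ _

/-- Splitting into a change of vector and a change of scaling factor, each contributes at most `‖v -
w‖`; this works in any normed space. -/
theorem lipschitzWith_radialRetract {R : ℝ} (hR : 0 < R) :
    LipschitzWith 2 (radialRetract R : V → V) := by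
  refine LipschitzWith.of_dist_le_mul fun v w => ?_
  have ha : 0 < max R ‖v‖ := lt_max_of_lt_left hR
  have hb : 0 < max R ‖w‖ := lt_max_of_lt_left hR
  rw [dist_eq_norm, dist_eq_norm]
  have e : radialRetract R v - radialRetract R w =
      (R / max R ‖v‖) • (v - w) + (R / max R ‖v‖ - R / max R ‖w‖) • w := by
    simp only [radialRetract]
    module
  have h1 : R / max R ‖v‖ ≤ 1 := (div_le_one ha).2 (le_max_left _ _)
  have h3 : |max R ‖w‖ - max R ‖v‖| ≤ ‖v - w‖ := by
    have := abs_max_sub_max_le_max R ‖w‖ R ‖v‖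
    rw [sub_self, abs_zero, max_eq_right (abs_nonneg (‖w‖ - ‖v‖))] at this
    refine this.trans ?_
    rw [abs_sub_comm]
    exact abs_norm_sub_norm_le v w
  have h2 : ‖(R / max R ‖v‖ - R / max R ‖w‖) • w‖ ≤ ‖v - w‖ := by
    have e2 : R / max R ‖v‖ - R / max R ‖w‖ =
        (R / max R ‖v‖) * ((max R ‖w‖ - max R ‖v‖) / max R ‖w‖) := by
      field_simp
    rw [e2, norm_smul, norm_mul, Real.norm_of_nonneg (show 0 ≤ R / max R ‖v‖ by positivity),
      norm_div, Real.norm_of_nonneg hb.le, Real.norm_eq_abs]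
    calc R / max R ‖v‖ * (|max R ‖w‖ - max R ‖v‖| / max R ‖w‖) * ‖w‖
        = R / max R ‖v‖ * |max R ‖w‖ - max R ‖v‖| * (‖w‖ / max R ‖w‖) := by ring
      _ ≤ 1 * |max R ‖w‖ - max R ‖v‖| * 1 := by
        gcongr
        exact (div_le_one hb).2 (le_max_right _ _)
      _ ≤ ‖v - w‖ := by simpa using h3
  rw [e]
  calc _ ≤ ‖(R / max R ‖v‖) • (v - w)‖ + ‖(R / max R ‖v‖ - R / max R ‖w‖) • w‖ :=
        norm_add_le _ _
    _ ≤ 1 * ‖v - w‖ + ‖v - w‖ := by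
        gcongr
        rw [norm_smul, Real.norm_of_nonneg (by positivity)]
        gcongr
    _ = _ := by push_cast; ring

end Retract

/-- Since the field is bounded by `M` on the whole space, the Picard-Lindelöf ball can be given
radius `M T`, and the solution exists on all of `[0, T]` at once. -/
theorem exists_solution_of_bddLipOn {E : Type*} [NormedAddCommGroup E] [NormedSpace ℝ E]
    [CompleteSpace E] {T : ℝ} (hT : 0 ≤ T) {f : ℝ × E → E}
    (hf : BddLipOn f (Icc 0 T ×ˢ univ)) (x₀ : E) :
    ∃ α : ℝ → E, α 0 = x₀ ∧ ∀ t ∈ Icc 0 T, HasDerivWithinAt α (f (t, α t)) (Icc 0 T) t := by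
  obtain ⟨⟨K, hK⟩, ⟨M, hM⟩⟩ := hf
  have hpl : IsPicardLindelof (fun t x => f (t, x)) (⟨0, left_mem_Icc.2 hT⟩ : Icc 0 T) x₀
      (|M|.toNNReal * T.toNNReal) 0 |M|.toNNReal K := by
    refine ⟨fun t ht x _ y _ => ?_, fun x _ t ht => ?_, fun t ht x _ => ?_, ?_⟩
    · refine (hK (show (t, x) ∈ _ from ⟨ht, mem_univ _⟩)
        (show (t, y) ∈ _ from ⟨ht, mem_univ _⟩)).trans ?_
      simp [Prod.edist_eq]
    · refine (hK.continuousOn.comp (f := fun t => (t, x)) (by fun_prop)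
        fun t ht => ⟨ht, mem_univ _⟩) t ht
    · rw [Real.coe_toNNReal _ (abs_nonneg _)]
      exact (hM _ ⟨ht, mem_univ _⟩).trans (le_abs_self M)
    · simp [hT]
  obtain ⟨α, h0, hα⟩ := hpl.exists_eq_forall_mem_Icc_hasDerivWithinAt₀
  exact ⟨α, h0, hα⟩

/-- Truncate the field by the radial retraction, solve, and remove the truncation by an a priori
bound: the retraction does not increase norms, so linear growth survives it and Gronwall's
inequality keeps `v` inside the ball. Growth is required of the first component only, because the
field is bounded in `s` as soon as `v` is bounded. -/
theorem exists_solution_of_linear_growth {V : Type*} [NormedAddCommGroup V] [NormedSpace ℝ V]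
    [CompleteSpace V] {T : ℝ} (hT : 0 ≤ T) {f : ℝ × V × ℝ → V × ℝ}
    (hf : ∀ R : ℝ, BddLipOn f (Icc 0 T ×ˢ Metric.closedBall 0 R ×ˢ univ))
    {c : ℝ} (hc : 0 ≤ c)
    (hg : ∀ t ∈ Icc 0 T, ∀ (v : V) (s : ℝ), ‖(f (t, v, s)).1‖ ≤ c * ‖v‖ + c) (v₀ : V) (s₀ : ℝ) :
    ∃ (v : ℝ → V) (s : ℝ → ℝ), v 0 = v₀ ∧ s 0 = s₀ ∧ ∀ t ∈ Icc 0 T,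
      HasDerivWithinAt v (f (t, v t, s t)).1 (Icc 0 T) t ∧
      HasDerivWithinAt s (f (t, v t, s t)).2 (Icc 0 T) t := by
  -- The Gronwall bound at the final time; the maximum with `1` provides the positive radius needed
  -- by the retraction.
  set R : ℝ := max 1 (gronwallBound ‖v₀‖ c c T) with hRdef
  have hR : 0 < R := lt_max_of_lt_left one_pos
  have hfR : BddLipOn (fun x : ℝ × V × ℝ => f (x.1, radialRetract R x.2.1, x.2.2))
      (Icc 0 T ×ˢ univ) := by
    have hl : LipschitzWith (max 1 (max (2 * (1 * 1)) (1 * 1)))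
        (fun x : ℝ × V × ℝ => (x.1, radialRetract R x.2.1, x.2.2)) :=
      LipschitzWith.prod_fst.prodMk
        (((lipschitzWith_radialRetract hR).comp
          (LipschitzWith.prod_fst.comp LipschitzWith.prod_snd)).prodMk
          (LipschitzWith.prod_snd.comp LipschitzWith.prod_snd))
    refine (hf R).comp_lip hl.lipschitzOnWith fun x hx => ⟨hx.1, ?_, mem_univ _⟩
    exact mem_closedBall_zero_iff.2 (norm_radialRetract_le hR _)
  obtain ⟨α, h0, hα⟩ := exists_solution_of_bddLipOn hT hfR (v₀, s₀)
  have hv : ∀ t ∈ Icc 0 T, HasDerivWithinAt (fun t => (α t).1)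
      (f (t, radialRetract R (α t).1, (α t).2)).1 (Icc 0 T) t := fun t ht => by
    have := (ContinuousLinearMap.fst ℝ V ℝ).hasFDerivAt.comp_hasDerivWithinAt t (hα t ht)
    exact this
  have hs : ∀ t ∈ Icc 0 T, HasDerivWithinAt (fun t => (α t).2)
      (f (t, radialRetract R (α t).1, (α t).2)).2 (Icc 0 T) t := fun t ht => by
    have := (ContinuousLinearMap.snd ℝ V ℝ).hasFDerivAt.comp_hasDerivWithinAt t (hα t ht)
    exact this
  have hb : ∀ t ∈ Icc 0 T, ‖(α t).1‖ ≤ gronwallBound ‖v₀‖ c c (t - 0) := by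
    refine norm_le_gronwallBound_of_norm_deriv_right_le (fun t ht => (hv t ht).continuousWithinAt)
      (fun t ht => (hv t (Ico_subset_Icc_self ht)).mono_of_mem_nhdsWithin
        (Icc_mem_nhdsGE_of_mem ht)) (by simp [h0]) fun t ht => ?_
    refine (hg t (Ico_subset_Icc_self ht) _ _).trans ?_
    gcongr
    exact norm_radialRetract_le_norm hR _
  have hb' : ∀ t ∈ Icc 0 T, radialRetract R (α t).1 = (α t).1 := fun t ht => by
    refine radialRetract_of_le hR ((hb t ht).trans (le_max_of_le_right ?_))
    exact gronwallBound_mono (norm_nonneg _) hc hc (by simpa using ht.2)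
  refine ⟨fun t => (α t).1, fun t => (α t).2, by simp [h0], by simp [h0], fun t ht => ?_⟩
  have h1 := hv t ht
  have h2 := hs t ht
  rw [hb' t ht] at h1 h2
  exact ⟨h1, h2⟩

/-! ### Lipschitz almost everywhere differentiable paths -/

/-- `f` is Lipschitz on `[0, T]` and differentiable at almost every point of `[0, T]`. -/
structure LipDiff {X : Type*} [NormedAddCommGroup X] [NormedSpace ℝ X] (T : ℝ) (f : ℝ → X) :
    Prop where
  lip : ∃ K, LipschitzOnWith K f (Icc 0 T)
  diff : ∀ᵐ t ∂(volume.restrict (Icc 0 T)), DifferentiableAt ℝ f t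

section LipDiff

variable {X Y : Type*} [NormedAddCommGroup X] [NormedSpace ℝ X] [NormedAddCommGroup Y]
  [NormedSpace ℝ Y] {T : ℝ}

theorem LipDiff.bddLipOn {f : ℝ → X} (hf : LipDiff T f) : BddLipOn f (Icc 0 T) := by
  obtain ⟨K, hK⟩ := hf.lip
  exact .of_lipschitzOnWith hK isCompact_Icc

theorem LipDiff.clm {f : ℝ → X} (hf : LipDiff T f) (L : X →L[ℝ] Y) :
    LipDiff T fun t => L (f t) :=
  ⟨(hf.bddLipOn.clm L).lip, hf.diff.mono fun _ h => L.differentiableAt.comp _ h⟩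

theorem ae_restrict_mem_Ioo (T : ℝ) : ∀ᵐ t ∂(volume.restrict (Icc 0 T)), t ∈ Ioo 0 T := by
  rw [← restrict_Ioo_eq_restrict_Icc]
  exact ae_restrict_mem measurableSet_Ioo

/-- For values in a Banach space, Lipschitz continuity alone would not give differentiability almost
everywhere; here it comes from the Lebesgue differentiation theorem for the primitive. The essential
bound of the density is the Lipschitz constant. -/
theorem IsW1Infty.lipDiff [CompleteSpace X] {f : ℝ → X} (hf : IsW1Infty T f) : LipDiff T f := by
  obtain ⟨f', hf', h⟩ := hf
  rcases lt_or_ge T 0 with hT | hT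
  · rw [← not_le] at hT
    exact ⟨⟨0, by simp [Icc_eq_empty hT]⟩, by simp [Icc_eq_empty hT]⟩
  have hi : IntervalIntegrable f' volume 0 T := by
    rw [intervalIntegrable_iff_integrableOn_Icc_of_le hT]
    exact hf'.integrable le_top
  have hsub : ∀ s ∈ Icc 0 T, ∀ t ∈ Icc 0 T, IntervalIntegrable f' volume s t :=
    fun s hs t ht => hi.mono_set (by rw [uIcc_of_le hT]; exact uIcc_subset_Icc hs ht)
  refine ⟨⟨(eLpNorm f' ⊤ (volume.restrict (Icc 0 T))).toNNReal,
    LipschitzOnWith.of_dist_le_mul fun t ht s hs => ?_⟩, ?_⟩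
  · have hb := ae_le_eLpNormEssSup (f := f') (μ := volume.restrict (Icc 0 T))
    have h0 : (0 : ℝ) ∈ Icc 0 T := left_mem_Icc.2 hT
    rw [dist_eq_norm, h t ht, h s hs, add_sub_add_left_eq_sub,
      intervalIntegral.integral_interval_sub_left (hsub 0 h0 t ht) (hsub 0 h0 s hs), dist_eq_norm,
      Real.norm_eq_abs]
    refine intervalIntegral.norm_integral_le_of_norm_le_const_ae ?_
    rw [ae_restrict_iff' measurableSet_Icc] at hb
    filter_upwards [hb] with x hx hxm
    have hx := hx (uIcc_subset_Icc hs ht (uIoc_subset_uIcc hxm))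
    rw [← eLpNorm_exponent_top] at hx
    have := ENNReal.toNNReal_mono hf'.2.ne hx
    exact_mod_cast this
  · have hd := hi.ae_hasDerivAt_integral
    have hd' := ae_restrict_of_ae (s := Icc 0 T) hd
    filter_upwards [hd', ae_restrict_mem_Ioo T] with t ht htm
    have h1 := ht (by rw [uIcc_of_le hT]; exact Ioo_subset_Icc_self htm) 0 (by simp)
    have h2 : HasDerivAt (fun t => f 0 + ∫ τ in (0 : ℝ)..t, f' τ) (f' t) t := h1.const_add _
    refine (h2.congr_of_eventuallyEq ?_).differentiableAt
    filter_upwards [Icc_mem_nhds htm.1 htm.2] with r hr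
    exact h r hr

end LipDiff

/-! ### Quadratic energies on a Hilbert space -/

/-- The data of an energy `b σ (ι v + p t) (ι v + p t) + σ - ℓ t v - m t` on `V × [σ₀, σbar]`. -/
structure EnergyData (V X : Type*) [NormedAddCommGroup V] [InnerProductSpace ℝ V]
    [NormedAddCommGroup X] [NormedSpace ℝ X] where
  /-- final time -/
  T : ℝ
  T_pos : 0 < T
  /-- lower bound of the scalar variable -/
  σ₀ : ℝ
  /-- upper bound of the scalar variable -/
  σbar : ℝ
  σ_lt : σ₀ < σbar
  /-- the linear part of the argument of the quadratic form -/
  ι : V →L[ℝ] X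
  /-- the quadratic form -/
  b : ℝ → X →L[ℝ] X →L[ℝ] ℝ
  b_C2 : ContDiffOn ℝ 2 b (Icc σ₀ σbar)
  /-- the translation in the argument of the quadratic form -/
  p : ℝ → X
  p_reg : LipDiff T p
  /-- the linear term -/
  ℓ : ℝ → V →L[ℝ] ℝ
  ℓ_reg : LipDiff T ℓ
  /-- the constant term -/
  m : ℝ → ℝ
  m_reg : LipDiff T m

namespace EnergyData

variable {V X : Type*} [NormedAddCommGroup V] [InnerProductSpace ℝ V]
    [NormedAddCommGroup X] [NormedSpace ℝ X] (D : EnergyData V X)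

/-- The energy. -/
def energy (t : ℝ) (v : V) (σ : ℝ) : ℝ :=
  D.b σ (D.ι v + D.p t) (D.ι v + D.p t) + σ - D.ℓ t v - D.m t

/-- The projection onto `[σ₀, σbar]`. -/
def clamp (σ : ℝ) : ℝ := projIcc D.σ₀ D.σbar D.σ_lt.le σ

theorem clamp_mem (σ : ℝ) : D.clamp σ ∈ Icc D.σ₀ D.σbar := (projIcc _ _ D.σ_lt.le σ).2

theorem clamp_of_mem {σ : ℝ} (h : σ ∈ Icc D.σ₀ D.σbar) : D.clamp σ = σ := by
  rw [clamp, projIcc_of_mem _ h]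

theorem lipschitzWith_clamp : LipschitzWith 1 D.clamp :=
  (LipschitzWith.subtype_val _).comp (LipschitzWith.projIcc D.σ_lt.le) |>.weaken (by simp)

/-- The argument of the quadratic form. -/
def arg (x : ℝ × V × ℝ) : X := D.ι x.2.1 + D.p x.1

/-- The differential of the energy with respect to `v`. -/
def gradForm (x : ℝ × V × ℝ) : V →L[ℝ] ℝ :=
  (D.b (D.clamp x.2.2) (D.arg x)).comp D.ι + ((D.b (D.clamp x.2.2)).flip (D.arg x)).comp D.ι -
    D.ℓ x.1

/-- The derivative of the energy with respect to `σ`. -/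
def dσ (x : ℝ × V × ℝ) : ℝ :=
  derivWithin D.b (Icc D.σ₀ D.σbar) (D.clamp x.2.2) (D.arg x) (D.arg x) + 1

theorem bddLipOn_b : BddLipOn D.b (Icc D.σ₀ D.σbar) := by
  obtain ⟨K, hK⟩ := (D.b_C2.of_le (by norm_num : (1 : WithTop ℕ∞) ≤ 2)).exists_lipschitzOnWith
    (by decide) (convex_Icc _ _) isCompact_Icc
  exact .of_lipschitzOnWith hK isCompact_Icc

/-- This is where `C²` regularity in `σ` is used: the derivative of `b` is of class `C¹`, hence
Lipschitz on the compact interval. -/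
theorem bddLipOn_deriv_b :
    BddLipOn (derivWithin D.b (Icc D.σ₀ D.σbar)) (Icc D.σ₀ D.σbar) := by
  have h : ContDiffOn ℝ 1 (derivWithin D.b (Icc D.σ₀ D.σbar)) (Icc D.σ₀ D.σbar) :=
    D.b_C2.derivWithin (uniqueDiffOn_Icc D.σ_lt) (by norm_num)
  obtain ⟨K, hK⟩ := h.exists_lipschitzOnWith (by decide) (convex_Icc _ _) isCompact_Icc
  exact .of_lipschitzOnWith hK isCompact_Icc

theorem bddLipOn_clamp {E : Type*} [SeminormedAddCommGroup E] {f : ℝ → E}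
    (h : BddLipOn f (Icc D.σ₀ D.σbar)) (s : Set (ℝ × V × ℝ)) :
    BddLipOn (fun x : ℝ × V × ℝ => f (D.clamp x.2.2)) s :=
  h.comp_lip (D.lipschitzWith_clamp.comp
    (LipschitzWith.prod_snd.comp LipschitzWith.prod_snd)).lipschitzOnWith
    fun x _ => D.clamp_mem x.2.2

/-- The set on which the time derivatives are estimated. -/
def dom (R : ℝ) : Set (ℝ × V × ℝ) := Icc 0 D.T ×ˢ Metric.closedBall 0 R ×ˢ univ

theorem bddLipOn_time {E : Type*} [NormedAddCommGroup E] [NormedSpace ℝ E] {f : ℝ → E}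
    (h : LipDiff D.T f) (R : ℝ) : BddLipOn (fun x : ℝ × V × ℝ => f x.1) (D.dom R) :=
  h.bddLipOn.comp_lip LipschitzWith.prod_fst.lipschitzOnWith fun _ hx => hx.1

theorem bddLipOn_arg (R : ℝ) : BddLipOn D.arg (D.dom R) := by
  refine BddLipOn.add (BddLipOn.clm D.ι ⟨⟨_, (LipschitzWith.prod_fst.comp
    LipschitzWith.prod_snd).lipschitzOnWith⟩, ⟨R, fun x hx => ?_⟩⟩) (D.bddLipOn_time D.p_reg R)
  exact mem_closedBall_zero_iff.1 hx.2.1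

theorem bddLipOn_gradForm (R : ℝ) : BddLipOn D.gradForm (D.dom R) := by
  have hb := D.bddLipOn_clamp D.bddLipOn_b (D.dom R)
  have hb' : BddLipOn (fun x : ℝ × V × ℝ => (D.b (D.clamp x.2.2)).flip) (D.dom R) :=
    BddLipOn.lip_comp (ContinuousLinearMap.flipₗᵢ ℝ X X ℝ).lipschitz hb
  have ha := D.bddLipOn_arg R
  exact (((hb.clm_apply ha).clm_comp (.const D.ι _)).add
    ((hb'.clm_apply ha).clm_comp (.const D.ι _))).sub (D.bddLipOn_time D.ℓ_reg R)

theorem bddLipOn_dσ (R : ℝ) : BddLipOn D.dσ (D.dom R) :=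
  (((D.bddLipOn_clamp D.bddLipOn_deriv_b _).clm_apply (D.bddLipOn_arg R)).clm_apply
    (D.bddLipOn_arg R)).add (.const 1 _)

/-- The energy is quadratic in `v`, and `b`, `p`, `ℓ` are bounded on their compact intervals. This
linear growth yields global existence. -/
theorem exists_norm_gradForm_le : ∃ c : ℝ, 0 ≤ c ∧ ∀ t ∈ Icc 0 D.T, ∀ (v : V) (s : ℝ),
    ‖D.gradForm (t, v, s)‖ ≤ c * ‖v‖ + c := by
  obtain ⟨M, hM⟩ := D.bddLipOn_b.bdd
  obtain ⟨N, hN⟩ := D.p_reg.bddLipOn.bdd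
  obtain ⟨L, hL⟩ := D.ℓ_reg.bddLipOn.bdd
  have hM0 : 0 ≤ M := (norm_nonneg (D.b D.σ₀)).trans (hM _ (left_mem_Icc.2 D.σ_lt.le))
  have hN0 : 0 ≤ N := (norm_nonneg (D.p 0)).trans (hN _ (left_mem_Icc.2 D.T_pos.le))
  have hL0 : 0 ≤ L := (norm_nonneg (D.ℓ 0)).trans (hL _ (left_mem_Icc.2 D.T_pos.le))
  refine ⟨2 * M * ‖D.ι‖ * ‖D.ι‖ + 2 * M * N * ‖D.ι‖ + L, by positivity, fun t ht v s => ?_⟩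
  have ha : ‖D.arg (t, v, s)‖ ≤ ‖D.ι‖ * ‖v‖ + N :=
    (norm_add_le _ _).trans (add_le_add (D.ι.le_opNorm v) (hN t ht))
  have hb := hM _ (D.clamp_mem s)
  have h1 : ‖(D.b (D.clamp s) (D.arg (t, v, s))).comp D.ι‖ ≤
      M * (‖D.ι‖ * ‖v‖ + N) * ‖D.ι‖ := by
    refine (ContinuousLinearMap.opNorm_comp_le _ _).trans ?_
    gcongr
    refine (ContinuousLinearMap.le_opNorm _ _).trans ?_
    gcongr
  have h2 : ‖((D.b (D.clamp s)).flip (D.arg (t, v, s))).comp D.ι‖ ≤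
      M * (‖D.ι‖ * ‖v‖ + N) * ‖D.ι‖ := by
    refine (ContinuousLinearMap.opNorm_comp_le _ _).trans ?_
    gcongr
    refine (ContinuousLinearMap.le_opNorm _ _).trans ?_
    rw [ContinuousLinearMap.opNorm_flip]
    gcongr
  have h3 : ‖D.gradForm (t, v, s)‖ ≤ M * (‖D.ι‖ * ‖v‖ + N) * ‖D.ι‖ +
      M * (‖D.ι‖ * ‖v‖ + N) * ‖D.ι‖ + L :=
    (norm_sub_le _ _).trans (add_le_add ((norm_add_le _ _).trans (add_le_add h1 h2)) (hL t ht))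
  refine h3.trans ?_
  have : 0 ≤ (2 * M * N * ‖D.ι‖ + L) * ‖v‖ := by positivity
  have : 0 ≤ 2 * M * ‖D.ι‖ * ‖D.ι‖ := by positivity
  nlinarith

theorem hasFDerivAt_energy (t : ℝ) (v : V) {σ : ℝ} (hσ : σ ∈ Icc D.σ₀ D.σbar) :
    HasFDerivAt (fun w => D.energy t w σ) (D.gradForm (t, v, σ)) v := by
  have h1 : HasFDerivAt (fun w => D.ι w + D.p t) D.ι v := D.ι.hasFDerivAt.add_const _
  have h2 := (((D.b σ).hasFDerivAt.comp v h1).clm_apply h1)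
  have h3 := ((h2.add_const σ).sub (D.ℓ t).hasFDerivAt).sub_const (D.m t)
  refine h3.congr_fderiv ?_
  ext w
  simp [gradForm, D.clamp_of_mem hσ, arg]

theorem hasDerivWithinAt_energy (t : ℝ) (v : V) {σ : ℝ} (hσ : σ ∈ Icc D.σ₀ D.σbar) :
    HasDerivWithinAt (fun s => D.energy t v s) (D.dσ (t, v, σ)) (Icc D.σ₀ D.σbar) σ := by
  have h1 : HasDerivWithinAt D.b (derivWithin D.b (Icc D.σ₀ D.σbar) σ) (Icc D.σ₀ D.σbar) σ :=
    ((D.b_C2.differentiableOn (by norm_num)) σ hσ).hasDerivWithinAt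
  have hc : ∀ y : X, HasDerivWithinAt (fun _ : ℝ => y) 0 (Icc D.σ₀ D.σbar) σ :=
    fun y => hasDerivWithinAt_const _ _ _
  have h2 := (h1.clm_apply (hc (D.ι v + D.p t))).clm_apply (hc (D.ι v + D.p t))
  have h3 := ((h2.add (hasDerivWithinAt_id σ _)).sub_const (D.ℓ t v)).sub_const (D.m t)
  refine h3.congr_deriv ?_
  simp [dσ, D.clamp_of_mem hσ, arg]

theorem hasDerivAt_energy_time {t : ℝ} {p' : X} {ℓ' : V →L[ℝ] ℝ} {m' : ℝ}
    (hp : HasDerivAt D.p p' t) (hl : HasDerivAt D.ℓ ℓ' t) (hm : HasDerivAt D.m m' t) (v : V)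
    (σ : ℝ) : HasDerivAt (fun r => D.energy r v σ)
      (D.b σ p' (D.ι v + D.p t) + D.b σ (D.ι v + D.p t) p' - ℓ' v - m') t := by
  have h1 : HasDerivAt (fun r => D.ι v + D.p r) p' t := hp.const_add _
  have h2 : HasDerivAt (fun r => D.b σ (D.ι v + D.p r)) (D.b σ p') t :=
    (D.b σ).hasFDerivAt.comp_hasDerivAt t h1
  have h3 := (((h2.clm_apply h1).add_const σ).sub (hl.clm_apply (hasDerivAt_const t v))).sub hm
  refine h3.congr_deriv ?_
  simp

/-- Chain rule along a path. -/
theorem hasDerivAt_energy_path {t : ℝ} (ht : t ∈ Ioo 0 D.T) {v : ℝ → V} {s : ℝ → ℝ} {v' : V}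
    {s' : ℝ} (hv : HasDerivAt v v' t) (hs : HasDerivAt s s' t)
    (hsm : MapsTo s (Icc 0 D.T) (Icc D.σ₀ D.σbar)) (hp : DifferentiableAt ℝ D.p t)
    (hl : DifferentiableAt ℝ D.ℓ t) (hm : DifferentiableAt ℝ D.m t) :
    HasDerivAt (fun r => D.energy r (v r) (s r))
      (deriv (fun r => D.energy r (v t) (s t)) t + D.gradForm (t, v t, s t) v' +
        s' * D.dσ (t, v t, s t)) t := by
  have hst := hsm (Ioo_subset_Icc_self ht)
  have h1 : HasDerivAt (fun r => D.ι (v r) + D.p r) (D.ι v' + deriv D.p t) t :=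
    (D.ι.hasFDerivAt.comp_hasDerivAt t hv).add hp.hasDerivAt
  have hb : HasDerivWithinAt D.b (derivWithin D.b (Icc D.σ₀ D.σbar) (s t)) (Icc D.σ₀ D.σbar)
      (s t) := ((D.b_C2.differentiableOn (by norm_num)) _ hst).hasDerivWithinAt
  have h2 : HasDerivAt (fun r => D.b (s r))
      (s' • derivWithin D.b (Icc D.σ₀ D.σbar) (s t)) t := by
    -- `b` is differentiable only within `[σ₀, σbar]`. Since the path stays there for all times in
    -- `[0, T]`, the composition is differentiable within `[0, T]`, hence fully at the interior time
    -- `t`.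
    have h := HasDerivWithinAt.scomp (F := X →L[ℝ] X →L[ℝ] ℝ) (h := s) (s := Icc 0 D.T) t hb hs.hasDerivWithinAt hsm
    exact h.hasDerivAt (Icc_mem_nhds ht.1 ht.2)
  have h3 := ((((h2.clm_apply h1).clm_apply h1).add hs).sub
    (hl.hasDerivAt.clm_apply hv)).sub hm.hasDerivAt
  refine h3.congr_deriv ?_
  rw [(D.hasDerivAt_energy_time hp.hasDerivAt hl.hasDerivAt hm.hasDerivAt (v t) (s t)).deriv]
  simp only [dσ, gradForm, D.clamp_of_mem hst, arg, _root_.smul_apply,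
    _root_.add_apply, _root_.sub_apply, map_add,
    ContinuousLinearMap.comp_apply, ContinuousLinearMap.flip_apply, smul_eq_mul]
  ring

end EnergyData

namespace EnergyData

variable {V X : Type*} [NormedAddCommGroup V] [InnerProductSpace ℝ V]
    [NormedAddCommGroup X] [NormedSpace ℝ X] (D : EnergyData V X)

/-! ### The modified gradient flow -/

section Flow

variable [CompleteSpace V]

/-- The gradient of the energy with respect to `v`. -/
def grad (x : ℝ × V × ℝ) : V := (InnerProductSpace.toDual ℝ V).symm (D.gradForm x)

theorem inner_grad (x : ℝ × V × ℝ) (w : V) : inner ℝ (D.grad x) w = D.gradForm x w :=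
  InnerProductSpace.toDual_symm_apply

theorem innerSL_grad (x : ℝ × V × ℝ) : innerSL ℝ (D.grad x) = D.gradForm x := by
  ext w
  exact D.inner_grad x w

/-- The vector field of the flow with relaxation parameter `ε` and cut-off factor `lam`. -/
def field (ε : ℝ) (lam : ℝ → ℝ) (x : ℝ × V × ℝ) : V × ℝ :=
  (-(ε⁻¹ • D.grad x), ε⁻¹ * max (-D.dσ x) 0 * lam x.2.2)

theorem bddLipOn_field (ε : ℝ) {lam : ℝ → ℝ} {K : ℝ≥0} (hlam : LipschitzWith K lam)
    (h1 : ∀ σ, |lam σ| ≤ 1) (R : ℝ) : BddLipOn (D.field ε lam) (D.dom R) := by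
  have hg : BddLipOn D.grad (D.dom R) :=
    BddLipOn.lip_comp (g := (InnerProductSpace.toDual ℝ V).symm)
      (InnerProductSpace.toDual ℝ V).symm.lipschitz (D.bddLipOn_gradForm R)
  have hl : BddLipOn (fun x : ℝ × V × ℝ => lam x.2.2) (D.dom R) :=
    ⟨⟨_, (hlam.comp (LipschitzWith.prod_snd.comp LipschitzWith.prod_snd)).lipschitzOnWith⟩,
      ⟨1, fun x _ => h1 x.2.2⟩⟩
  have hm : BddLipOn (fun x => max (-D.dσ x) 0) (D.dom R) :=
    BddLipOn.lip_comp (LipschitzWith.id.max_const 0) (D.bddLipOn_dσ R).neg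
  refine BddLipOn.prodMk ?_ ?_
  · exact (hg.clm (ε⁻¹ • ContinuousLinearMap.id ℝ V)).neg
  · exact ((BddLipOn.const (ε⁻¹) _).bilin (ContinuousLinearMap.mul ℝ ℝ) hm).bilin
      (ContinuousLinearMap.mul ℝ ℝ) hl

/-- `(v, σ)` is a solution of the flow. -/
structure IsSol (ε : ℝ) (lam : ℝ → ℝ) (v : ℝ → V) (s : ℝ → ℝ) : Prop where
  deriv_v : ∀ t ∈ Icc 0 D.T,
    HasDerivWithinAt v (D.field ε lam (t, v t, s t)).1 (Icc 0 D.T) t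
  deriv_s : ∀ t ∈ Icc 0 D.T,
    HasDerivWithinAt s (D.field ε lam (t, v t, s t)).2 (Icc 0 D.T) t

theorem exists_isSol {ε : ℝ} (hε : 0 < ε) {lam : ℝ → ℝ} {K : ℝ≥0} (hlam : LipschitzWith K lam)
    (h1 : ∀ σ, |lam σ| ≤ 1) (u₀ : V) :
    ∃ v s, D.IsSol ε lam v s ∧ v 0 = u₀ ∧ s 0 = D.σ₀ := by
  obtain ⟨c, hc, hg⟩ := D.exists_norm_gradForm_le
  have hb : ∀ t ∈ Icc 0 D.T, ∀ (v : V) (s : ℝ),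
      ‖(D.field ε lam (t, v, s)).1‖ ≤ ε⁻¹ * c * ‖v‖ + ε⁻¹ * c := fun t ht v s => by
    have h2 : ‖D.grad (t, v, s)‖ = ‖D.gradForm (t, v, s)‖ :=
      (InnerProductSpace.toDual ℝ V).symm.norm_map _
    rw [field, norm_neg, norm_smul, h2, Real.norm_of_nonneg (by positivity)]
    calc _ ≤ ε⁻¹ * (c * ‖v‖ + c) := by gcongr; exact hg t ht v s
      _ = _ := by ring
  obtain ⟨v, s, h0, h0', h⟩ := exists_solution_of_linear_growth D.T_pos.le
    (D.bddLipOn_field ε hlam h1) (by positivity) hb u₀ D.σ₀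
  exact ⟨v, s, ⟨fun t ht => (h t ht).1, fun t ht => (h t ht).2⟩, h0, h0'⟩

namespace IsSol

variable {D} {ε : ℝ} {lam : ℝ → ℝ} {v : ℝ → V} {s : ℝ → ℝ}

theorem continuousOn_v (h : D.IsSol ε lam v s) : ContinuousOn v (Icc 0 D.T) :=
  fun t ht => (h.deriv_v t ht).continuousWithinAt

theorem continuousOn_s (h : D.IsSol ε lam v s) : ContinuousOn s (Icc 0 D.T) :=
  fun t ht => (h.deriv_s t ht).continuousWithinAt

theorem exists_mapsTo_dom (h : D.IsSol ε lam v s) :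
    ∃ R, MapsTo (fun t => (t, v t, s t)) (Icc 0 D.T) (D.dom R) := by
  obtain ⟨R, hR⟩ := isCompact_Icc.exists_bound_of_continuousOn h.continuousOn_v
  exact ⟨R, fun t ht => ⟨ht, mem_closedBall_zero_iff.2 (hR t ht), mem_univ _⟩⟩

theorem continuousOn_comp (h : D.IsSol ε lam v s) {E : Type*} [SeminormedAddCommGroup E]
    {f : ℝ × V × ℝ → E} (hf : ∀ R, BddLipOn f (D.dom R)) :
    ContinuousOn (fun t => f (t, v t, s t)) (Icc 0 D.T) := by
  obtain ⟨R, hR⟩ := h.exists_mapsTo_dom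
  obtain ⟨K, hK⟩ := (hf R).lip
  exact hK.continuousOn.comp (continuousOn_id.prodMk (h.continuousOn_v.prodMk h.continuousOn_s)) hR

theorem monotoneOn (h : D.IsSol ε lam v s) (hε : 0 < ε) (h0 : ∀ σ, 0 ≤ lam σ) :
    MonotoneOn s (Icc 0 D.T) := by
  have hd : ∀ t ∈ Ioo 0 D.T, HasDerivAt s (D.field ε lam (t, v t, s t)).2 t := fun t ht =>
    (h.deriv_s t (Ioo_subset_Icc_self ht)).hasDerivAt (Icc_mem_nhds ht.1 ht.2)
  refine monotoneOn_of_deriv_nonneg (convex_Icc _ _) h.continuousOn_s ?_ ?_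
  · rw [interior_Icc]
    exact fun t ht => (hd t ht).differentiableAt.differentiableWithinAt
  · rw [interior_Icc]
    intro t ht
    rw [(hd t ht).deriv, field]
    have := h0 (s t)
    positivity

/-- With `v` and `∂_σ` of the energy frozen along the solution, `s` solves a scalar equation `x' =
h(t) lam x`, Lipschitz in `x`, of which the constant `σbar` is also a solution. If `s` reached
`σbar`, uniqueness backwards in time would force `s 0 = σbar`. -/
theorem lt_σbar (h : D.IsSol ε lam v s) (hs : s 0 = D.σ₀) {K : ℝ≥0}
    (hlam : LipschitzWith K lam) (hz : lam D.σbar = 0) {t : ℝ} (ht : t ∈ Icc 0 D.T) :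
    s t < D.σbar := by
  by_contra! hge
  have h0 : (0 : ℝ) ∈ Icc 0 D.T := left_mem_Icc.2 D.T_pos.le
  obtain ⟨t₁, ht₁, he⟩ : D.σbar ∈ s '' Icc 0 t :=
    intermediate_value_Icc ht.1 (h.continuousOn_s.mono (Icc_subset_Icc_right ht.2))
      ⟨hs ▸ D.σ_lt.le, hge⟩
  have hsub : Icc 0 t₁ ⊆ Icc 0 D.T := Icc_subset_Icc_right (ht₁.2.trans ht.2)
  have hmax : ContinuousOn (fun t => ε⁻¹ * max (-D.dσ (t, v t, s t)) 0) (Icc 0 D.T) :=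
    continuousOn_const.mul ((h.continuousOn_comp D.bddLipOn_dσ).neg.sup continuousOn_const)
  obtain ⟨H, hH⟩ := isCompact_Icc.exists_bound_of_continuousOn hmax
  have hu := ODE_solution_unique_of_mem_Icc_left (a := 0) (b := t₁) (f := s)
    (g := fun _ => D.σbar) (K := H.toNNReal * K) (s := fun _ => univ)
    (v := fun t x => ε⁻¹ * max (-D.dσ (t, v t, s t)) 0 * lam x)
    (fun r hr => LipschitzOnWith.of_dist_le_mul fun x _ y _ => ?_)
    (h.continuousOn_s.mono hsub) (fun r hr => ?_) (fun _ _ => mem_univ _)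
    continuousOn_const (fun r hr => ?_) (fun _ _ => mem_univ _) he
  · have := hu (left_mem_Icc.2 ht₁.1)
    simp only [hs] at this
    exact D.σ_lt.ne this
  · have hr' := hsub (Ioc_subset_Icc_self hr)
    have hH0 : 0 ≤ H := (norm_nonneg _).trans (hH r hr')
    rw [Real.dist_eq, ← mul_sub, abs_mul, NNReal.coe_mul, Real.coe_toNNReal _ hH0, mul_assoc]
    gcongr
    · exact hH r hr'
    · exact hlam.dist_le_mul x y
  · have hr' := hsub (Ioc_subset_Icc_self hr)
    exact (h.deriv_s r hr').mono_of_mem_nhdsWithin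
      (Icc_mem_nhdsLE_of_mem ⟨hr.1, hr'.2⟩)
  · rw [hz, mul_zero]
    exact hasDerivWithinAt_const _ _ _

theorem mem_Icc (h : D.IsSol ε lam v s) (hε : 0 < ε) (h0 : ∀ σ, 0 ≤ lam σ) (hs : s 0 = D.σ₀)
    {K : ℝ≥0} (hlam : LipschitzWith K lam) (hz : lam D.σbar = 0) :
    MapsTo s (Icc 0 D.T) (Icc D.σ₀ D.σbar) := fun _ ht =>
  ⟨hs ▸ h.monotoneOn hε h0 (left_mem_Icc.2 D.T_pos.le) ht ht.1, (h.lt_σbar hs hlam hz ht).le⟩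

/-- The velocities are continuous, hence bounded, on `[0, T]`. Lipschitz continuity lets the energy
be recovered from a derivative that is known only almost everywhere. -/
theorem lipschitzOnWith_energy (h : D.IsSol ε lam v s) {K : ℝ≥0} (hlam : LipschitzWith K lam)
    (h1 : ∀ σ, |lam σ| ≤ 1) (hm : MapsTo s (Icc 0 D.T) (Icc D.σ₀ D.σbar)) :
    ∃ C, LipschitzOnWith C (fun t => D.energy t (v t) (s t)) (Icc 0 D.T) := by
  obtain ⟨M, hM⟩ := isCompact_Icc.exists_bound_of_continuousOn
    (h.continuousOn_comp (D.bddLipOn_field ε hlam h1))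
  have hv : BddLipOn v (Icc 0 D.T) := by
    refine .of_lipschitzOnWith (K := M.toNNReal) ?_ isCompact_Icc
    refine (convex_Icc _ _).lipschitzOnWith_of_nnnorm_hasDerivWithin_le h.deriv_v fun t ht => ?_
    exact NNReal.le_toNNReal_of_coe_le ((le_max_left _ _).trans (hM t ht))
  have hs : LipschitzOnWith M.toNNReal s (Icc 0 D.T) := by
    refine (convex_Icc _ _).lipschitzOnWith_of_nnnorm_hasDerivWithin_le h.deriv_s fun t ht => ?_
    exact NNReal.le_toNNReal_of_coe_le ((le_max_right _ _).trans (hM t ht))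
  have ha : BddLipOn (fun t => D.ι (v t) + D.p t) (Icc 0 D.T) :=
    (hv.clm D.ι).add D.p_reg.bddLipOn
  have hb : BddLipOn (fun t => D.b (s t)) (Icc 0 D.T) := D.bddLipOn_b.comp_lip hs hm
  exact ((((hb.clm_apply ha).clm_apply ha).add (.of_lipschitzOnWith hs isCompact_Icc)).sub
    (D.ℓ_reg.bddLipOn.clm_apply hv)).sub D.m_reg.bddLipOn |>.lip

/-- The dissipation identity. -/
theorem dissipation (hε : 0 < ε) (x : ℝ × V × ℝ) (h0 : 0 < lam x.2.2) :
    D.gradForm x (D.field ε lam x).1 + (D.field ε lam x).2 * D.dσ x =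
      -(ε * ‖(D.field ε lam x).1‖ ^ 2) - ε * ((D.field ε lam x).2 ^ 2 / lam x.2.2) := by
  have e1 : D.gradForm x (D.field ε lam x).1 = -(ε * ‖(D.field ε lam x).1‖ ^ 2) := by
    rw [← D.inner_grad, field, norm_neg, norm_smul, inner_neg_right, inner_smul_right,
      real_inner_self_eq_norm_sq, Real.norm_of_nonneg (by positivity)]
    field_simp
  have e2 : (D.field ε lam x).2 * D.dσ x = - (ε * ((D.field ε lam x).2 ^ 2 / lam x.2.2)) := by
    simp only [field]
    -- Either the positive part vanishes and both sides are zero, or `σ' = -ε⁻¹ dσ lam`, so that `dσ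
    -- = -ε σ' / lam`.
    rcases le_total (-D.dσ x) 0 with hd | hd
    · rw [max_eq_right hd]
      simp
    · rw [max_eq_left hd]
      field_simp
  rw [e1, e2, sub_eq_add_neg]

/-- At almost every time the chain rule and the dissipation identity express the partial time
derivative of the energy as its total derivative plus the two dissipation terms. The energy is
absolutely continuous along the solution, so integrating gives an exact balance. -/
theorem energy_balance (h : D.IsSol ε lam v s) (hε : 0 < ε) {K : ℝ≥0}
    (hlam : LipschitzWith K lam) (h1 : ∀ σ, |lam σ| ≤ 1)
    (hm : MapsTo s (Icc 0 D.T) (Icc D.σ₀ D.σbar)) (hp : ∀ t ∈ Icc 0 D.T, 0 < lam (s t)) :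
    IntervalIntegrable (fun t => ‖(D.field ε lam (t, v t, s t)).1‖ ^ 2) volume 0 D.T ∧
    IntervalIntegrable (fun t => (D.field ε lam (t, v t, s t)).2 ^ 2 / lam (s t)) volume 0 D.T ∧
    IntervalIntegrable (fun t => deriv (fun r => D.energy r (v t) (s t)) t) volume 0 D.T ∧
    ∀ a b : ℝ, 0 ≤ a → a < b → b ≤ D.T →
      ε * (∫ t in a..b, ‖(D.field ε lam (t, v t, s t)).1‖ ^ 2) +
        ε * (∫ t in a..b, (D.field ε lam (t, v t, s t)).2 ^ 2 / lam (s t)) +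
        D.energy b (v b) (s b) =
      D.energy a (v a) (s a) + ∫ t in a..b, deriv (fun r => D.energy r (v t) (s t)) t := by
  have hT := D.T_pos.le
  have hfc := h.continuousOn_comp (D.bddLipOn_field ε hlam h1)
  have i1 : IntervalIntegrable (fun t => ‖(D.field ε lam (t, v t, s t)).1‖ ^ 2) volume 0 D.T := by
    refine ContinuousOn.intervalIntegrable ?_
    rw [uIcc_of_le hT]
    exact (continuous_fst.comp_continuousOn hfc).norm.pow 2
  have i2 : IntervalIntegrable (fun t => (D.field ε lam (t, v t, s t)).2 ^ 2 / lam (s t))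
      volume 0 D.T := by
    refine ContinuousOn.intervalIntegrable ?_
    rw [uIcc_of_le hT]
    exact ((continuous_snd.comp_continuousOn hfc).pow 2).div
      (hlam.continuous.comp_continuousOn h.continuousOn_s) fun t ht => (hp t ht).ne'
  obtain ⟨C, hC⟩ := h.lipschitzOnWith_energy hlam h1 hm
  set e : ℝ → ℝ := fun t => D.energy t (v t) (s t) with he
  have hac : AbsolutelyContinuousOnInterval e 0 D.T :=
    LipschitzOnWith.absolutelyContinuousOnInterval (by rwa [uIcc_of_le hT])
  have hae : ∀ᵐ t ∂(volume.restrict (Icc 0 D.T)),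
      deriv (fun r => D.energy r (v t) (s t)) t = deriv e t +
        ε * ‖(D.field ε lam (t, v t, s t)).1‖ ^ 2 +
        ε * ((D.field ε lam (t, v t, s t)).2 ^ 2 / lam (s t)) := by
    filter_upwards [ae_restrict_mem_Ioo D.T, D.p_reg.diff, D.ℓ_reg.diff, D.m_reg.diff]
      with t ht d1 d2 d3
    have ht' := Ioo_subset_Icc_self ht
    have hn := Icc_mem_nhds ht.1 ht.2
    have hd := D.hasDerivAt_energy_path ht ((h.deriv_v t ht').hasDerivAt hn)
      ((h.deriv_s t ht').hasDerivAt hn) hm d1 d2 d3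
    rw [he, hd.deriv, add_assoc (deriv _ _), dissipation hε _ (hp t ht')]
    ring
  -- Integrability of the partial time derivative is read off from this expression, which agrees
  -- with it almost everywhere; its terms are the derivative of an absolutely continuous function
  -- and two integrable dissipation terms.
  have i3 : IntervalIntegrable (fun t => deriv e t +
        ε * ‖(D.field ε lam (t, v t, s t)).1‖ ^ 2 +
        ε * ((D.field ε lam (t, v t, s t)).2 ^ 2 / lam (s t))) volume 0 D.T :=
    (hac.intervalIntegrable_deriv.add (i1.const_mul ε)).add (i2.const_mul ε)
  refine ⟨i1, i2, ?_, fun a b ha hab hb => ?_⟩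
  · rw [intervalIntegrable_iff_integrableOn_Icc_of_le hT] at i3 ⊢
    exact i3.congr_fun_ae (hae.mono fun _ h => h.symm)
  have hsub : uIcc a b ⊆ uIcc 0 D.T := by
    rw [uIcc_of_le hab.le, uIcc_of_le hT]
    exact Icc_subset_Icc ha hb
  have hi : ∫ t in a..b, deriv (fun r => D.energy r (v t) (s t)) t =
      ∫ t in a..b, (deriv e t + ε * ‖(D.field ε lam (t, v t, s t)).1‖ ^ 2 +
        ε * ((D.field ε lam (t, v t, s t)).2 ^ 2 / lam (s t))) := by
    refine intervalIntegral.integral_congr_ae ?_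
    rw [ae_restrict_iff' measurableSet_Icc] at hae
    filter_upwards [hae] with t ht htm
    refine ht ?_
    have := hsub (uIoc_subset_uIcc htm)
    rwa [uIcc_of_le hT] at this
  have hac' := hac.mono hsub
  rw [hi, intervalIntegral.integral_add
      (hac'.intervalIntegrable_deriv.add ((i1.mono_set hsub).const_mul ε))
      ((i2.mono_set hsub).const_mul ε),
    intervalIntegral.integral_add hac'.intervalIntegrable_deriv ((i1.mono_set hsub).const_mul ε),
    hac'.integral_deriv_eq_sub, intervalIntegral.integral_const_mul,
    intervalIntegral.integral_const_mul]
  simp only [he]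
  ring

end IsSol

end Flow

end EnergyData

/-! ### Existence theorem for abstract quadratic energies -/

/-- The inner product of a real inner product space as a continuous bilinear map. -/
def innerCLM (Y : Type*) [NormedAddCommGroup Y] [InnerProductSpace ℝ Y] : Y →L[ℝ] Y →L[ℝ] ℝ :=
  (isBoundedBilinearMap_inner (𝕜 := ℝ) (E := Y)).toContinuousLinearMap

/-- Existence of the modified gradient flow for a quadratic energy on a complete inner product
space given by a definite seminorm. -/
theorem exists_flow {V X Y : Type*} [SeminormedAddCommGroup V] [InnerProductSpace ℝ V]
    [CompleteSpace V] [NormedAddCommGroup X] [NormedSpace ℝ X]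
    [NormedAddCommGroup Y] [InnerProductSpace ℝ Y] (hV : ∀ v : V, ‖v‖ = 0 → v = 0) {T σ₀ σbar : ℝ} (hT : 0 < T) (hσ : σ₀ < σbar)
    (ι : V →L[ℝ] X) {b : ℝ → X →L[ℝ] X →L[ℝ] ℝ} (hb : ContDiffOn ℝ 2 b (Icc σ₀ σbar))
    {p : ℝ → X} (hp : LipDiff T p) {g : ℝ → Y} (hg : LipDiff T g)
    (tr : V →L[ℝ] Y) {m : ℝ → ℝ} (hmr : LipDiff T m) {F : ℝ → V → ℝ → ℝ}
    (hF : ∀ t ∈ Icc 0 T, ∀ v, ∀ σ ∈ Icc σ₀ σbar,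
      F t v σ = b σ (ι v + p t) (ι v + p t) + σ - inner ℝ (g t) (tr v) - m t)
    {lam : ℝ → ℝ} {K : ℝ≥0} (hlam : LipschitzWith K lam) (h0 : ∀ σ, 0 ≤ lam σ)
    (h1 : ∀ σ, lam σ ≤ 1) (hz : lam σbar = 0) (hpos : ∀ σ < σbar, 0 < lam σ)
    {ε : ℝ} (hε : 0 < ε) (u₀ : V) :
    ∃ (v v' : ℝ → V) (σ σ' : ℝ → ℝ),
      ((∀ t ∈ Icc 0 T, HasDerivWithinAt v (v' t) (Icc 0 T) t) ∧ ContinuousOn v' (Icc 0 T) ∧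
        (∀ t ∈ Icc 0 T, HasDerivWithinAt σ (σ' t) (Icc 0 T) t) ∧ ContinuousOn σ' (Icc 0 T) ∧
        (∀ t ∈ Icc 0 T, σ t ∈ Icc σ₀ σbar) ∧ MonotoneOn σ (Icc 0 T) ∧
        (∀ t ∈ Icc 0 T, ∃ G : V, HasFDerivAt (fun w => F t w (σ t)) (innerSL ℝ G) (v t) ∧
          ∀ w : V, inner ℝ (ε • v' t) w = - inner ℝ G w) ∧
        (∀ t ∈ Icc 0 T, ∃ d : ℝ, HasDerivWithinAt (fun s => F t (v t) s) d (Icc σ₀ σbar) (σ t) ∧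
          ε * σ' t = max (-d) 0 * lam (σ t)) ∧ v 0 = u₀ ∧ σ 0 = σ₀) ∧
      (∀ t ∈ Icc 0 T, 0 < lam (σ t)) ∧
      IntervalIntegrable (fun τ => ‖v' τ‖ ^ 2) volume 0 T ∧
      IntervalIntegrable (fun τ => (σ' τ) ^ 2 / lam (σ τ)) volume 0 T ∧
      (∀ᵐ τ ∂(volume.restrict (Icc 0 T)), DifferentiableAt ℝ (fun r => F r (v τ) (σ τ)) τ) ∧
      IntervalIntegrable (fun τ => deriv (fun r => F r (v τ) (σ τ)) τ) volume 0 T ∧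
      ∀ s t : ℝ, 0 ≤ s → s < t → t ≤ T →
        ε * (∫ τ in s..t, ‖v' τ‖ ^ 2) + ε * (∫ τ in s..t, (σ' τ) ^ 2 / lam (σ τ))
            + F t (v t) (σ t)
          = F s (v s) (σ s) + ∫ τ in s..t, deriv (fun r => F r (v τ) (σ τ)) τ := by
  -- Definiteness upgrades the seminorm to a norm, so that the Riesz representation and the theory
  -- of differential equations apply.
  let _ : NormedAddCommGroup V := NormedAddCommGroup.ofSeparation hV
  have hl : LipDiff T fun t => (innerCLM Y (g t)).comp tr :=
    hg.clm (((ContinuousLinearMap.compL ℝ V Y ℝ).flip tr).comp (innerCLM Y))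
  let D : EnergyData V X := ⟨T, hT, σ₀, σbar, hσ, ι, b, hb, p, hp, _, hl, m, hmr⟩
  have habs : ∀ σ, |lam σ| ≤ 1 := fun σ => by rw [abs_of_nonneg (h0 σ)]; exact h1 σ
  obtain ⟨v, s, h, hv0, hs0⟩ := D.exists_isSol hε hlam habs u₀
  have hm := h.mem_Icc hε h0 hs0 hlam hz
  have hlt := fun t (ht : t ∈ Icc 0 T) => hpos (s t) (h.lt_σbar hs0 hlam hz ht)
  have hfc := h.continuousOn_comp (D.bddLipOn_field ε hlam habs)
  obtain ⟨i1, i2, i3, hbal⟩ := h.energy_balance hε hlam habs hm hlt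
  -- `F` has the quadratic form only for times in `[0, T]`, so time derivatives are compared at
  -- interior times, which are almost all.
  have hev : ∀ t ∈ Ioo 0 T, ∀ (w : V), ∀ r ∈ Icc σ₀ σbar,
      (fun τ => F τ w r) =ᶠ[𝓝 t] fun τ => D.energy τ w r := fun t ht w r hr => by
    filter_upwards [Icc_mem_nhds ht.1 ht.2] with τ hτ
    exact hF τ hτ w r hr
  have hdt : ∀ t ∈ Ioo 0 T, deriv (fun r => D.energy r (v t) (s t)) t =
      deriv (fun r => F r (v t) (s t)) t := fun t ht =>
    (hev t ht (v t) (s t) (hm (Ioo_subset_Icc_self ht))).deriv_eq.symm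
  refine ⟨v, fun t => (D.field ε lam (t, v t, s t)).1, s, fun t => (D.field ε lam (t, v t, s t)).2,
    ⟨h.deriv_v, continuous_fst.comp_continuousOn hfc, h.deriv_s,
      continuous_snd.comp_continuousOn hfc, hm, h.monotoneOn hε h0, fun t ht => ?_, fun t ht => ?_,
      hv0, hs0⟩, hlt, i1, i2, ?_, ?_, fun a c ha hac hc => ?_⟩
  · refine ⟨D.grad (t, v t, s t), ?_, fun w => ?_⟩
    · rw [D.innerSL_grad]
      refine (D.hasFDerivAt_energy t (v t) (hm ht)).congr_of_eventuallyEq ?_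
      exact Eventually.of_forall fun w => hF t ht w _ (hm ht)
    · simp only [EnergyData.field]
      rw [smul_neg, smul_inv_smul₀ hε.ne', inner_neg_left]
  · refine ⟨D.dσ (t, v t, s t), ?_, ?_⟩
    · exact (D.hasDerivWithinAt_energy t (v t) (hm ht)).congr
        (fun r hr => hF t ht _ r hr) (hF t ht _ _ (hm ht))
    · simp only [EnergyData.field]
      field_simp
  · filter_upwards [ae_restrict_mem_Ioo T, hp.diff, hl.diff, hmr.diff] with t ht d1 d2 d3
    exact (D.hasDerivAt_energy_time d1.hasDerivAt d2.hasDerivAt d3.hasDerivAt (v t)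
      (s t)).differentiableAt.congr_of_eventuallyEq
        (hev t ht (v t) (s t) (hm (Ioo_subset_Icc_self ht)))
  · rw [intervalIntegrable_iff_integrableOn_Icc_of_le hT.le] at i3 ⊢
    refine i3.congr_fun_ae ?_
    filter_upwards [ae_restrict_mem_Ioo T] with t ht
    exact hdt t ht
  · have hi : ∫ τ in a..c, deriv (fun r => F r (v τ) (s τ)) τ =
        ∫ τ in a..c, deriv (fun r => D.energy r (v τ) (s τ)) τ := by
      refine intervalIntegral.integral_congr_ae ?_
      have hae := ae_restrict_mem_Ioo T
      rw [ae_restrict_iff' measurableSet_Icc] at hae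
      filter_upwards [hae] with t ht htm
      rw [uIoc_of_le hac.le] at htm
      exact (hdt t (ht ⟨ha.trans htm.1.le, htm.2.trans hc⟩)).symm
    rw [hi, hF c ⟨ha.trans hac.le, hc⟩ _ _ (hm ⟨ha.trans hac.le, hc⟩),
      hF a ⟨ha, hac.le.trans hc⟩ _ _ (hm ⟨ha, hac.le.trans hc⟩)]
    exact hbal a c ha hac hc

/-! ### Quadratic forms with continuous coefficients -/

section WeightedForm

variable {α : Type*} [TopologicalSpace α] [MeasurableSpace α] [BorelSpace α]
  {μ : Measure α} [IsFiniteMeasure μ] {X : Type*} [NormedAddCommGroup X] [NormedSpace ℝ X]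

/-- The bilinear form `∫ c (J ξ) (J' η)`, as a function of the weight `c`. -/
def weightedForm (J J' : X →L[ℝ] Lp ℝ 2 μ) :
    BoundedContinuousFunction α ℝ →L[ℝ] X →L[ℝ] X →L[ℝ] ℝ :=
  ((ContinuousLinearMap.compL ℝ X (Lp ℝ 2 μ) (X →L[ℝ] ℝ)
      (((ContinuousLinearMap.compL ℝ X (Lp ℝ 2 μ) ℝ).flip J').comp (innerCLM (Lp ℝ 2 μ)))).comp
    ((ContinuousLinearMap.compL ℝ X (Lp ℝ 2 μ) (Lp ℝ 2 μ)).flip J)).comp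
  (((ContinuousLinearMap.mul ℝ ℝ).holderL μ ⊤ 2 2).comp (BoundedContinuousFunction.toLp ⊤ μ ℝ))

theorem weightedForm_apply (J J' : X →L[ℝ] Lp ℝ 2 μ) (c : BoundedContinuousFunction α ℝ)
    (ξ η : X) : Integrable (fun x => c x * J ξ x * J' η x) μ ∧
      weightedForm J J' c ξ η = ∫ x, c x * J ξ x * J' η x ∂μ := by
  set f : Lp ℝ 2 μ := (ContinuousLinearMap.mul ℝ ℝ).holderL μ ⊤ 2 2
    (BoundedContinuousFunction.toLp ⊤ μ ℝ c) (J ξ) with hf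
  have h1 : weightedForm J J' c ξ η = inner ℝ f (J' η) := rfl
  have h2 : ∀ᵐ x ∂μ, inner ℝ (f x) (J' η x) = c x * J ξ x * J' η x := by
    filter_upwards [(ContinuousLinearMap.mul ℝ ℝ).coeFn_holder (r := 2)
      (BoundedContinuousFunction.toLp ⊤ μ ℝ c) (J ξ),
      BoundedContinuousFunction.coeFn_toLp ⊤ μ ℝ c] with x hx hx'
    have : f x = c x * J ξ x := by
      rw [← hx']
      exact hx
    rw [this]
    simp [mul_comm]
  refine ⟨(L2.integrable_inner f (J' η)).congr h2, ?_⟩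
  rw [h1, L2.inner_def]
  exact integral_congr_ae h2

/-- The form is linear and continuous in its weight, so `C²` dependence of the coefficients on `σ`,
in the uniform norm, passes to the forms in operator norm. -/
theorem contDiff_weightedForm (J J' : X →L[ℝ] Lp ℝ 2 μ) : ContDiff ℝ 2 (weightedForm J J') :=
  ContinuousLinearMap.contDiff (𝕜 := ℝ) (E := BoundedContinuousFunction α ℝ)
    (F := X →L[ℝ] X →L[ℝ] ℝ) _

end WeightedForm

namespace CrackedBody

variable (B : CrackedBody)

/-- The restriction of Lebesgue measure to the cracked domain, as a measure on the closure of the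
reference configuration. -/
def measureClosure : Measure (closure B.Ω) := (volume.restrict B.U).comap Subtype.val

theorem measurePreserving_val :
    MeasurePreserving (Subtype.val : closure B.Ω → Plane) B.measureClosure
      (volume.restrict B.U) := by
  refine ⟨measurable_subtype_coe, ?_⟩
  rw [measureClosure, map_comap_subtype_coe isClosed_closure.measurableSet,
    Measure.restrict_restrict isClosed_closure.measurableSet,
    inter_eq_right.2 (B.U_subset.trans subset_closure)]

instance : IsFiniteMeasure (volume.restrict B.U) :=
  ⟨by simpa using (B.isBounded_Ω.subset B.U_subset).measure_lt_top⟩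

instance : IsFiniteMeasure B.measureClosure := by
  refine ⟨?_⟩
  have h := B.measurePreserving_val.measure_preimage (MeasurableSet.univ).nullMeasurableSet
  rw [preimage_univ] at h
  rw [h]
  exact measure_lt_top _ _

/-- The `j`-th component of a field. -/
def component (j : Fin 2) :
    Lp Plane 2 (volume.restrict B.U) →L[ℝ] Lp ℝ 2 B.measureClosure :=
  (Lp.compMeasurePreservingₗᵢ ℝ Subtype.val B.measurePreserving_val).toContinuousLinearMap.comp
    ((EuclideanSpace.proj (𝕜 := ℝ) j).compLpL 2 (volume.restrict B.U))

theorem coeFn_component (j : Fin 2) (ξ : Lp Plane 2 (volume.restrict B.U)) :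
    ∀ᵐ y ∂B.measureClosure, B.component j ξ y = ξ (y : Plane) j := by
  have h1 := Lp.coeFn_compMeasurePreserving
    ((EuclideanSpace.proj (𝕜 := ℝ) j).compLpL 2 (volume.restrict B.U) ξ) B.measurePreserving_val
  have h2 := B.measurePreserving_val.quasiMeasurePreserving.ae
    ((EuclideanSpace.proj (𝕜 := ℝ) j).coeFn_compLpL (p := 2) (μ := volume.restrict B.U) ξ)
  filter_upwards [h1, h2] with y hy hy'
  exact hy.trans hy'

/-- The quadratic form of the energy. -/
theorem exists_quadraticForm :
    ∃ b : ℝ → Lp Plane 2 (volume.restrict B.U) →L[ℝ] Lp Plane 2 (volume.restrict B.U) →L[ℝ] ℝ,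
      ContDiffOn ℝ 2 b (Icc B.σ₀ B.σbar) ∧ ∀ σ ∈ Icc B.σ₀ B.σbar, ∀ ξ η,
        b σ ξ η = ∫ x in B.U, ∑ i, ∑ j, B.A σ x i j * ξ x j * η x i := by
  choose β hβ hβ' using B.coeff_C2
  refine ⟨fun σ => ∑ i, ∑ j, weightedForm (B.component j) (B.component i) (β i j σ), ?_, ?_⟩
  · exact ContDiffOn.sum fun i _ => ContDiffOn.sum fun j _ =>
      (contDiff_weightedForm (B.component j) (B.component i)).comp_contDiffOn (hβ i j)
  · intro σ hσ ξ η
    have hemb : MeasurableEmbedding (Subtype.val : closure B.Ω → Plane) :=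
      .subtype_coe isClosed_closure.measurableSet
    -- The continuous extensions agree with the coefficients only on `Ω`; the measure is
    -- concentrated on `U`, which is contained in `Ω`.
    have hU : ∀ᵐ y : closure B.Ω ∂B.measureClosure, (y : Plane) ∈ B.U :=
      Measure.QuasiMeasurePreserving.ae (p := fun x : Plane => x ∈ B.U)
        B.measurePreserving_val.quasiMeasurePreserving (ae_restrict_mem B.isOpen_U.measurableSet)
    have key : ∀ i j, Integrable (fun x => B.A σ x i j * ξ x j * η x i) (volume.restrict B.U) ∧
        weightedForm (B.component j) (B.component i) (β i j σ) ξ η =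
          ∫ x in B.U, B.A σ x i j * ξ x j * η x i := by
      intro i j
      obtain ⟨h1, h2⟩ := weightedForm_apply (B.component j) (B.component i) (β i j σ) ξ η
      have hae : ∀ᵐ y ∂B.measureClosure,
          β i j σ y * B.component j ξ y * B.component i η y =
            B.A σ (y : Plane) i j * ξ (y : Plane) j * η (y : Plane) i := by
        filter_upwards [hU, B.coeFn_component j ξ, B.coeFn_component i η] with y h3 h4 h5
        rw [h4, h5, hβ' i j σ hσ y (B.U_subset h3)]
        rfl
      constructor
      · rw [← B.measurePreserving_val.integrable_comp_emb hemb]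
        exact h1.congr hae
      · rw [h2, integral_congr_ae hae]
        exact B.measurePreserving_val.integral_comp hemb
          fun x => B.A σ x i j * ξ x j * η x i
    have hi : ∀ i, Integrable (fun x => ∑ j, B.A σ x i j * ξ x j * η x i)
        (volume.restrict B.U) := fun i => integrable_finsetSum _ fun j _ => (key i j).1
    have e : ∫ x in B.U, ∑ i, ∑ j, B.A σ x i j * ξ x j * η x i =
        ∑ i, ∑ j, ∫ x in B.U, B.A σ x i j * ξ x j * η x i :=
      (integral_finsetSum Finset.univ fun i _ => hi i).trans
        (Finset.sum_congr rfl fun i _ => integral_finsetSum Finset.univ fun j _ => (key i j).1)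
    refine Eq.trans ?_ e.symm
    simp only [_root_.sum_apply, (key _ _).2]

/-! ### Restriction to the cracked domain -/

/-- The crack is a null set, so both restricted measures coincide; the identity map then carries
`Lp` classes over `Ω` to classes over `U`. -/
theorem measurePreserving_id :
    MeasurePreserving (id : Plane → Plane) (volume.restrict B.U) (volume.restrict B.Ω) :=
  ⟨measurable_id, by rw [Measure.map_id, B.restrict_U]⟩

/-- Restriction of fields to the cracked domain. -/
def restrictLp (F : Type*) [NormedAddCommGroup F] [NormedSpace ℝ F] :
    Lp F 2 (volume.restrict B.Ω) →L[ℝ] Lp F 2 (volume.restrict B.U) :=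
  (Lp.compMeasurePreservingₗᵢ ℝ id B.measurePreserving_id).toContinuousLinearMap

theorem coeFn_restrictLp {F : Type*} [NormedAddCommGroup F] [NormedSpace ℝ F]
    (f : Lp F 2 (volume.restrict B.Ω)) :
    B.restrictLp F f =ᵐ[volume.restrict B.U] f :=
  Lp.coeFn_compMeasurePreserving f B.measurePreserving_id

/-- Restriction of functions and gradients to the cracked domain. -/
def restrictPair : Pair B.Ω →L[ℝ] Pair B.U :=
  (B.restrictLp ℝ).prodMap (B.restrictLp Plane)

theorem restrictPair_mem {q : Pair B.Ω} (hq : q ∈ H1 B.Ω) : B.restrictPair q ∈ H1 B.U := by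
  intro φ hφ hc hs i
  have h := hq φ hφ hc (hs.trans B.U_subset) i
  have e (f : Plane → ℝ) : ∫ x in B.Ω, f x = ∫ x in B.U, f x := by rw [B.restrict_U]
  rw [e, e] at h
  have e1 : ∀ᵐ x ∂(volume.restrict B.U), (B.restrictPair q).1 x * fderiv ℝ φ x (unitVec i) =
      q.1 x * fderiv ℝ φ x (unitVec i) := by
    filter_upwards [B.coeFn_restrictLp q.1] with x hx
    rw [← hx]
    rfl
  have e2 : ∀ᵐ x ∂(volume.restrict B.U), (B.restrictPair q).2 x i * φ x = q.2 x i * φ x := by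
    filter_upwards [B.coeFn_restrictLp q.2] with x hx
    rw [← hx]
    rfl
  rw [integral_congr_ae e1, integral_congr_ae e2]
  exact h

/-- The gradient as a continuous linear map. -/
def gradCLM : B.V →L[ℝ] Lp Plane 2 (volume.restrict B.U) :=
  LinearMap.mkContinuous (SobolevV.grad (U := B.U) (D := B.dirichlet)) 1
    fun v => by rw [one_mul]; rfl

/-- The trace operator on `V`. -/
def traceV :
    B.V →L[ℝ] Lp ℝ 2 ((μH[1] : Measure Plane).restrict B.neumann) :=
  B.neumannTrace.comp B.toH1

/-! ### The cut-off factor -/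

theorem lipschitzWith_cutoff : ∃ K, LipschitzWith K B.cutoff := by
  have h : 0 < B.σbar - B.σ₁ := sub_pos.2 B.σ₁_lt
  refine ⟨(B.σbar - B.σ₁)⁻¹.toNNReal, LipschitzWith.of_dist_le_mul fun x y => ?_⟩
  rw [Real.coe_toNNReal _ (by positivity), Real.dist_eq, Real.dist_eq, cutoff, cutoff, ← sub_div,
    abs_div, abs_of_pos h, div_eq_inv_mul]
  refine mul_le_mul_of_nonneg_left ?_ (inv_nonneg.2 h.le)
  refine (abs_max_sub_max_le_abs (B.σbar - max x B.σ₁) (B.σbar - max y B.σ₁) 0).trans ?_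
  rw [sub_sub_sub_cancel_left, abs_sub_comm]
  exact abs_max_sub_max_le_abs _ _ _

theorem cutoff_nonneg (σ : ℝ) : 0 ≤ B.cutoff σ :=
  div_nonneg (le_max_right _ _) (sub_pos.2 B.σ₁_lt).le

theorem cutoff_le_one (σ : ℝ) : B.cutoff σ ≤ 1 := by
  have h : 0 < B.σbar - B.σ₁ := sub_pos.2 B.σ₁_lt
  rw [cutoff, div_le_one h]
  exact max_le (by linarith [le_max_right σ B.σ₁]) h.le

theorem cutoff_σbar : B.cutoff B.σbar = 0 := by
  rw [cutoff, max_eq_left B.σ₁_lt.le]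
  simp

theorem cutoff_pos {σ : ℝ} (h : σ < B.σbar) : 0 < B.cutoff σ :=
  div_pos (lt_max_of_lt_left (sub_pos.2 (max_lt h B.σ₁_lt))) (sub_pos.2 B.σ₁_lt)

end CrackedBody

/-! ### The energy of the cracked body in abstract quadratic form -/

namespace Loads

variable {B : CrackedBody} {T : ℝ} (P : Loads B T)

open Classical in
/-- The boundary displacement as an element of `H¹` of the cracked domain. -/
def restrictψ (t : ℝ) : H1 B.U :=
  -- For `t` in `[0, T]` the first case always occurs; the value `0` only makes the function total.
  if h : B.restrictPair (P.ψ t) ∈ H1 B.U then ⟨B.restrictPair (P.ψ t), h⟩ else 0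

theorem coe_restrictψ {t : ℝ} (ht : t ∈ Icc 0 T) :
    (P.restrictψ t : Pair B.U) = B.restrictPair (P.ψ t) := by
  rw [restrictψ, dif_pos (B.restrictPair_mem (P.ψ_mem t ht))]

/-- The work of the boundary force on the boundary displacement. -/
def work (t : ℝ) : ℝ := inner ℝ (P.g t) (B.neumannTrace (P.restrictψ t))

/-- The work is a real-valued Lipschitz function, so it is differentiable almost everywhere whatever
the differentiability of its two factors. -/
theorem lipDiff_work : LipDiff T P.work := by
  obtain ⟨K, hK⟩ := (P.ψ_W1.lipDiff.clm B.restrictPair).lip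
  have hr : LipschitzOnWith K P.restrictψ (Icc 0 T) := by
    intro t ht s hs
    rw [Subtype.edist_eq, P.coe_restrictψ ht, P.coe_restrictψ hs]
    exact hK ht hs
  have hq : BddLipOn (fun t => B.neumannTrace (P.restrictψ t)) (Icc 0 T) :=
    (BddLipOn.of_lipschitzOnWith hr isCompact_Icc).clm B.neumannTrace
  have hw : BddLipOn P.work (Icc 0 T) :=
    P.g_W1.lipDiff.bddLipOn.bilin (innerCLM _) hq
  obtain ⟨C, hC⟩ := hw.lip
  refine ⟨⟨C, hC⟩, ?_⟩
  filter_upwards [hC.ae_differentiableWithinAt_real measurableSet_Icc, ae_restrict_mem_Ioo T]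
    with t ht htm
  exact ht.differentiableAt (Icc_mem_nhds htm.1 htm.2)

/-- Linearity of the trace separates the work of `g t` into a part linear in `v` and a part
depending on time alone. -/
theorem boundary_term {t : ℝ} (ht : t ∈ Icc 0 T) (v : B.V) :
    ∫ x in B.neumann, P.g t x * trace B.U (fun y => v.fn y + (P.ψ t).1 y) x ∂μH[1] =
      inner ℝ (P.g t) (B.traceV v) + P.work t := by
  have hq : ((B.toH1 v + P.restrictψ t : H1 B.U) : Pair B.U).1 =ᵐ[volume.restrict B.U]
      fun y => v.fn y + (P.ψ t).1 y := by
    have e : ((B.toH1 v + P.restrictψ t : H1 B.U) : Pair B.U).1 =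
        v.fn + B.restrictLp ℝ (P.ψ t).1 := by
      rw [Submodule.coe_add, P.coe_restrictψ ht]
      rfl
    rw [e]
    filter_upwards [Lp.coeFn_add v.fn (B.restrictLp ℝ (P.ψ t).1),
      B.coeFn_restrictLp (P.ψ t).1] with y h1 h2
    rw [h1, Pi.add_apply, h2]
  rw [work, ← inner_add_right, CrackedBody.traceV, ContinuousLinearMap.comp_apply, ← map_add,
    L2.inner_def]
  refine integral_congr_ae ?_
  filter_upwards [B.coeFn_neumannTrace (B.toH1 v + P.restrictψ t)] with x hx
  rw [hx, trace_congr_ae hq x]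
  simp [mul_comm]

theorem exists_form :
    ∃ b : ℝ → Lp Plane 2 (volume.restrict B.U) →L[ℝ] Lp Plane 2 (volume.restrict B.U) →L[ℝ] ℝ,
      ContDiffOn ℝ 2 b (Icc B.σ₀ B.σbar) ∧
      ∀ t ∈ Icc 0 T, ∀ v, ∀ σ ∈ Icc B.σ₀ B.σbar, P.F t v σ =
        b σ (B.gradCLM v + B.restrictLp Plane (P.ψ t).2)
          (B.gradCLM v + B.restrictLp Plane (P.ψ t).2) + σ - inner ℝ (P.g t) (B.traceV v) -
          P.work t := by
  obtain ⟨b, hb, hb'⟩ := B.exists_quadraticForm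
  refine ⟨b, hb, fun t ht v σ hσ => ?_⟩
  rw [Loads.F, P.boundary_term ht v, hb' σ hσ, ← sub_sub]
  congr 3
  refine integral_congr_ae ?_
  filter_upwards [Lp.coeFn_add (B.gradCLM v) (B.restrictLp Plane (P.ψ t).2),
    B.coeFn_restrictLp (P.ψ t).2] with x h1 h2
  simp only [h1, Pi.add_apply, h2, PiLp.add_apply]
  rfl

end Loads

end Crack

end

/-! ### The modified gradient flow of the cracked body -/

theorem theorem3p4 (B : Crack.CrackedBody) (T : ℝ) (hT : 0 < T) (P : Crack.Loads B T)
    (ε : ℝ) (hε : 0 < ε) (u₀ : B.V) :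
    ∃ (v v' : ℝ → B.V) (σ σ' : ℝ → ℝ),
      P.IsFlow ε u₀ v v' σ σ' ∧
      (∀ t ∈ Set.Icc 0 T, 0 < B.cutoff (σ t)) ∧
      IntervalIntegrable (fun τ => ‖v' τ‖ ^ 2) MeasureTheory.volume 0 T ∧
      IntervalIntegrable (fun τ => (σ' τ) ^ 2 / B.cutoff (σ τ)) MeasureTheory.volume 0 T ∧
      (∀ᵐ τ ∂(MeasureTheory.volume.restrict (Set.Icc 0 T)),
        DifferentiableAt ℝ (fun r => P.F r (v τ) (σ τ)) τ) ∧
      IntervalIntegrable (fun τ => P.dtF τ (v τ) (σ τ)) MeasureTheory.volume 0 T ∧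
      ∀ s t : ℝ, 0 ≤ s → s < t → t ≤ T →
        ε * (∫ τ in s..t, ‖v' τ‖ ^ 2) + ε * (∫ τ in s..t, (σ' τ) ^ 2 / B.cutoff (σ τ))
            + P.F t (v t) (σ t)
          ≤ P.F s (v s) (σ s) + ∫ τ in s..t, P.dtF τ (v τ) (σ τ) := by
  have := B.completeSpace_V
  obtain ⟨b, hb, hF⟩ := P.exists_form
  obtain ⟨K, hK⟩ := B.lipschitzWith_cutoff
  have hp : Crack.LipDiff T fun t => B.restrictLp Plane (P.ψ t).2 :=
    P.ψ_W1.lipDiff.clm ((B.restrictLp Plane).comp (ContinuousLinearMap.snd ℝ _ _))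
  obtain ⟨v, v', σ, σ', ⟨h1, h2, h3, h4, h5, h6, h7, h8, h9, h10⟩, hpos, i1, i2, hd, i3, hbal⟩ :=
    Crack.exists_flow B.eq_zero_of_norm_eq_zero hT B.σ₀_lt_σbar B.gradCLM hb hp P.g_W1.lipDiff
      B.traceV P.lipDiff_work hF hK B.cutoff_nonneg B.cutoff_le_one B.cutoff_σbar
      (fun _ => B.cutoff_pos) hε u₀
  -- The balance is an equality for the solution constructed; only one of its two inequalities is
  -- asserted.
  exact ⟨v, v', σ, σ', ⟨h1, h2, h3, h4, h5, h6, h7, h8, h9, h10⟩, hpos, i1, i2, hd, i3,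
    fun s t hs hst ht => (hbal s t hs hst ht).le⟩
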